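/- **Setting.** Let $T>0$, $L>0$, $I=(0,T)$. Let $f:[0,T]\times\mathbb R\times\mathbb R\to\mathbb R$ be continuous in $t\in[0,T]$ and satisfy $|f(t,x_1,y_1)-f(t,x_2,y_2)|\le L(|x_1-x_2|+|y_1-y_2|)$ for all $t\in[0,T]$ and $x_i,y_i\in\mathbb R$. Let $u$ be the solution of $u''(t)=f(t,u(t),u'(t))$ on $[0,T]$ with $u(0)=u_0$, $u'(0)=u_1$. For a partition $0=t_0<t_1<\dots<t_N=T$ put $I_n=(t_{n-1},t_n)$, $k_n=t_n-t_{n-1}$, $k=\max_n k_n$, and let $r_n\ge 2$ be integers. A $C^1$-CPG solution is a function $U\in H^2(I)$ (identified with its $C^1$ representative) with $U|_{I_n}$ a polynomial of degree at most $r_n$ for every $n$, $U(0)=u_0$, $U'(0)=u_1$, and $$\sum_{n=1}^N\int_{I_n}U''\varphi\,dt=\sum_{n=1}^N\int_{I_n}f(t,U,U')\varphi\,dt$$ for all $\varphi$ with $\varphi|_{I_n}$ a polynomial of degree at most $r_n-2$ for every $n$. For an open interval $J$ and an integer $m\ge0$, $\|v\|_{H^m(J)}^2=\sum_{j\le m}\|v^{(j)}\|_{L^2(J)}^2$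 with weak derivatives. For $\sigma=m+\theta$, $m\in\mathbb N_0$, $0<\theta<1$, $H^\sigma(J)=(H^m(J),H^{m+1}(J))_{\theta,2}$ by the $K$-method, with norm $\big(\int_0^\infty (t^{-\theta}K(t,v))^2\,\frac{dt}{t}\big)^{1/2}$, $K(t,v)=\inf_{v=v_0+v_1}\big(\|v_0\|_{H^m(J)}+t\|v_1\|_{H^{m+1}(J)}\big)$. **Theorem.** There is $k_0>0$ depending only on $T$ and $L$ such that the following holds. (i) There is a constant $C>0$ depending only on $T$ and $L$ with the following property. For every $f,u_0,u_1,u$ as above with $u\in H^2(I)$, every partition with $k_n\le k_0$ and degrees $r_n\ge3$ for all $n$, every $C^1$-CPG solution $U$, all real $s_{0,n}\ge1$ with $u|_{I_n}\in H^{s_{0,n}+1}(I_n)$, and all real $s_n$ with $1\le s_n\le\min\{r_n,s_{0,n}\}$, one has $u-U\in H^2(I)$, $$\|u-U\|_{H^1(I)}^2\le C\sum_{n=1}^N\Big(\frac{k_n}{2}\Big)^{2s_n}\frac{\Gamma(r_n-s_n+1)}{\Gamma(r_n+s_n-1)}\,\frac{1}{r_n(r_n-1)}\,\|u\|_{H^{s_n+1}(I_n)}^2,$$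 $$\|u-U\|_{H^2(I)}^2\le C\sum_{n=1}^N\Big(\frac{k_n}{2}\Big)^{2s_n-2}\frac{\Gamma(r_n-s_n+1)}{\Gamma(r_n+s_n-1)}\,\|u\|_{H^{s_n+1}(I_n)}^2 .$$ (ii) For all real $C_q\ge1$ and $s\ge1$ there is a constant $C>0$ depending only on $T,L,C_q,s$ with the following property. For every $f,u_0,u_1,u$ as above with $u\in H^{s+1}(I)$, every partition with $1\le k/k_n\le C_q$ and $k_n\le k_0$ for all $n$, every integer $r\ge3$, and every $C^1$-CPG solution $U$ with $r_n=r$ for all $n$, one has $u-U\in H^2(I)$, $$\|u-U\|_{H^1(I)}\le C\,\frac{k^{\min\{r,s\}}}{r^{s}}\,\|u\|_{H^{s+1}(I)},\qquad \|u-U\|_{H^2(I)}\le C\,\frac{k^{\min\{r,s\}-1}}{r^{s-1}}\,\|u\|_{H^{s+1}(I)} .$$ -/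

import Mathlib

open MeasureTheory Set
open scoped ENNReal ContDiff

namespace CPG

noncomputable section

/-! ### Sobolev spaces on a bounded open interval `(a, b)` -/

/-- `g` is the weak derivative of order `j` of `u` on the open interval `(a, b)`: both functions are
locally integrable on `(a, b)` and `∫ u φ⁽ʲ⁾ = (-1)ʲ ∫ g φ` for all test functions
`φ ∈ C_c^∞(a, b)`. Only the values of `u` and `g` on `(a, b)` matter. -/
def IsWeakDeriv (j : ℕ) (a b : ℝ) (u g : ℝ → ℝ) : Prop :=
  LocallyIntegrableOn u (Ioo a b) ∧ LocallyIntegrableOn g (Ioo a b) ∧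
    ∀ φ : ℝ → ℝ, ContDiff ℝ ∞ φ → HasCompactSupport φ → tsupport φ ⊆ Ioo a b →
      ∫ x, u x * iteratedDeriv j φ x = (-1) ^ j * ∫ x, g x * φ x

/-- The norm `(∑_{j ≤ m} ‖u⁽ʲ⁾‖²_{L²(a,b)})^{1/2}` of the integer-order Sobolev space `H^m(a, b)`,
with value `∞` when `u ∉ H^m(a, b)`. Weak derivatives are unique almost everywhere, so the infimum
is over a set with at most one value, and it is `∞` if one of the weak derivatives does not exist. -/
def eSobolevNormNat (m : ℕ) (a b : ℝ) (u : ℝ → ℝ) : ℝ≥0∞ :=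
  ⨅ (D : ℕ → ℝ → ℝ) (_ : ∀ j ≤ m, IsWeakDeriv j a b u (D j)),
    (∑ j ∈ Finset.range (m + 1), eLpNorm (D j) 2 (volume.restrict (Ioo a b)) ^ 2) ^ (1 / 2 : ℝ)

/-- Peetre's functional `K(t, u) = inf {‖v‖_{H^m} + t ‖w‖_{H^{m+1}} : u = v + w}` of the couple
`(H^m(a, b), H^{m+1}(a, b))`. -/
def peetreK (m : ℕ) (a b : ℝ) (u : ℝ → ℝ) (t : ℝ) : ℝ≥0∞ :=
  ⨅ w : ℝ → ℝ, eSobolevNormNat m a b (u - w) + ENNReal.ofReal t * eSobolevNormNat (m + 1) a b w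

/-- The norm `(∫₀^∞ (t^{-θ} K(t, u))² dt/t)^{1/2}` of the interpolation space
`(H^m(a, b), H^{m+1}(a, b))_{θ, 2}` obtained by the `K`-method, `0 < θ < 1`. -/
def eInterpNorm (m : ℕ) (θ : ℝ) (a b : ℝ) (u : ℝ → ℝ) : ℝ≥0∞ :=
  (∫⁻ t in Ioi (0 : ℝ), (ENNReal.ofReal (t ^ (-θ)) * peetreK m a b u t) ^ 2 / ENNReal.ofReal t)
    ^ (1 / 2 : ℝ)

open Classical in
/-- The extended norm of `H^σ(a, b)` for real `σ ≥ 0`: the standard norm for an integer `σ`, and the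
norm of `(H^m, H^{m+1})_{θ, 2}` for `σ = m + θ` with `m ∈ ℕ`, `0 < θ < 1`. -/
def eSobolevNorm (σ a b : ℝ) (u : ℝ → ℝ) : ℝ≥0∞ :=
  if (⌊σ⌋₊ : ℝ) = σ then eSobolevNormNat ⌊σ⌋₊ a b u
  else eInterpNorm ⌊σ⌋₊ (σ - ⌊σ⌋₊) a b u

/-- Membership in `H^σ(a, b)`, `σ ≥ 0`. -/
def MemSobolev (σ a b : ℝ) (u : ℝ → ℝ) : Prop := eSobolevNorm σ a b u < (⊤ : ℝ≥0∞)

/-- The norm `‖u‖_{H^σ(a, b)}` of a function `u ∈ H^σ(a, b)`. -/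
def sobolevNorm (σ a b : ℝ) (u : ℝ → ℝ) : ℝ := (eSobolevNorm σ a b u).toReal

/-! ### The initial value problem -/

/-- The right-hand side `f(t, x, y)` is continuous in `t ∈ [0, T]` and uniformly Lipschitz in
`(x, y)` with constant `L`. -/
structure IsAdmissibleRHS (T L : ℝ) (f : ℝ → ℝ → ℝ → ℝ) : Prop where
  continuousOn : ∀ x y : ℝ, ContinuousOn (fun t => f t x y) (Icc 0 T)
  lipschitz : ∀ t ∈ Icc (0 : ℝ) T, ∀ x₁ y₁ x₂ y₂ : ℝ,
    |f t x₁ y₁ - f t x₂ y₂| ≤ L * (|x₁ - x₂| + |y₁ - y₂|)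

/-- `u` solves `u'' = f(t, u, u')` on `[0, T]`, `u(0) = u₀`, `u'(0) = u₁`
(with one-sided derivatives at the end points). -/
def IsExactSolution (T : ℝ) (f : ℝ → ℝ → ℝ → ℝ) (u₀ u₁ : ℝ) (u : ℝ → ℝ) : Prop :=
  ∃ v : ℝ → ℝ,
    (∀ t ∈ Icc (0 : ℝ) T, HasDerivWithinAt u (v t) (Icc 0 T) t) ∧
    (∀ t ∈ Icc (0 : ℝ) T, HasDerivWithinAt v (f t (u t) (v t)) (Icc 0 T) t) ∧
    u 0 = u₀ ∧ v 0 = u₁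

/-! ### Partitions and the discrete problem -/

/-- A partition `0 = t₀ < t₁ < ⋯ < t_N = T` of `(0, T)` into `N` subintervals. The subinterval
with index `n : Fin N` is `(left n, right n)`. -/
structure Partition (T : ℝ) (N : ℕ) where
  node : Fin (N + 1) → ℝ
  strictMono : StrictMono node
  node_zero : node 0 = 0
  node_last : node (Fin.last N) = T

namespace Partition

variable {T : ℝ} {N : ℕ}

/-- Left end point of the `n`-th subinterval. -/
def left (P : Partition T N) (n : Fin N) : ℝ := P.node n.castSucc

/-- Right end point of the `n`-th subinterval. -/
def right (P : Partition T N) (n : Fin N) : ℝ := P.node n.succ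

/-- The local time step `k_n`. -/
def step (P : Partition T N) (n : Fin N) : ℝ := P.right n - P.left n

/-- The maximal time step `k = max_n k_n`. -/
def meshSize (P : Partition T N) : ℝ := ⨆ n, P.step n

/-- Quasi-uniformity with constant `Cq`: `1 ≤ k / k_n ≤ Cq` for all `n`. -/
def IsQuasiUniform (P : Partition T N) (Cq : ℝ) : Prop :=
  ∀ n, 1 ≤ P.meshSize / P.step n ∧ P.meshSize / P.step n ≤ Cq

end Partition

/-- The trial space: functions in `H²(0, T)` that are polynomials of degree at most `r n` on the
`n`-th subinterval. An element of `H²(0, T)` is an almost everywhere class; `U` is its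
`C¹` representative on `[0, T]`. -/
structure IsTrial {T : ℝ} {N : ℕ} (P : Partition T N) (r : Fin N → ℕ) (U : ℝ → ℝ) : Prop where
  memSobolev : MemSobolev 2 0 T U
  contDiffOn : ContDiffOn ℝ 1 U (Icc 0 T)
  piecewise : ∀ n, ∃ p : Polynomial ℝ, p.natDegree ≤ r n ∧
    ∀ t ∈ Ioo (P.left n) (P.right n), U t = p.eval t

/-- The test space: functions that are polynomials of degree at most `r n - 2` on the `n`-th
subinterval (hence square integrable on `(0, T)`), where `r n ≥ 2`. -/
def IsTest {T : ℝ} {N : ℕ} (P : Partition T N) (r : Fin N → ℕ) (φ : ℝ → ℝ) : Prop :=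
  ∀ n, ∃ q : Polynomial ℝ, q.natDegree + 2 ≤ r n ∧
    ∀ t ∈ Ioo (P.left n) (P.right n), φ t = q.eval t

/-- `U` is a solution of the `hp`-version `C¹`-continuous Petrov-Galerkin scheme. -/
structure IsCPGSolution {T : ℝ} {N : ℕ} (P : Partition T N) (r : Fin N → ℕ)
    (f : ℝ → ℝ → ℝ → ℝ) (u₀ u₁ : ℝ) (U : ℝ → ℝ) : Prop where
  isTrial : IsTrial P r U
  galerkin : ∀ φ : ℝ → ℝ, IsTest P r φ →
    ∑ n, ∫ t in Ioo (P.left n) (P.right n), iteratedDeriv 2 U t * φ t =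
      ∑ n, ∫ t in Ioo (P.left n) (P.right n), f t (U t) (deriv U t) * φ t
  initial : U 0 = u₀
  initial_deriv : derivWithin U (Icc 0 T) 0 = u₁

end

end CPG

/-!
The argument compares the discrete solution `U` with a piecewise polynomial `Q` built from the
exact solution `u`.

On each subinterval the Galerkin equations say that `U''` is the `L²` projection of `f(t, U, U')`
onto the polynomials of degree at most `r - 2` (`CPG.IsCPGSolution.isPolyProj`). Let `Q''` be the
same projection of `u''`, with `Q` and `Q'` interpolating `u` and `u'` at the left end point. Because
`r ≥ 3`, the function `u'' - Q''` is orthogonal to the linear functions, so `Q` and `Q'` interpolate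
at the right end point too (`CPG.exists_comparison_polynomial`). Then
`‖u' - Q'‖² = -(u'' - Q'', u - Q)`, and subtracting from `u - Q` a polynomial of degree at most
`r - 2` gains a factor `k / r` over `‖u'' - Q''‖` (`CPG.integral_deriv_sq_le`). The remaining part
`Q - U` is a polynomial whose second derivative is the projection of `f(t, u, u') - f(t, U, U')`; by
the Lipschitz condition an energy estimate on one short subinterval (`CPG.local_error`) and the
discrete Gronwall inequality along the nodes (`CPG.Partition.gronwall`) control it. Hence the errors
are bounded by the projection errors of `u''` alone (`CPG.stability`).

The projection error is estimated through the operator `G ↦ (-1)^σ (w^σ G^(σ))^(σ)` with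
`w = (x - a) (b - x)`. It is symmetric on polynomials, does not raise the degree, and acts on
leading coefficients in degree `M` by the factor `(M + σ)! / (M - σ)!`. This gives a spectral gap on the
orthogonal complement of the polynomials of degree at most `p`
(`PolyInterval.eigenvalue_mul_ip_le_energy`), and since `w ≤ ((b - a) / 2)²`, the `hp` estimate with
the Gamma quotient at integer orders, first for polynomials and by density for Sobolev functions
(`CPG.IsWeakChain.eL2_sub_proj_le`). For a real order `s` the estimates of the two adjacent integer
orders are combined in the K-functional, whose pointwise size is controlled by the interpolation
norm (`CPG.peetreK_le`), while log-convexity of `Γ` shows that the interpolated constants are at most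
a constant multiple of the Gamma quotient at `s` (`CPG.hpFactor_interpolate`); the result is
`CPG.bestApprox_le_eSobolevNorm`.

For a uniform degree, the Gamma quotient is bounded by a multiple of
`r^(2 - 2s)` (`CPG.exists_hpFactor_min_le`) and the squared local norms add up to at most twice the
squared global norm (`CPG.sum_eSobolevNorm_sq_le`).
-/

/-! ### Orthogonal projection onto polynomials -/

open Polynomial in
/-- `q` is the `L²(a, b)`-orthogonal projection of `g` onto the polynomials of degree at most `p`. -/
structure IsPolyProj (a b : ℝ) (p : ℕ) (g : ℝ → ℝ) (q : ℝ[X]) : Prop where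
  natDegree_le : q.natDegree ≤ p
  orthogonal : ∀ φ : ℝ[X], φ.natDegree ≤ p → ∫ x in a..b, (g x - q.eval x) * φ.eval x = 0

namespace PolyInterval

open Polynomial intervalIntegral

lemma intervalIntegrable_eval (P : ℝ[X]) (a b : ℝ) :
    IntervalIntegrable (fun x => P.eval x) volume a b :=
  P.continuous.intervalIntegrable a b

/-- A polynomial whose square has integral zero over a nondegenerate interval vanishes. -/
lemma eq_zero_of_integral_sq {a b : ℝ} (hab : a < b) {P : ℝ[X]}
    (h : ∫ x in a..b, P.eval x * P.eval x = 0) : P = 0 := by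
  have hcont : ContinuousOn (fun x => P.eval x * P.eval x) (Icc a b) := by fun_prop
  by_contra hP
  have hinf : (Ioo a b).Infinite := Ioo_infinite hab
  obtain ⟨c, hc, hne⟩ : ∃ c ∈ Ioo a b, P.eval c ≠ 0 := by
    by_contra! hcon
    exact hP (Polynomial.eq_zero_of_infinite_isRoot P (hinf.mono fun x hx => hcon x hx))
  have := integral_pos hab hcont (fun x _ => mul_self_nonneg _)
    ⟨c, Ioo_subset_Icc_self hc, mul_self_pos.2 hne⟩
  exact this.ne' h

/-- Existence of the orthogonal projection: the `L²` pairing on the finite-dimensional space of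
polynomials of degree at most `p` is definite, hence represents every functional. -/
lemma exists_isPolyProj {a b : ℝ} (hab : a < b) (p : ℕ) {g : ℝ → ℝ}
    (hg : IntervalIntegrable g volume a b) : ∃ q, IsPolyProj a b p g q := by
  let V := degreeLT ℝ (p + 1)
  have hmul : ∀ φ : ℝ[X], IntervalIntegrable (fun x => g x * φ.eval x) volume a b := fun φ =>
    hg.mul_continuousOn φ.continuous.continuousOn
  have hmul' : ∀ P φ : ℝ[X], IntervalIntegrable (fun x => P.eval x * φ.eval x) volume a b :=
    fun P φ => (P.continuous.mul φ.continuous).intervalIntegrable a b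
  let B : V →ₗ[ℝ] Module.Dual ℝ V := LinearMap.mk₂ ℝ
    (fun P φ => ∫ x in a..b, P.1.eval x * φ.1.eval x)
    (fun P Q φ => by
      simp only [Submodule.coe_add, eval_add, add_mul]
      exact integral_add (hmul' _ _) (hmul' _ _))
    (fun c P φ => by
      simp only [Submodule.coe_smul, eval_smul, smul_eq_mul, mul_assoc]
      exact integral_const_mul _ _)
    (fun P Q φ => by
      simp only [Submodule.coe_add, eval_add, mul_add]
      exact integral_add (hmul' _ _) (hmul' _ _))
    (fun c P φ => by
      simp only [Submodule.coe_smul, eval_smul, smul_eq_mul, mul_left_comm _ c]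
      exact integral_const_mul _ _)
  let ℓ : Module.Dual ℝ V :=
    { toFun := fun φ => ∫ x in a..b, g x * φ.1.eval x
      map_add' := fun P Q => by
        simp only [Submodule.coe_add, eval_add, mul_add]
        exact integral_add (hmul _) (hmul _)
      map_smul' := fun c P => by
        simp only [Submodule.coe_smul, eval_smul, smul_eq_mul, mul_left_comm _ c]
        exact integral_const_mul _ _ }
  have : FiniteDimensional ℝ V := Module.Finite.equiv (degreeLTEquiv ℝ (p + 1)).symm
  have hinj : Function.Injective B := by
    rw [injective_iff_map_eq_zero]
    intro P hP
    have h0 : B P P = 0 := by rw [hP]; rfl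
    exact Subtype.ext (eq_zero_of_integral_sq hab h0)
  have hsurj : Function.Surjective B :=
    (LinearMap.injective_iff_surjective_of_finrank_eq_finrank
      Subspace.dual_finrank_eq.symm).1 hinj
  obtain ⟨q, hq⟩ := hsurj ℓ
  have hmem : ∀ φ : ℝ[X], φ.natDegree ≤ p ↔ φ ∈ degreeLT ℝ (p + 1) := fun φ => by
    rw [mem_degreeLT, degree_lt_iff_coeff_zero, natDegree_le_iff_coeff_eq_zero]
    rfl
  refine ⟨q.1, (hmem _).2 q.2, fun φ hφ => ?_⟩
  have h1 : B q ⟨φ, (hmem φ).1 hφ⟩ = ℓ ⟨φ, (hmem φ).1 hφ⟩ := by rw [hq]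
  have h2 : ∫ x in a..b, q.1.eval x * φ.eval x = ∫ x in a..b, g x * φ.eval x := h1
  simp only [sub_mul]
  rw [integral_sub (hmul φ) (hmul' _ _), h2, sub_self]

/-- The `L²(a, b)` pairing of two polynomials. -/
noncomputable def ip (a b : ℝ) (P Q : ℝ[X]) : ℝ := ∫ x in a..b, (P * Q).eval x

variable {a b : ℝ}

lemma ip_add_left (P Q R : ℝ[X]) : ip a b (P + Q) R = ip a b P R + ip a b Q R := by
  simp only [ip, add_mul, eval_add]
  exact integral_add (intervalIntegrable_eval _ _ _) (intervalIntegrable_eval _ _ _)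

lemma ip_comm (P Q : ℝ[X]) : ip a b P Q = ip a b Q P := by simp only [ip, mul_comm]

lemma ip_C_mul_left (c : ℝ) (P Q : ℝ[X]) : ip a b (C c * P) Q = c * ip a b P Q := by
  simp only [ip, mul_assoc, eval_mul, eval_C]
  exact integral_const_mul _ _

lemma ip_self_nonneg (hab : a ≤ b) (P : ℝ[X]) : 0 ≤ ip a b P P :=
  integral_nonneg hab fun x _ => by simpa using mul_self_nonneg _

/-- Every polynomial `G` splits as `H + Q` with `H` of degree at most `p` and `Q` orthogonal to all
polynomials of degree at most `p`. -/
lemma exists_orthogonal_decomposition (hab : a < b) (p : ℕ) (G : ℝ[X]) :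
    ∃ H Q : ℝ[X], G = H + Q ∧ H.natDegree ≤ p ∧
      ∀ φ : ℝ[X], φ.natDegree ≤ p → ip a b Q φ = 0 := by
  obtain ⟨H, hH⟩ := exists_isPolyProj hab p (intervalIntegrable_eval G a b)
  refine ⟨H, G - H, by ring, hH.natDegree_le, fun φ hφ => ?_⟩
  simpa [ip] using hH.orthogonal φ hφ

/-- The weight `(x - a) (b - x)`, vanishing at both end points. -/
noncomputable def weight (a b : ℝ) : ℝ[X] := (X - C a) * (C b - X)

/-- The symmetric differential operator `G ↦ (-1)^σ (w^σ G^(σ))^(σ)`, `w = (x - a) (b - x)`. It maps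
polynomials of degree at most `M` to such polynomials, and the Legendre polynomials of `(a, b)` are
its eigenfunctions. -/
noncomputable def legendreOp (a b : ℝ) (σ : ℕ) (G : ℝ[X]) : ℝ[X] :=
  C ((-1) ^ σ) * derivative^[σ] (weight a b ^ σ * derivative^[σ] G)

/-- The eigenvalue `(M + σ)! / (M - σ)!` of `legendreOp a b σ` in degree `M`. -/
def legendreEigenvalue (σ M : ℕ) : ℕ := (M + σ).descFactorial σ * M.descFactorial σ

lemma legendreEigenvalue_mono (σ : ℕ) : Monotone (legendreEigenvalue σ) := fun _ _ h =>
  Nat.mul_le_mul (Nat.descFactorial_le _ (by omega)) (Nat.descFactorial_le _ h)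

lemma eval_weight_left : (weight a b).eval a = 0 := by simp [weight]

lemma eval_weight_right : (weight a b).eval b = 0 := by simp [weight]

/-- Repeated integration by parts; the powers of the weight cancel all boundary terms. -/
lemma ip_iterate_derivative (σ : ℕ) : ∀ Z R : ℝ[X], weight a b ^ σ ∣ Z →
    ip a b (derivative^[σ] Z) R = (-1) ^ σ * ip a b Z (derivative^[σ] R) := by
  induction σ with
  | zero => intro Z R _; simp
  | succ n ih =>
    intro Z R hZ
    have hdvd : weight a b ∣ derivative^[n] Z := by
      simpa using pow_sub_dvd_iterate_derivative_of_pow_dvd n hZ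
    obtain ⟨S, hS⟩ := hdvd
    have hibp : ip a b (derivative (derivative^[n] Z)) R
        = - ip a b (derivative^[n] Z) (derivative R) := by
      have h := integral_eq_sub_of_hasDerivAt (a := a) (b := b)
        (f := fun x => (derivative^[n] Z * R).eval x)
        (f' := fun x => (derivative (derivative^[n] Z * R)).eval x)
        (fun x _ => (derivative^[n] Z * R).hasDerivAt x) (intervalIntegrable_eval _ _ _)
      have h0 : (derivative^[n] Z * R).eval b - (derivative^[n] Z * R).eval a = 0 := by
        rw [hS]; simp [eval_weight_left, eval_weight_right]
      rw [h0, derivative_mul] at h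
      simp only [eval_add] at h
      rw [integral_add (intervalIntegrable_eval _ _ _) (intervalIntegrable_eval _ _ _)] at h
      simp only [ip]; linarith
    rw [Function.iterate_succ_apply', hibp, ih Z _ ((pow_dvd_pow _ n.le_succ).trans hZ),
      ← Function.iterate_succ_apply]
    ring

/-- The energy form `∫ w^σ G^(σ) R^(σ)` of `legendreOp`, `w = (x - a) (b - x)`. -/
noncomputable def energy (a b : ℝ) (σ : ℕ) (G R : ℝ[X]) : ℝ :=
  ip a b (weight a b ^ σ * derivative^[σ] G) (derivative^[σ] R)

lemma ip_legendreOp (σ : ℕ) (G R : ℝ[X]) : ip a b (legendreOp a b σ G) R = energy a b σ G R := by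
  rw [legendreOp, ip_C_mul_left, ip_iterate_derivative σ _ _ (Dvd.intro _ rfl), energy, ← mul_assoc,
    ← mul_pow]
  simp

lemma energy_comm (σ : ℕ) (G R : ℝ[X]) : energy a b σ G R = energy a b σ R G := by
  simp only [energy, ip]
  congr 1; ext x; congr 1; ring

lemma energy_add_left (σ : ℕ) (G H R : ℝ[X]) :
    energy a b σ (G + H) R = energy a b σ G R + energy a b σ H R := by
  simp only [energy, _root_.iterate_map_add, mul_add, ip_add_left]

lemma energy_add_self (σ : ℕ) (G H : ℝ[X]) (h : energy a b σ H G = 0) :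
    energy a b σ (H + G) (H + G) = energy a b σ H H + energy a b σ G G := by
  rw [energy_add_left, energy_comm σ H (H + G), energy_comm σ G (H + G), energy_add_left,
    energy_add_left, energy_comm σ G H, h]
  ring

lemma ip_add_self (G H : ℝ[X]) (h : ip a b G H = 0) :
    ip a b (H + G) (H + G) = ip a b H H + ip a b G G := by
  rw [ip_add_left, ip_comm H (H + G), ip_comm G (H + G), ip_add_left, ip_add_left, ip_comm H G, h]
  ring

lemma energy_self_nonneg (hab : a ≤ b) (σ : ℕ) (G : ℝ[X]) : 0 ≤ energy a b σ G G := by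
  refine integral_nonneg hab fun x hx => ?_
  have hw : 0 ≤ (weight a b).eval x := by
    simp only [weight, eval_mul, eval_sub, eval_X, eval_C]
    exact mul_nonneg (sub_nonneg.2 hx.1) (sub_nonneg.2 hx.2)
  rw [mul_assoc, eval_mul, eval_pow, eval_mul]
  exact mul_nonneg (pow_nonneg hw _) (mul_self_nonneg _)

/-- On `(a, b)` the weight is at most `((b - a) / 2)²`. -/
lemma energy_self_le (hab : a ≤ b) (σ : ℕ) (G : ℝ[X]) :
    energy a b σ G G ≤ ((b - a) / 2) ^ (2 * σ) * ∫ x in a..b, ((derivative^[σ] G).eval x) ^ 2 := by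
  rw [← intervalIntegral.integral_const_mul]
  refine integral_mono_on hab (intervalIntegrable_eval _ _ _)
    (Continuous.intervalIntegrable (by fun_prop) _ _) fun x hx => ?_
  have hw : 0 ≤ (weight a b).eval x := by
    simp only [weight, eval_mul, eval_sub, eval_X, eval_C]
    exact mul_nonneg (sub_nonneg.2 hx.1) (sub_nonneg.2 hx.2)
  have hw' : (weight a b).eval x ≤ ((b - a) / 2) ^ 2 := by
    simp only [weight, eval_mul, eval_sub, eval_X, eval_C]
    nlinarith [sq_nonneg (x - (a + b) / 2)]
  rw [mul_assoc, eval_mul, eval_pow, eval_mul, pow_mul, ← sq]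
  exact mul_le_mul_of_nonneg_right (pow_le_pow_left₀ hw hw' σ) (sq_nonneg _)

lemma natDegree_weight_le : (weight a b).natDegree ≤ 2 := by
  unfold weight; compute_degree

lemma coeff_weight_two : (weight a b).coeff 2 = -1 := by
  unfold weight; compute_degree

lemma natDegree_legendreOp_le {σ M : ℕ} {G : ℝ[X]} (hG : G.natDegree ≤ M) :
    (legendreOp a b σ G).natDegree ≤ M := by
  by_cases hσ : G.natDegree < σ
  · rw [legendreOp, iterate_derivative_eq_zero hσ]; simp
  have h1 : (weight a b ^ σ * derivative^[σ] G).natDegree ≤ M + σ := by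
    refine natDegree_mul_le.trans ?_
    have h2 := natDegree_pow_le_of_le σ (natDegree_weight_le (a := a) (b := b))
    have h3 := natDegree_iterate_derivative G σ
    omega
  refine (natDegree_C_mul_le _ _).trans ((natDegree_iterate_derivative _ _).trans ?_)
  omega

lemma coeff_legendreOp {σ M : ℕ} {G : ℝ[X]} (hG : G.natDegree ≤ M) :
    (legendreOp a b σ G).coeff M = legendreEigenvalue σ M * G.coeff M := by
  by_cases hσ : M < σ
  · rw [legendreOp, iterate_derivative_eq_zero (hG.trans_lt hσ), legendreEigenvalue,
      Nat.descFactorial_eq_zero_iff_lt.2 hσ]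
    simp
  push Not at hσ
  have h2 := natDegree_pow_le_of_le σ (natDegree_weight_le (a := a) (b := b))
  have h3 : (derivative^[σ] G).natDegree ≤ M - σ :=
    (natDegree_iterate_derivative G σ).trans (by omega)
  have h4 := coeff_mul_add_eq_of_natDegree_le h2 h3
  rw [coeff_pow_of_natDegree_le natDegree_weight_le, coeff_weight_two,
    show σ * 2 + (M - σ) = M + σ by omega, coeff_iterate_derivative, Nat.sub_add_cancel hσ] at h4
  rw [legendreOp, coeff_C_mul, coeff_iterate_derivative, h4, legendreEigenvalue]
  have : ((-1 : ℝ) ^ σ) * (-1) ^ σ = 1 := by rw [← mul_pow]; simp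
  simp only [nsmul_eq_mul, Nat.cast_mul]
  linear_combination (((M + σ).descFactorial σ : ℝ) * (M.descFactorial σ) * G.coeff M) * this

/-- Spectral gap of `legendreOp` on the orthogonal complement of the polynomials of degree at most
`p`. The top-degree component of `G` is an eigenfunction, and it splits off orthogonally for both
forms; this gives an induction on the degree. -/
lemma eigenvalue_mul_ip_le_energy (hab : a < b) (σ p j : ℕ) : ∀ G : ℝ[X], G.natDegree ≤ p + j →
    (∀ φ : ℝ[X], φ.natDegree ≤ p → ip a b G φ = 0) →
    legendreEigenvalue σ (p + 1) * ip a b G G ≤ energy a b σ G G := by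
  induction j with
  | zero =>
    intro G hG horth
    rw [horth G hG, mul_zero]
    exact energy_self_nonneg hab.le σ G
  | succ j ih =>
    intro G hG horth
    obtain ⟨H, Q, rfl, hH, hQ⟩ := exists_orthogonal_decomposition hab (p + j) G
    have hQdeg : Q.natDegree ≤ p + j + 1 := by
      have : Q = (H + Q) - H := by ring
      rw [this]
      exact (natDegree_sub_le _ _).trans (max_le hG (by omega))
    have hcross : energy a b σ H Q = 0 := by
      rw [← ip_legendreOp, ip_comm]
      exact hQ _ (natDegree_legendreOp_le hH)
    have hHorth : ∀ φ : ℝ[X], φ.natDegree ≤ p → ip a b H φ = 0 := fun φ hφ => by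
      have := horth φ hφ
      rwa [ip_add_left, hQ φ (by omega), add_zero] at this
    have hHbound := ih H hH hHorth
    have hQeig : energy a b σ Q Q = legendreEigenvalue σ (p + j + 1) * ip a b Q Q := by
      set c : ℝ := (legendreEigenvalue σ (p + j + 1) : ℝ) with hc
      have hdeg : (legendreOp a b σ Q + C (-c) * Q).natDegree ≤ p + j := by
        have h1 : (legendreOp a b σ Q + C (-c) * Q).natDegree ≤ p + j + 1 :=
          (natDegree_add_le _ _).trans (max_le (natDegree_legendreOp_le hQdeg)
            ((natDegree_C_mul_le _ _).trans hQdeg))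
        have h2 : (legendreOp a b σ Q + C (-c) * Q).coeff (p + j + 1) = 0 := by
          rw [coeff_add, coeff_legendreOp hQdeg, coeff_C_mul, ← hc]; ring
        exact natDegree_le_pred h1 h2
      have h3 := hQ _ hdeg
      rw [ip_comm, ip_add_left, ip_legendreOp, ip_C_mul_left] at h3
      linarith
    rw [energy_add_self σ Q H hcross, ip_add_self Q H (hQ H hH), hQeig, mul_add]
    have hmono : (legendreEigenvalue σ (p + 1) : ℝ) ≤ legendreEigenvalue σ (p + j + 1) := by
      exact_mod_cast legendreEigenvalue_mono σ (by omega)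
    have := mul_le_mul_of_nonneg_right hmono (ip_self_nonneg hab.le Q)
    linarith

/-- The `hp` approximation estimate for polynomials: the spectral gap applied to the part of `G`
orthogonal to the polynomials of degree at most `p`, whose energy is at most that of `G`. -/
lemma exists_approx_polynomial (hab : a < b) (σ p : ℕ) (G : ℝ[X]) :
    ∃ q : ℝ[X], q.natDegree ≤ p ∧
      legendreEigenvalue σ (p + 1) * ∫ x in a..b, (G.eval x - q.eval x) ^ 2 ≤
        ((b - a) / 2) ^ (2 * σ) * ∫ x in a..b, ((derivative^[σ] G).eval x) ^ 2 := by
  obtain ⟨H, Q, rfl, hH, hQ⟩ := exists_orthogonal_decomposition hab p G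
  refine ⟨H, hH, ?_⟩
  have h1 := eigenvalue_mul_ip_le_energy hab σ p Q.natDegree Q (by omega) hQ
  have hcross : energy a b σ H Q = 0 := by
    rw [← ip_legendreOp, ip_comm]
    exact hQ _ (natDegree_legendreOp_le hH)
  have h2 := energy_add_self σ Q H hcross
  have h3 := energy_self_nonneg hab.le σ H
  have h4 := energy_self_le hab.le σ (H + Q)
  have h5 : ∫ x in a..b, ((H + Q).eval x - H.eval x) ^ 2 = ip a b Q Q := by
    simp only [ip, eval_add, eval_mul, add_sub_cancel_left, sq]
  rw [h5]
  linarith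

end PolyInterval

/-! ### The `L²` norm on an interval -/

namespace CPG

/-- The norm of `L²(a, b)`, with value `∞` for functions that are not square integrable. -/
noncomputable abbrev eL2 (a b : ℝ) (f : ℝ → ℝ) : ℝ≥0∞ :=
  eLpNorm f 2 (volume.restrict (Ioo a b))

/-- Square integrability on `(a, b)`. -/
abbrev MemL2 (a b : ℝ) (f : ℝ → ℝ) : Prop := MemLp f 2 (volume.restrict (Ioo a b))

variable {a b : ℝ}

lemma setIntegral_Ioo_eq (hab : a ≤ b) (f : ℝ → ℝ) :
    ∫ x in Ioo a b, f x = ∫ x in a..b, f x := by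
  rw [intervalIntegral.integral_of_le hab, integral_Ioc_eq_integral_Ioo]

lemma intervalIntegrable_iff_Ioo (hab : a ≤ b) {f : ℝ → ℝ} :
    IntervalIntegrable f volume a b ↔ Integrable f (volume.restrict (Ioo a b)) := by
  rw [intervalIntegrable_iff_integrableOn_Ioo_of_le hab]; rfl

lemma MemL2.integrable {f : ℝ → ℝ} (hf : MemL2 a b f) :
    Integrable f (volume.restrict (Ioo a b)) :=
  MemLp.integrable (by norm_num) hf

lemma MemL2.intervalIntegrable {f : ℝ → ℝ} (hab : a ≤ b) (hf : MemL2 a b f) :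
    IntervalIntegrable f volume a b :=
  (intervalIntegrable_iff_Ioo hab).2 hf.integrable

lemma MemL2.intervalIntegrable_mul {f g : ℝ → ℝ} (hab : a ≤ b) (hf : MemL2 a b f)
    (hg : MemL2 a b g) : IntervalIntegrable (fun x => f x * g x) volume a b :=
  (intervalIntegrable_iff_Ioo hab).2 (MemLp.integrable_mul hf hg)

lemma memL2_of_continuousOn {f : ℝ → ℝ} (hf : ContinuousOn f (Icc a b)) : MemL2 a b f := by
  obtain ⟨C, hC⟩ := isCompact_Icc.exists_bound_of_continuousOn hf
  refine MemLp.of_bound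
    ((hf.mono Ioo_subset_Icc_self).aestronglyMeasurable measurableSet_Ioo) C ?_
  filter_upwards [ae_restrict_mem measurableSet_Ioo] with x hx
  exact hC x (Ioo_subset_Icc_self hx)

lemma memL2_eval (P : Polynomial ℝ) : MemL2 a b (fun x => P.eval x) :=
  memL2_of_continuousOn P.continuous.continuousOn

lemma eL2_sq_eq_lintegral (f : ℝ → ℝ) : eL2 a b f ^ 2 = ∫⁻ x in Ioo a b, ‖f x‖ₑ ^ 2 := by
  have h2 := eLpNorm_nnreal_pow_eq_lintegral (f := f) (μ := volume.restrict (Ioo a b))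
    (p := 2) (by norm_num)
  simp only [NNReal.coe_ofNat, ENNReal.coe_ofNat, ENNReal.rpow_ofNat] at h2
  exact h2

lemma eL2_sq (hab : a ≤ b) {f : ℝ → ℝ} (hf : MemL2 a b f) :
    eL2 a b f ^ 2 = ENNReal.ofReal (∫ x in a..b, f x ^ 2) := by
  have h : Integrable (fun x => f x ^ 2) (volume.restrict (Ioo a b)) := hf.integrable_sq
  rw [← setIntegral_Ioo_eq hab, ofReal_integral_eq_lintegral_ofReal h
    (Filter.Eventually.of_forall fun x => sq_nonneg _)]
  rw [eL2_sq_eq_lintegral]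
  refine lintegral_congr fun x => ?_
  rw [← sq_abs, ENNReal.ofReal_pow (abs_nonneg _), ← Real.enorm_eq_ofReal_abs]

/-- The Cauchy-Schwarz inequality in `L²(a, b)`. -/
lemma sq_integral_mul_le (hab : a ≤ b) {f g : ℝ → ℝ} (hf : MemL2 a b f) (hg : MemL2 a b g) :
    (∫ x in a..b, f x * g x) ^ 2 ≤ (∫ x in a..b, f x ^ 2) * ∫ x in a..b, g x ^ 2 := by
  have hff := hf.intervalIntegrable_mul hab hf
  have hfg := hf.intervalIntegrable_mul hab hg
  have hgg := hg.intervalIntegrable_mul hab hg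
  have hquad : ∀ t : ℝ, 0 ≤ (∫ x in a..b, g x ^ 2) * (t * t) + (2 * ∫ x in a..b, f x * g x) * t +
      ∫ x in a..b, f x ^ 2 := fun t => by
    have h : 0 ≤ ∫ x in a..b, (f x + t * g x) ^ 2 :=
      intervalIntegral.integral_nonneg hab fun x _ => sq_nonneg _
    have h2 : ∀ x, (f x + t * g x) ^ 2 = f x * f x + 2 * t * (f x * g x) + t * t * (g x * g x) :=
      fun x => by ring
    simp only [h2] at h
    rw [intervalIntegral.integral_add (hff.add (hfg.const_mul _)) (hgg.const_mul _),
      intervalIntegral.integral_add hff (hfg.const_mul _), intervalIntegral.integral_const_mul,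
      intervalIntegral.integral_const_mul] at h
    simp only [sq]
    linarith
  have := discrim_le_zero hquad
  rw [discrim] at this
  linarith

/-- `L²` bound of a primitive by the length of the interval. -/
lemma eL2_primitive_le {f : ℝ → ℝ} (hf : MemL2 a b f) :
    eL2 a b (fun x => ∫ t in a..x, f t) ≤ ENNReal.ofReal (b - a) * eL2 a b f := by
  rcases lt_or_ge b a with hab | hab
  · simp [eL2, Ioo_eq_empty_of_le hab.le]
  have h1 : ∀ x ∈ Ioo a b, ‖∫ t in a..x, f t‖ₑ ≤ eLpNorm f 1 (volume.restrict (Ioo a b)) := by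
    intro x hx
    rw [intervalIntegral.integral_of_le hx.1.le, eLpNorm_one_eq_lintegral_enorm]
    exact (enorm_integral_le_lintegral_enorm _).trans
      (lintegral_mono_set fun y hy => ⟨hy.1, hy.2.trans_lt hx.2⟩)
  have h2 : eLpNorm f 1 (volume.restrict (Ioo a b)) ≤
      eL2 a b f * ENNReal.ofReal (b - a) ^ (1 / 2 : ℝ) := by
    have := eLpNorm_le_eLpNorm_mul_rpow_measure_univ (p := 1) (q := 2) (by norm_num)
      hf.aestronglyMeasurable
    convert this using 3
    · simp
    · norm_num
  have h3 : eL2 a b (fun x => ∫ t in a..x, f t) ^ 2 ≤ (ENNReal.ofReal (b - a) * eL2 a b f) ^ 2 := by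
    rw [eL2_sq_eq_lintegral]
    calc ∫⁻ x in Ioo a b, ‖∫ t in a..x, f t‖ₑ ^ 2
        ≤ ∫⁻ x in Ioo a b, (eL2 a b f * ENNReal.ofReal (b - a) ^ (1 / 2 : ℝ)) ^ 2 :=
          setLIntegral_mono' measurableSet_Ioo fun x hx => by
            gcongr; exact (h1 x hx).trans h2
      _ = _ := by
          rw [setLIntegral_const, Real.volume_Ioo, mul_pow, mul_pow, ← ENNReal.rpow_natCast
            (ENNReal.ofReal (b - a) ^ (1 / 2 : ℝ)), ← ENNReal.rpow_mul]
          norm_num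
          ring
  exact (ENNReal.pow_right_strictMono two_ne_zero).le_iff_le.1 h3

/-! ### Weak derivatives on an interval -/

lemma integral_mul_test_eq (hab : a ≤ b) (g : ℝ → ℝ) {φ : ℝ → ℝ} (hφ : tsupport φ ⊆ Ioo a b) :
    ∫ x, g x * φ x = ∫ x in a..b, g x * φ x := by
  rw [← setIntegral_Ioo_eq hab]
  refine (setIntegral_eq_integral_of_forall_compl_eq_zero fun x hx => ?_).symm
  rw [image_eq_zero_of_notMem_tsupport fun h => hx (hφ h), mul_zero]

lemma integrable_mul_test {g φ : ℝ → ℝ} (hg : LocallyIntegrableOn g (Ioo a b)) (hφ : Continuous φ)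
    (hc : HasCompactSupport φ) (hs : tsupport φ ⊆ Ioo a b) : Integrable (fun x => g x * φ x) := by
  have h1 : IntegrableOn g (tsupport φ) := hg.integrableOn_compact_subset hs hc
  have h2 := h1.mul_continuousOn hφ.continuousOn hc
  refine (integrableOn_iff_integrable_of_support_subset fun x hx => ?_).1 h2
  exact subset_tsupport _ (right_ne_zero_of_mul hx)

lemma contDiff_iteratedDeriv {φ : ℝ → ℝ} (hφ : ContDiff ℝ ∞ φ) (j : ℕ) :
    ContDiff ℝ ∞ (iteratedDeriv j φ) := by
  rw [iteratedDeriv_eq_iterate]; exact hφ.iterate_deriv j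

lemma tsupport_iteratedDeriv_subset (φ : ℝ → ℝ) (j : ℕ) :
    tsupport (iteratedDeriv j φ) ⊆ tsupport φ := by
  induction j with
  | zero => simp
  | succ n ih => rw [iteratedDeriv_succ]; exact (tsupport_deriv_subset).trans ih

lemma hasCompactSupport_iteratedDeriv {φ : ℝ → ℝ} (hφ : HasCompactSupport φ) (j : ℕ) :
    HasCompactSupport (iteratedDeriv j φ) :=
  hφ.of_isClosed_subset (isClosed_tsupport _) (tsupport_iteratedDeriv_subset φ j)

lemma IsWeakDeriv.add {j : ℕ} {u g u' g' : ℝ → ℝ} (h : IsWeakDeriv j a b u g)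
    (h' : IsWeakDeriv j a b u' g') : IsWeakDeriv j a b (u + u') (g + g') := by
  refine ⟨h.1.add h'.1, h.2.1.add h'.2.1, fun φ h1 h2 h3 => ?_⟩
  simp only [Pi.add_apply, add_mul]
  have hd := (contDiff_iteratedDeriv h1 j).continuous
  have hs := (tsupport_iteratedDeriv_subset φ j).trans h3
  have hc := hasCompactSupport_iteratedDeriv h2 j
  rw [integral_add (integrable_mul_test h.1 hd hc hs) (integrable_mul_test h'.1 hd hc hs),
    integral_add (integrable_mul_test h.2.1 h1.continuous h2 h3)
      (integrable_mul_test h'.2.1 h1.continuous h2 h3), h.2.2 φ h1 h2 h3, h'.2.2 φ h1 h2 h3, mul_add]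

lemma IsWeakDeriv.neg {j : ℕ} {u g : ℝ → ℝ} (h : IsWeakDeriv j a b u g) :
    IsWeakDeriv j a b (-u) (-g) := by
  refine ⟨h.1.neg, h.2.1.neg, fun φ h1 h2 h3 => ?_⟩
  simp only [Pi.neg_apply, neg_mul, integral_neg, h.2.2 φ h1 h2 h3, mul_neg]

lemma IsWeakDeriv.sub {j : ℕ} {u g u' g' : ℝ → ℝ} (h : IsWeakDeriv j a b u g)
    (h' : IsWeakDeriv j a b u' g') : IsWeakDeriv j a b (u - u') (g - g') := by
  rw [sub_eq_add_neg, sub_eq_add_neg]; exact h.add h'.neg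

/-- Weak derivatives are unique almost everywhere. -/
lemma IsWeakDeriv.ae_eq {j : ℕ} {u g g' : ℝ → ℝ} (h : IsWeakDeriv j a b u g)
    (h' : IsWeakDeriv j a b u g') : g =ᵐ[volume.restrict (Ioo a b)] g' := by
  have h0 := h.sub h'
  have := isOpen_Ioo.ae_eq_zero_of_integral_contDiff_smul_eq_zero h0.2.1 fun φ h1 h2 h3 => by
    have := h0.2.2 φ h1 h2 h3
    simp only [sub_self, Pi.zero_apply, zero_mul, integral_zero] at this
    have h4 := (mul_eq_zero.1 this.symm).resolve_left (pow_ne_zero _ (by norm_num))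
    simpa [mul_comm] using h4
  rw [Filter.EventuallyEq, ae_restrict_iff' measurableSet_Ioo]
  filter_upwards [this] with x hx hxm
  exact sub_eq_zero.1 (hx hxm)

/-- If `g = u⁽ʲ⁾` and `h = u⁽ʲ⁺¹⁾` weakly, then `h = g'` weakly. -/
lemma IsWeakDeriv.step {j : ℕ} {u g h : ℝ → ℝ} (hg : IsWeakDeriv j a b u g)
    (hh : IsWeakDeriv (j + 1) a b u h) : IsWeakDeriv 1 a b g h := by
  refine ⟨hg.2.1, hh.2.1, fun φ h1 h2 h3 => ?_⟩
  have e1 := hh.2.2 φ h1 h2 h3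
  have e2 := hg.2.2 (iteratedDeriv 1 φ) (contDiff_iteratedDeriv h1 1)
    (hasCompactSupport_iteratedDeriv h2 1) ((tsupport_iteratedDeriv_subset φ 1).trans h3)
  rw [iteratedDeriv_one, ← iteratedDeriv_succ', e1, pow_succ, mul_assoc] at e2
  rw [iteratedDeriv_one]
  have := mul_left_cancel₀ (pow_ne_zero j (by norm_num : (-1 : ℝ) ≠ 0)) e2
  simp only [← this, pow_one]

/-- If `g = u'` and `h = g⁽ʲ⁾` weakly, then `h = u⁽ʲ⁺¹⁾` weakly. -/
lemma IsWeakDeriv.comp {j : ℕ} {u g h : ℝ → ℝ} (hg : IsWeakDeriv 1 a b u g)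
    (hh : IsWeakDeriv j a b g h) : IsWeakDeriv (j + 1) a b u h := by
  refine ⟨hg.1, hh.2.1, fun φ h1 h2 h3 => ?_⟩
  have e1 := hg.2.2 (iteratedDeriv j φ) (contDiff_iteratedDeriv h1 j)
    (hasCompactSupport_iteratedDeriv h2 j) ((tsupport_iteratedDeriv_subset φ j).trans h3)
  rw [iteratedDeriv_one, ← iteratedDeriv_succ] at e1
  rw [e1, hh.2.2 φ h1 h2 h3]
  ring

lemma IsWeakDeriv.mono {j : ℕ} {c d : ℝ} {u g : ℝ → ℝ} (h : IsWeakDeriv j a b u g)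
    (hsub : Ioo c d ⊆ Ioo a b) : IsWeakDeriv j c d u g :=
  ⟨h.1.mono_set hsub, h.2.1.mono_set hsub, fun φ h1 h2 h3 => h.2.2 φ h1 h2 (h3.trans hsub)⟩

lemma isWeakDeriv_zero_self {u : ℝ → ℝ} (hu : LocallyIntegrableOn u (Ioo a b)) :
    IsWeakDeriv 0 a b u u := ⟨hu, hu, fun φ _ _ _ => by simp⟩

/-- A primitive of an integrable function has that function as its weak derivative. -/
lemma isWeakDeriv_one_of_eq_primitive (hab : a ≤ b) {u h : ℝ → ℝ} {c : ℝ}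
    (hh : IntervalIntegrable h volume a b) (hu : ∀ x ∈ Ioo a b, u x = c + ∫ t in a..x, h t) :
    IsWeakDeriv 1 a b u h := by
  have hac := hh.absolutelyContinuousOnInterval_intervalIntegral (c := a) (by simp)
  have hcont : ContinuousOn (fun x => ∫ t in a..x, h t) (Icc a b) := by
    have := hac.continuousOn; rwa [uIcc_of_le hab] at this
  have hhI : IntegrableOn h (Ioo a b) := (intervalIntegrable_iff_Ioo hab).1 hh
  refine ⟨?_, hhI.locallyIntegrableOn,
    fun φ h1 h2 h3 => ?_⟩
  · refine ContinuousOn.locallyIntegrableOn ?_ measurableSet_Ioo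
    exact (continuousOn_const.add (hcont.mono Ioo_subset_Icc_self)).congr hu
  have hφa : φ a = 0 := image_eq_zero_of_notMem_tsupport fun h => (h3 h).1.false
  have hφb : φ b = 0 := image_eq_zero_of_notMem_tsupport fun h => (h3 h).2.false
  have hφ1 : ContDiff ℝ 1 φ := h1.of_le (by exact_mod_cast le_top)
  have hφac : AbsolutelyContinuousOnInterval φ a b :=
    ContDiffOn.absolutelyContinuousOnInterval hφ1.contDiffOn
  have hd : Continuous (deriv φ) := hφ1.continuous_deriv le_rfl
  rw [iteratedDeriv_one, integral_mul_test_eq hab u ((tsupport_deriv_subset).trans h3),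
    integral_mul_test_eq hab h h3]
  have e1 := hac.integral_mul_deriv_eq_deriv_mul hφac
  have e2 : ∫ x in a..b, deriv (fun x => ∫ t in a..x, h t) x * φ x = ∫ x in a..b, h x * φ x := by
    refine intervalIntegral.integral_congr_ae ?_
    filter_upwards [hh.ae_hasDerivAt_integral] with x hx hxm
    rw [(hx (uIoc_subset_uIcc hxm) a (by simp)).deriv]
  have e3 : ∫ x in a..b, deriv φ x = 0 := by
    rw [intervalIntegral.integral_eq_sub_of_hasDerivAt
      (fun x _ => (hφ1.differentiable one_ne_zero x).hasDerivAt) (hd.intervalIntegrable _ _),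
      hφa, hφb, sub_zero]
  have e4 : ∫ x in a..b, u x * deriv φ x =
      ∫ x in a..b, (c * deriv φ x + (∫ t in a..x, h t) * deriv φ x) := by
    rw [← setIntegral_Ioo_eq hab, ← setIntegral_Ioo_eq hab]
    refine setIntegral_congr_fun measurableSet_Ioo fun x hx => ?_
    simp only [hu x hx, add_mul]
  rw [e4, intervalIntegral.integral_add ((hd.intervalIntegrable _ _).const_mul _),
    intervalIntegral.integral_const_mul, e3, e1, e2, hφa, hφb]
  · ring
  · exact ContinuousOn.intervalIntegrable (by rw [uIcc_of_le hab]; exact hcont.mul hd.continuousOn)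

/-- A function with vanishing weak derivative is constant: every test function is, up to a multiple
of a fixed bump, the derivative of a test function. -/
lemma IsWeakDeriv.exists_ae_eq_const (hab : a < b) {u : ℝ → ℝ} (h : IsWeakDeriv 1 a b u 0) :
    ∃ c : ℝ, ∀ᵐ x ∂volume.restrict (Ioo a b), u x = c := by
  let η : ContDiffBump ((a + b) / 2) :=
    ⟨(b - a) / 8, (b - a) / 4, by linarith, by linarith⟩
  let e : ℝ → ℝ := η.normed volume
  have heC : ContDiff ℝ ∞ e := η.contDiff_normed
  have hec : HasCompactSupport e := η.hasCompactSupport_normed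
  have hes : tsupport e ⊆ Ioo a b := by
    rw [η.tsupport_normed_eq, Real.closedBall_eq_Icc]
    intro x hx
    simp only [η, mem_Icc] at hx
    constructor <;> linarith [hx.1, hx.2]
  have hei : ∫ x, e x = 1 := η.integral_normed
  have heint : Integrable e := heC.continuous.integrable_of_hasCompactSupport hec
  set c : ℝ := ∫ x, u x * e x with hc
  refine ⟨c, ?_⟩
  have hconst : LocallyIntegrableOn (fun _ : ℝ => c) (Ioo a b) :=
    (locallyIntegrable_const c).locallyIntegrableOn _
  suffices key : ∀ φ : ℝ → ℝ, ContDiff ℝ ∞ φ → HasCompactSupport φ → tsupport φ ⊆ Ioo a b →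
      ∫ x, φ x • (u x - c) = 0 by
    rw [ae_restrict_iff' measurableSet_Ioo]
    filter_upwards [isOpen_Ioo.ae_eq_zero_of_integral_contDiff_smul_eq_zero
      (h.1.sub hconst) key] with x hx hxm
    exact sub_eq_zero.1 (hx hxm)
  intro φ h1 h2 h3
  have hφint : Integrable φ := h1.continuous.integrable_of_hasCompactSupport h2
  set m : ℝ := ∫ x, φ x with hm
  -- `κ` has mean zero, so its primitive `ψ` is again a test function
  let κ : ℝ → ℝ := fun x => φ x - m * e x
  have hκC : ContDiff ℝ ∞ κ := h1.sub (contDiff_const.mul heC)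
  have hκint : Integrable κ := hφint.sub (heint.const_mul m)
  have hκ0 : ∫ x, κ x = 0 := by
    rw [integral_sub hφint (heint.const_mul m), integral_const_mul, hei, mul_one, hm, sub_self]
  let K := tsupport φ ∪ tsupport e
  have hK : IsCompact K := h2.isCompact.union hec.isCompact
  have hKne : K.Nonempty := by
    by_contra hcon
    have : e = 0 := by
      have := not_nonempty_iff_eq_empty.1 hcon
      rw [union_empty_iff] at this
      exact tsupport_eq_empty_iff.1 this.2
    rw [this] at hei; simp at hei
  have hKs : K ⊆ Ioo a b := union_subset h3 hes
  have hInf := hKs (hK.sInf_mem hKne)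
  have hSup := hKs (hK.sSup_mem hKne)
  have hκz : ∀ x ∉ K, κ x = 0 := fun x hx => by
    simp only [K, mem_union, not_or] at hx
    simp [κ, image_eq_zero_of_notMem_tsupport hx.1, image_eq_zero_of_notMem_tsupport hx.2]
  let ψ : ℝ → ℝ := fun x => ∫ t in a..x, κ t
  have hψd : ∀ x, HasDerivAt ψ (κ x) x := fun x =>
    intervalIntegral.integral_hasDerivAt_right (hκC.continuous.intervalIntegrable _ _)
      (hκC.continuous.stronglyMeasurableAtFilter _ _) hκC.continuous.continuousAt
  have hψderiv : deriv ψ = κ := funext fun x => (hψd x).deriv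
  have hψC : ContDiff ℝ ∞ ψ := by
    rw [contDiff_infty_iff_deriv]
    exact ⟨fun x => (hψd x).differentiableAt, hψderiv ▸ hκC⟩
  have hψz : Function.support ψ ⊆ Icc (sInf K) (sSup K) := by
    intro x hx
    by_contra hcon
    apply hx
    rw [mem_Icc, not_and_or, not_le, not_le] at hcon
    rcases hcon with hcon | hcon
    · refine intervalIntegral.integral_zero_ae (Filter.Eventually.of_forall fun t ht => hκz t ?_)
      intro htK
      have h5 := csInf_le hK.bddBelow htK
      have h6 : t ≤ max a x := (mem_uIoc.1 ht).elim (fun h => h.2.trans (le_max_right _ _))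
        fun h => h.2.trans (le_max_left _ _)
      exact absurd (h5.trans h6) (not_le.2 (max_lt hInf.1 hcon))
    · change ∫ t in a..x, κ t = 0
      rw [intervalIntegral.integral_of_le (by linarith [hSup.1]),
        setIntegral_eq_integral_of_forall_compl_eq_zero, hκ0]
      intro t ht
      refine hκz t fun htK => ht ⟨(hKs htK).1, (le_csSup hK.bddAbove htK).trans hcon.le⟩
  have hψt : tsupport ψ ⊆ Icc (sInf K) (sSup K) := closure_minimal hψz isClosed_Icc
  have hψc : HasCompactSupport ψ := isCompact_Icc.of_isClosed_subset (isClosed_tsupport _) hψt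
  have h7 := h.2.2 ψ hψC hψc (hψt.trans fun x hx =>
    ⟨hInf.1.trans_le hx.1, hx.2.trans_lt hSup.2⟩)
  rw [iteratedDeriv_one, hψderiv] at h7
  simp only [Pi.zero_apply, zero_mul, integral_zero, mul_zero, κ, mul_sub] at h7
  have huφ := integrable_mul_test h.1 h1.continuous h2 h3
  have hue := integrable_mul_test h.1 heC.continuous hec hes
  have h8 : ∀ x, u x * (m * e x) = m * (u x * e x) := fun x => by ring
  simp only [h8] at h7
  rw [integral_sub huφ (hue.const_mul m), integral_const_mul, ← hc] at h7
  have h9 : ∀ x, φ x • (u x - c) = u x * φ x - c * φ x := fun x => by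
    rw [smul_eq_mul]; ring
  simp only [h9]
  rw [integral_sub huφ (hφint.const_mul c), integral_const_mul, ← hm]
  linarith

/-- A function with integrable weak derivative is a primitive of it almost everywhere. -/
lemma IsWeakDeriv.exists_ae_eq_primitive (hab : a < b) {u g : ℝ → ℝ} (h : IsWeakDeriv 1 a b u g)
    (hg : IntervalIntegrable g volume a b) :
    ∃ c : ℝ, ∀ᵐ x ∂volume.restrict (Ioo a b), u x = c + ∫ t in a..x, g t := by
  have h1 := isWeakDeriv_one_of_eq_primitive (u := fun x => ∫ t in a..x, g t) (c := 0) hab.le hg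
    fun x _ => by simp
  have h2 := h.sub h1
  rw [sub_self] at h2
  obtain ⟨c, hc⟩ := h2.exists_ae_eq_const hab
  refine ⟨c, ?_⟩
  filter_upwards [hc] with x hx
  simp only [Pi.sub_apply] at hx
  linarith

end CPG

/-! ### Polynomial approximation of Sobolev functions -/

namespace CPG

open Polynomial

variable {a b : ℝ}

/-- Polynomials are dense in `L²(a, b)`. -/
lemma exists_polynomial_eL2_sub_le {h : ℝ → ℝ} (hh : MemL2 a b h) {ε : ℝ≥0∞} (hε : ε ≠ 0) :
    ∃ q : ℝ[X], eL2 a b (fun x => h x - q.eval x) ≤ ε := by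
  obtain ⟨δ, hδ, hδ2⟩ : ∃ δ : ℝ, 0 < δ ∧
      ENNReal.ofReal (b - a) ^ (1 / 2 : ℝ) * ENNReal.ofReal δ ≤ ε / 2 := by
    have hM : ENNReal.ofReal (b - a) ^ (1 / 2 : ℝ) ≠ ⊤ :=
      ENNReal.rpow_ne_top_of_nonneg (by norm_num) ENNReal.ofReal_ne_top
    obtain ⟨δ, hδ0, hδ⟩ := ENNReal.exists_nnreal_pos_mul_lt hM (ENNReal.half_pos hε).ne'
    exact ⟨δ, hδ0, by rw [mul_comm, ENNReal.ofReal_coe_nnreal]; exact hδ.le⟩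
  obtain ⟨g, -, hg1, hg2, hg3⟩ :=
    hh.exists_hasCompactSupport_eLpNorm_sub_le (by norm_num) (ENNReal.half_pos hε).ne'
  obtain ⟨q, hq⟩ := exists_polynomial_near_of_continuousOn a b g hg2.continuousOn δ hδ
  refine ⟨q, ?_⟩
  have h1 : (fun x => h x - q.eval x) = (h - g) + (fun x => g x - q.eval x) := by
    ext x; simp
  have h2 : eL2 a b (fun x => g x - q.eval x) ≤
      ENNReal.ofReal (b - a) ^ (1 / 2 : ℝ) * ENNReal.ofReal δ := by
    refine (eLpNorm_le_of_ae_bound (C := δ) ?_).trans (le_of_eq ?_)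
    · filter_upwards [ae_restrict_mem measurableSet_Ioo] with x hx
      rw [Real.norm_eq_abs, abs_sub_comm]
      exact (hq x (Ioo_subset_Icc_self hx)).le
    · simp
  rw [h1, ← ENNReal.add_halves ε]
  exact (eLpNorm_add_le (hh.aestronglyMeasurable.sub hg3.aestronglyMeasurable)
    (hg3.aestronglyMeasurable.sub (memL2_eval q).aestronglyMeasurable) (by norm_num)).trans
    (add_le_add hg1 (h2.trans hδ2))

lemma exists_derivative_eq (q : ℝ[X]) : ∃ Q : ℝ[X], derivative Q = q := by
  induction q using Polynomial.induction_on' with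
  | add p q hp hq =>
    obtain ⟨P, rfl⟩ := hp
    obtain ⟨Q, rfl⟩ := hq
    exact ⟨P + Q, derivative_add⟩
  | monomial n c =>
    refine ⟨monomial (n + 1) (c / (n + 1)), ?_⟩
    rw [derivative_monomial]
    have : (n + 1 : ℝ) ≠ 0 := by positivity
    simp [this]

/-- `D 0, …, D σ` is a chain of successive weak derivatives on `(a, b)`, all square integrable. -/
structure IsWeakChain (a b : ℝ) (σ : ℕ) (D : ℕ → ℝ → ℝ) : Prop where
  weak : ∀ j < σ, IsWeakDeriv 1 a b (D j) (D (j + 1))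
  memL2 : ∀ j ≤ σ, MemL2 a b (D j)

/-- Simultaneous approximation of a Sobolev function and of its top derivative by a polynomial:
approximate the top derivative and integrate. -/
lemma IsWeakChain.exists_polynomial (hab : a < b) {ε : ℝ≥0∞} (σ : ℕ) : ∀ (D : ℕ → ℝ → ℝ),
    IsWeakChain a b σ D → ε ≠ 0 → ∃ q : ℝ[X], eL2 a b (fun x => D 0 x - q.eval x) ≤ ε ∧
      eL2 a b (fun x => D σ x - (derivative^[σ] q).eval x) ≤ ε := by
  induction σ generalizing ε with
  | zero =>
    intro D hD hε
    obtain ⟨q, hq⟩ := exists_polynomial_eL2_sub_le (hD.memL2 0 le_rfl) hε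
    exact ⟨q, hq, hq⟩
  | succ n ih =>
    intro D hD hε
    obtain ⟨δ, hδ, hδ1, hδ2⟩ : ∃ δ : ℝ≥0∞, δ ≠ 0 ∧ δ ≤ ε ∧ ENNReal.ofReal (b - a) * δ ≤ ε := by
      obtain ⟨δ, hδ0, hδ⟩ := ENNReal.exists_nnreal_pos_mul_lt
        (ENNReal.ofReal_ne_top (r := b - a)) hε
      refine ⟨min δ ε, ?_, min_le_right _ _, ?_⟩
      · exact (lt_min (ENNReal.coe_pos.2 hδ0) (pos_iff_ne_zero.2 hε)).ne'
      · rw [mul_comm]; exact (mul_le_mul_left (min_le_left _ _) _).trans hδ.le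
    obtain ⟨q, hq1, hq2⟩ := ih (fun j => D (j + 1))
      ⟨fun j hj => hD.weak (j + 1) (by omega), fun j hj => hD.memL2 (j + 1) (by omega)⟩ hδ
    obtain ⟨c, hc⟩ := (hD.weak 0 n.succ_pos).exists_ae_eq_primitive hab
      ((hD.memL2 1 (by omega)).intervalIntegrable hab.le)
    obtain ⟨Q, rfl⟩ := exists_derivative_eq q
    have hder : derivative (Q + C (c - Q.eval a)) = derivative Q := by simp
    refine ⟨Q + C (c - Q.eval a), ?_, ?_⟩
    · have hmem : MemL2 a b (fun x => D (0 + 1) x - (derivative Q).eval x) :=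
        (hD.memL2 1 (by omega)).sub (memL2_eval _)
      have heq : (fun x => D 0 x - (Q + C (c - Q.eval a)).eval x) =ᵐ[volume.restrict (Ioo a b)]
          fun x => ∫ t in a..x, (D (0 + 1) t - (derivative Q).eval t) := by
        filter_upwards [hc, ae_restrict_mem measurableSet_Ioo] with x hx hxm
        have hi := (hD.memL2 1 (by omega)).intervalIntegrable hab.le
        have hi' : IntervalIntegrable (D (0 + 1)) volume a x := hi.mono_set (by
          rw [uIcc_of_le hab.le, uIcc_of_le hxm.1.le]; exact Icc_subset_Icc_right hxm.2.le)
        rw [intervalIntegral.integral_sub hi' (PolyInterval.intervalIntegrable_eval _ _ _),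
          intervalIntegral.integral_eq_sub_of_hasDerivAt (fun y _ => Q.hasDerivAt y)
          (PolyInterval.intervalIntegrable_eval _ _ _), hx]
        simp
        ring
      rw [eL2, eLpNorm_congr_ae heq]
      refine (eL2_primitive_le hmem).trans (le_trans ?_ hδ2)
      gcongr
    · rw [Function.iterate_succ_apply, hder]
      exact hq2.trans hδ1

/-- The orthogonal projection is the best approximation in `L²`. -/
lemma _root_.IsPolyProj.eL2_sub_le (hab : a ≤ b) {p : ℕ} {g : ℝ → ℝ} {q : ℝ[X]}
    (hq : IsPolyProj a b p g q) (hg : MemL2 a b g) {q' : ℝ[X]} (hq' : q'.natDegree ≤ p) :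
    eL2 a b (fun x => g x - q.eval x) ≤ eL2 a b (fun x => g x - q'.eval x) := by
  have hm : MemL2 a b (fun x => g x - q.eval x) := hg.sub (memL2_eval q)
  have hm' : MemL2 a b (fun x => g x - q'.eval x) := hg.sub (memL2_eval q')
  have hd : MemL2 a b (fun x => (q - q').eval x) := memL2_eval _
  refine (ENNReal.pow_right_strictMono two_ne_zero).le_iff_le.1 ?_
  rw [eL2_sq hab hm, eL2_sq hab hm']
  refine ENNReal.ofReal_le_ofReal ?_
  have hsplit : ∀ x, (g x - q'.eval x) ^ 2 = (g x - q.eval x) * (g x - q.eval x) +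
      2 * ((g x - q.eval x) * (q - q').eval x) + (q - q').eval x * (q - q').eval x := fun x => by
    rw [eval_sub]; ring
  have horth := hq.orthogonal (q - q') ((natDegree_sub_le _ _).trans (max_le hq.natDegree_le hq'))
  simp only [hsplit]
  rw [intervalIntegral.integral_add ((hm.intervalIntegrable_mul hab hm).add
      ((hm.intervalIntegrable_mul hab hd).const_mul 2)) (hd.intervalIntegrable_mul hab hd),
    intervalIntegral.integral_add (hm.intervalIntegrable_mul hab hm)
      ((hm.intervalIntegrable_mul hab hd).const_mul 2), intervalIntegral.integral_const_mul, horth]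
  have : 0 ≤ ∫ x in a..b, (q - q').eval x * (q - q').eval x :=
    intervalIntegral.integral_nonneg hab fun x _ => mul_self_nonneg _
  simp only [sq]
  linarith

lemma eL2_approx_polynomial (hab : a < b) (σ p : ℕ) (G : ℝ[X]) :
    ∃ q : ℝ[X], q.natDegree ≤ p ∧
      ENNReal.ofReal √(PolyInterval.legendreEigenvalue σ (p + 1)) *
        eL2 a b (fun x => G.eval x - q.eval x) ≤
      ENNReal.ofReal (((b - a) / 2) ^ σ) * eL2 a b (fun x => (derivative^[σ] G).eval x) := by
  obtain ⟨q, hq, h⟩ := PolyInterval.exists_approx_polynomial hab σ p G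
  refine ⟨q, hq, (ENNReal.pow_right_strictMono two_ne_zero).le_iff_le.1 ?_⟩
  have hm : MemL2 a b (fun x => G.eval x - q.eval x) := (memL2_eval G).sub (memL2_eval q)
  have hk : 0 ≤ (b - a) / 2 := by linarith
  change (_ * eL2 a b _) ^ 2 ≤ (_ * eL2 a b _) ^ 2
  rw [mul_pow, mul_pow, eL2_sq hab.le hm, eL2_sq hab.le (memL2_eval _),
    ← ENNReal.ofReal_pow (by positivity), ← ENNReal.ofReal_pow (by positivity),
    ← ENNReal.ofReal_mul (by positivity), ← ENNReal.ofReal_mul (by positivity),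
    Real.sq_sqrt (by positivity), ← pow_mul, mul_comm σ 2]
  exact ENNReal.ofReal_le_ofReal h

/-- The `hp` approximation estimate for the `L²` projection of a Sobolev function, by density of the
polynomials. -/
lemma IsWeakChain.eL2_sub_proj_le (hab : a < b) {σ p : ℕ} {D : ℕ → ℝ → ℝ}
    (hD : IsWeakChain a b σ D) {q : ℝ[X]} (hq : IsPolyProj a b p (D 0) q) :
    ENNReal.ofReal √(PolyInterval.legendreEigenvalue σ (p + 1)) *
        eL2 a b (fun x => D 0 x - q.eval x) ≤
      ENNReal.ofReal (((b - a) / 2) ^ σ) * eL2 a b (D σ) := by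
  set A := ENNReal.ofReal √(PolyInterval.legendreEigenvalue σ (p + 1))
  set B := ENNReal.ofReal (((b - a) / 2) ^ σ)
  have hA : A ≠ ⊤ := ENNReal.ofReal_ne_top
  have hB : B ≠ ⊤ := ENNReal.ofReal_ne_top
  refine ENNReal.le_of_forall_pos_le_add fun ε hε _ => ?_
  obtain ⟨δ, hδ0, hδ⟩ := ENNReal.exists_nnreal_pos_mul_lt
    (ENNReal.add_ne_top.2 ⟨hA, hB⟩) (ENNReal.coe_pos.2 hε).ne'
  obtain ⟨G, hG1, hG2⟩ := hD.exists_polynomial hab σ D (ENNReal.coe_pos.2 hδ0).ne'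
  obtain ⟨q', hq', h'⟩ := eL2_approx_polynomial hab σ p G
  have h0 := hD.memL2 0 (Nat.zero_le _)
  have hσ := hD.memL2 σ le_rfl
  have hG := (memL2_eval (a := a) (b := b) G).aestronglyMeasurable
  have hGσ := (memL2_eval (a := a) (b := b) (derivative^[σ] G)).aestronglyMeasurable
  have h1 : eL2 a b (fun x => D 0 x - q.eval x) ≤ δ + eL2 a b (fun x => G.eval x - q'.eval x) := by
    refine (hq.eL2_sub_le hab.le h0 hq').trans ?_
    have : (fun x => D 0 x - q'.eval x) =
        (fun x => D 0 x - G.eval x) + fun x => G.eval x - q'.eval x := by ext x; simp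
    rw [this]
    exact (eLpNorm_add_le (h0.aestronglyMeasurable.sub hG)
      (hG.sub (memL2_eval q').aestronglyMeasurable) (by norm_num)).trans (add_le_add hG1 le_rfl)
  have h2 : eL2 a b (fun x => (derivative^[σ] G).eval x) ≤ eL2 a b (D σ) + δ := by
    have : (fun x => (derivative^[σ] G).eval x) =
        D σ - fun x => D σ x - (derivative^[σ] G).eval x := by ext x; simp
    rw [this]
    exact (eLpNorm_sub_le hσ.aestronglyMeasurable (hσ.aestronglyMeasurable.sub hGσ)
      (by norm_num)).trans (add_le_add le_rfl hG2)
  calc A * eL2 a b (fun x => D 0 x - q.eval x)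
      ≤ A * (δ + eL2 a b (fun x => G.eval x - q'.eval x)) := by gcongr
    _ = A * δ + A * eL2 a b (fun x => G.eval x - q'.eval x) := mul_add _ _ _
    _ ≤ A * δ + B * (eL2 a b (D σ) + δ) := add_le_add le_rfl (h'.trans (by gcongr))
    _ = B * eL2 a b (D σ) + δ * (A + B) := by ring
    _ ≤ B * eL2 a b (D σ) + ε := by gcongr

end CPG

/-! ### The scale of Sobolev norms -/

namespace CPG

variable {a b : ℝ}

lemma rpow_half_sq (x : ℝ≥0∞) : (x ^ (1 / 2 : ℝ)) ^ 2 = x := by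
  rw [← ENNReal.rpow_natCast, ← ENNReal.rpow_mul]; norm_num

lemma sq_le_sq_iff_ennreal {x y : ℝ≥0∞} : x ^ 2 ≤ y ^ 2 ↔ x ≤ y :=
  (ENNReal.pow_right_strictMono two_ne_zero).le_iff_le

/-- Weak derivatives being unique, any choice of them computes the norm. -/
lemma eSobolevNormNat_eq {m : ℕ} {u : ℝ → ℝ} {D : ℕ → ℝ → ℝ}
    (hD : ∀ j ≤ m, IsWeakDeriv j a b u (D j)) :
    eSobolevNormNat m a b u = (∑ j ∈ Finset.range (m + 1), eL2 a b (D j) ^ 2) ^ (1 / 2 : ℝ) := by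
  refine le_antisymm (iInf₂_le D hD) (le_iInf₂ fun D' hD' => le_of_eq ?_)
  congr 1
  refine Finset.sum_congr rfl fun j hj => ?_
  have hj' : j ≤ m := Nat.lt_succ_iff.1 (Finset.mem_range.1 hj)
  rw [eL2, eLpNorm_congr_ae ((hD j hj').ae_eq (hD' j hj'))]

lemma eSobolevNormNat_sq {m : ℕ} {u : ℝ → ℝ} {D : ℕ → ℝ → ℝ}
    (hD : ∀ j ≤ m, IsWeakDeriv j a b u (D j)) :
    eSobolevNormNat m a b u ^ 2 = ∑ j ∈ Finset.range (m + 1), eL2 a b (D j) ^ 2 := by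
  rw [eSobolevNormNat_eq hD, rpow_half_sq]

lemma exists_weakDeriv_of_lt_top {m : ℕ} {u : ℝ → ℝ} (h : eSobolevNormNat m a b u < ⊤) :
    ∃ D : ℕ → ℝ → ℝ, ∀ j ≤ m, IsWeakDeriv j a b u (D j) := by
  by_contra! hcon
  refine h.ne (le_antisymm le_top (le_iInf₂ fun D hD => ?_))
  obtain ⟨j, hj, hj'⟩ := hcon D
  exact absurd (hD j hj) hj'

lemma eL2_le_eSobolevNormNat {m : ℕ} {u : ℝ → ℝ} {D : ℕ → ℝ → ℝ}
    (hD : ∀ j ≤ m, IsWeakDeriv j a b u (D j)) {j : ℕ} (hj : j ≤ m) :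
    eL2 a b (D j) ≤ eSobolevNormNat m a b u := by
  rw [← sq_le_sq_iff_ennreal, eSobolevNormNat_sq hD]
  exact Finset.single_le_sum (f := fun j => eL2 a b (D j) ^ 2) (fun _ _ => zero_le)
    (Finset.mem_range.2 (Nat.lt_succ_of_le hj))

lemma IsWeakDeriv.aestronglyMeasurable {j : ℕ} {u g : ℝ → ℝ} (h : IsWeakDeriv j a b u g) :
    AEStronglyMeasurable g (volume.restrict (Ioo a b)) := h.2.1.aestronglyMeasurable

lemma memL2_of_eSobolevNormNat_lt_top {m : ℕ} {u : ℝ → ℝ} {D : ℕ → ℝ → ℝ}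
    (hD : ∀ j ≤ m, IsWeakDeriv j a b u (D j)) (h : eSobolevNormNat m a b u < ⊤) {j : ℕ}
    (hj : j ≤ m) : MemL2 a b (D j) :=
  ⟨(hD j hj).aestronglyMeasurable, (eL2_le_eSobolevNormNat hD hj).trans_lt h⟩

lemma eSobolevNormNat_mono {m n : ℕ} (hmn : m ≤ n) (u : ℝ → ℝ) :
    eSobolevNormNat m a b u ≤ eSobolevNormNat n a b u := by
  by_cases h : eSobolevNormNat n a b u < ⊤
  · obtain ⟨D, hD⟩ := exists_weakDeriv_of_lt_top h
    rw [← sq_le_sq_iff_ennreal, eSobolevNormNat_sq hD, eSobolevNormNat_sq fun j hj =>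
      hD j (hj.trans hmn)]
    exact Finset.sum_le_sum_of_subset (Finset.range_subset_range.2 (by omega))
  · rw [not_lt_top_iff.1 h]; exact le_top

lemma isWeakDeriv_zero (j : ℕ) (a b : ℝ) : IsWeakDeriv j a b 0 0 :=
  ⟨locallyIntegrableOn_zero, locallyIntegrableOn_zero, fun φ _ _ _ => by simp⟩

lemma eSobolevNormNat_zero (m : ℕ) (a b : ℝ) : eSobolevNormNat m a b 0 = 0 := by
  rw [eSobolevNormNat_eq (D := fun _ => 0) fun j _ => isWeakDeriv_zero j a b]
  simp [eL2]

lemma eSobolevNormNat_add_le (m : ℕ) (u v : ℝ → ℝ) :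
    eSobolevNormNat m a b (u + v) ≤ eSobolevNormNat m a b u + eSobolevNormNat m a b v := by
  by_cases hu : eSobolevNormNat m a b u < ⊤
  swap
  · rw [not_lt_top_iff.1 hu, top_add]; exact le_top
  by_cases hv : eSobolevNormNat m a b v < ⊤
  swap
  · rw [not_lt_top_iff.1 hv, add_top]; exact le_top
  obtain ⟨D, hD⟩ := exists_weakDeriv_of_lt_top hu
  obtain ⟨E, hE⟩ := exists_weakDeriv_of_lt_top hv
  have hsum : ∀ j ≤ m, IsWeakDeriv j a b (u + v) ((fun j => D j + E j) j) := fun j hj =>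
    (hD j hj).add (hE j hj)
  rw [eSobolevNormNat_eq hD, eSobolevNormNat_eq hE, eSobolevNormNat_eq hsum]
  have h1 := ENNReal.Lp_add_le (Finset.range (m + 1)) (fun j => eL2 a b (D j))
    (fun j => eL2 a b (E j)) (p := 2) (by norm_num)
  simp only [ENNReal.rpow_ofNat] at h1
  refine le_trans ?_ h1
  gcongr with j hj
  have hj' : j ≤ m := Nat.lt_succ_iff.1 (Finset.mem_range.1 hj)
  exact eLpNorm_add_le (hD j hj').aestronglyMeasurable (hE j hj').aestronglyMeasurable
    (by norm_num)

/-! ### The K-functional -/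

lemma peetreK_mono (m : ℕ) (u : ℝ → ℝ) {s t : ℝ} (hst : s ≤ t) :
    peetreK m a b u s ≤ peetreK m a b u t :=
  iInf_mono fun w => by gcongr

/-- The weight `t ^ (-θ)` and the measure `dt / t` are comparable to constants on `[t, 2t]`, which
turns the `L²` norm defining the interpolation space into a pointwise bound. -/
lemma peetreK_le (m : ℕ) (u : ℝ → ℝ) {θ t : ℝ} (hθ0 : 0 < θ) (hθ1 : θ < 1) (ht : 0 < t) :
    peetreK m a b u t ≤ ENNReal.ofReal (√8 * t ^ θ) * eInterpNorm m θ a b u := by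
  rw [← sq_le_sq_iff_ennreal, mul_pow, eInterpNorm, rpow_half_sq]
  set K := peetreK m a b u t
  have h2t : 0 < 2 * t := by linarith
  have h1 : ENNReal.ofReal ((2 * t) ^ (-θ)) ^ 2 * K ^ 2 / ENNReal.ofReal (2 * t)
        * ENNReal.ofReal t ≤
      ∫⁻ τ in Ioi (0 : ℝ),
        (ENNReal.ofReal (τ ^ (-θ)) * peetreK m a b u τ) ^ 2 / ENNReal.ofReal τ := by
    calc _ = ∫⁻ _ in Ioc t (2 * t),
          (ENNReal.ofReal ((2 * t) ^ (-θ)) * K) ^ 2 / ENNReal.ofReal (2 * t) := by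
          rw [setLIntegral_const, Real.volume_Ioc, mul_pow]; congr 2; ring
      _ ≤ ∫⁻ τ in Ioc t (2 * t),
          (ENNReal.ofReal (τ ^ (-θ)) * peetreK m a b u τ) ^ 2 / ENNReal.ofReal τ := by
          refine setLIntegral_mono' measurableSet_Ioc fun τ hτ => ?_
          have hτ0 : 0 < τ := ht.trans hτ.1
          have h3 : (2 * t) ^ (-θ) ≤ τ ^ (-θ) :=
            Real.rpow_le_rpow_of_nonpos hτ0 hτ.2 (by linarith)
          have h4 := peetreK_mono (a := a) (b := b) m u hτ.1.le
          have h5 := hτ.2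
          gcongr
      _ ≤ _ := lintegral_mono_set fun τ hτ => ht.trans hτ.1
  refine le_trans ?_ (mul_le_mul_right h1 _)
  rw [← ENNReal.ofReal_pow (by positivity), ← ENNReal.ofReal_pow (by positivity),
    div_eq_mul_inv, ← ENNReal.ofReal_inv_of_pos h2t]
  have h6 : ENNReal.ofReal ((√8 * t ^ θ) ^ 2) * (ENNReal.ofReal (((2 * t) ^ (-θ)) ^ 2) * K ^ 2 *
      ENNReal.ofReal (2 * t)⁻¹ * ENNReal.ofReal t) =
      ENNReal.ofReal ((√8 * t ^ θ) ^ 2 * ((2 * t) ^ (-θ)) ^ 2 * (2 * t)⁻¹ * t) * K ^ 2 := by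
    rw [ENNReal.ofReal_mul (by positivity), ENNReal.ofReal_mul (by positivity),
      ENNReal.ofReal_mul (by positivity)]
    ring
  rw [h6]
  have h7 : 1 ≤ (√8 * t ^ θ) ^ 2 * ((2 * t) ^ (-θ)) ^ 2 * (2 * t)⁻¹ * t := by
    have e1 : t ^ θ * (2 * t) ^ (-θ) = 2 ^ (-θ) := by
      rw [Real.mul_rpow (by norm_num) ht.le, mul_left_comm, ← Real.rpow_add ht]; simp
    have e2 : (√8 * t ^ θ) ^ 2 * ((2 * t) ^ (-θ)) ^ 2 * (2 * t)⁻¹ * t =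
        √8 ^ 2 * (t ^ θ * (2 * t) ^ (-θ)) ^ 2 * ((2 * t)⁻¹ * t) := by ring
    have e3 : (2 : ℝ)⁻¹ ≤ 2 ^ (-θ) := by
      rw [← Real.rpow_neg_one]
      exact Real.rpow_le_rpow_of_exponent_le (by norm_num) (by linarith)
    have e4 : (2 * t)⁻¹ * t = 2⁻¹ := by field_simp
    rw [e2, e1, e4, Real.sq_sqrt (by norm_num)]
    nlinarith
  calc K ^ 2 = ENNReal.ofReal 1 * K ^ 2 := by simp
    _ ≤ _ := by gcongr

lemma eSobolevNormNat_le_peetreK_one (m : ℕ) (u : ℝ → ℝ) :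
    eSobolevNormNat m a b u ≤ peetreK m a b u 1 := by
  refine le_iInf fun w => ?_
  have h := eSobolevNormNat_add_le (a := a) (b := b) m (u - w) w
  rw [sub_add_cancel] at h
  rw [ENNReal.ofReal_one, one_mul]
  exact h.trans (add_le_add le_rfl (eSobolevNormNat_mono m.le_succ w))

lemma peetreK_le_eSobolevNormNat (m : ℕ) (u : ℝ → ℝ) (t : ℝ) :
    peetreK m a b u t ≤ eSobolevNormNat m a b u := by
  refine (iInf_le _ 0).trans ?_
  rw [eSobolevNormNat_zero, sub_zero, mul_zero, add_zero]

lemma peetreK_le_mul_eSobolevNormNat (m : ℕ) (u : ℝ → ℝ) (t : ℝ) :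
    peetreK m a b u t ≤ ENNReal.ofReal t * eSobolevNormNat (m + 1) a b u := by
  refine (iInf_le _ u).trans ?_
  rw [sub_self, eSobolevNormNat_zero, zero_add]

/-! ### Embeddings and restrictions -/

lemma eSobolevNorm_natCast (m : ℕ) (a b : ℝ) (u : ℝ → ℝ) :
    eSobolevNorm m a b u = eSobolevNormNat m a b u := by
  simp [eSobolevNorm]

lemma eSobolevNorm_two (a b : ℝ) (u : ℝ → ℝ) :
    eSobolevNorm 2 a b u = eSobolevNormNat 2 a b u := by
  exact_mod_cast eSobolevNorm_natCast 2 a b u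

lemma eSobolevNorm_one (a b : ℝ) (u : ℝ → ℝ) :
    eSobolevNorm 1 a b u = eSobolevNormNat 1 a b u := by
  exact_mod_cast eSobolevNorm_natCast 1 a b u

lemma floor_lt_of_ne {σ : ℝ} (hσ : 0 ≤ σ) (h : (⌊σ⌋₊ : ℝ) ≠ σ) :
    0 < σ - ⌊σ⌋₊ ∧ σ - ⌊σ⌋₊ < 1 := by
  have h1 := lt_of_le_of_ne (Nat.floor_le hσ) h
  have h2 := Nat.lt_floor_add_one σ
  constructor <;> linarith

/-- The embedding of `H^σ` into the integer-order space below it. -/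
lemma eSobolevNormNat_le_eSobolevNorm {σ : ℝ} (hσ : 0 ≤ σ) {m : ℕ} (hm : m ≤ ⌊σ⌋₊) (u : ℝ → ℝ) :
    eSobolevNormNat m a b u ≤ ENNReal.ofReal √8 * eSobolevNorm σ a b u := by
  refine (eSobolevNormNat_mono hm u).trans ?_
  by_cases h : (⌊σ⌋₊ : ℝ) = σ
  · rw [eSobolevNorm, if_pos h]
    refine le_mul_of_one_le_left (zero_le) ?_
    rw [ENNReal.one_le_ofReal, Real.one_le_sqrt]
    norm_num
  · rw [eSobolevNorm, if_neg h]
    obtain ⟨h1, h2⟩ := floor_lt_of_ne hσ h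
    simpa using (eSobolevNormNat_le_peetreK_one _ u).trans (peetreK_le _ u h1 h2 one_pos)

lemma MemSobolev.eSobolevNormNat_lt_top {σ : ℝ} (hσ : 0 ≤ σ) {u : ℝ → ℝ}
    (h : MemSobolev σ a b u) {m : ℕ} (hm : m ≤ ⌊σ⌋₊) : eSobolevNormNat m a b u < ⊤ :=
  (eSobolevNormNat_le_eSobolevNorm hσ hm u).trans_lt (ENNReal.mul_lt_top ENNReal.ofReal_lt_top h)

lemma lintegral_rpow_Ioi_one_lt_top {θ : ℝ} (hθ : 0 < θ) :
    ∫⁻ t in Ioi (1 : ℝ), ENNReal.ofReal (t ^ (-θ)) ^ 2 / ENNReal.ofReal t < ⊤ := by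
  have h := (integrableOn_Ioi_rpow_of_lt (a := -2 * θ - 1) (c := 1) (by linarith)
    one_pos).hasFiniteIntegral
  rw [hasFiniteIntegral_iff_enorm] at h
  refine lt_of_le_of_lt (setLIntegral_mono' measurableSet_Ioi fun t ht => le_of_eq ?_) h
  have ht0 : (0 : ℝ) < t := one_pos.trans ht
  rw [Real.enorm_eq_ofReal (by positivity), ← ENNReal.ofReal_pow (by positivity),
    ← ENNReal.ofReal_div_of_pos ht0, ← Real.rpow_natCast, ← Real.rpow_mul ht0.le,
    Real.rpow_sub_one ht0.ne']
  norm_num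
  ring_nf

lemma lintegral_rpow_Ioc_lt_top {θ : ℝ} (hθ : θ < 1) :
    ∫⁻ t in Ioc (0 : ℝ) 1, (ENNReal.ofReal (t ^ (-θ)) * ENNReal.ofReal t) ^ 2 / ENNReal.ofReal t
      < ⊤ := by
  have h := (intervalIntegral.intervalIntegrable_rpow' (a := 0) (b := 1) (r := 1 - 2 * θ)
    (by linarith)).1.hasFiniteIntegral
  rw [hasFiniteIntegral_iff_enorm] at h
  refine lt_of_le_of_lt (setLIntegral_mono' measurableSet_Ioc fun t ht => le_of_eq ?_) h
  have ht0 : (0 : ℝ) < t := ht.1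
  rw [Real.enorm_eq_ofReal (by positivity), ← ENNReal.ofReal_mul (by positivity),
    ← ENNReal.ofReal_pow (by positivity),
    ← ENNReal.ofReal_div_of_pos ht0, mul_pow, ← Real.rpow_natCast, ← Real.rpow_mul ht0.le,
    sub_eq_add_neg, Real.rpow_add ht0]
  congr 1
  field_simp
  norm_num
  ring_nf

lemma eInterpNorm_lt_top_iff {m : ℕ} {θ : ℝ} {u : ℝ → ℝ} :
    eInterpNorm m θ a b u < ⊤ ↔ ∫⁻ t in Ioi (0 : ℝ),
      (ENNReal.ofReal (t ^ (-θ)) * peetreK m a b u t) ^ 2 / ENNReal.ofReal t < ⊤ := by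
  rw [eInterpNorm, ENNReal.rpow_lt_top_iff_of_pos (by norm_num)]

/-- Only the behaviour of the K-functional near `t = 0` matters for membership. -/
lemma eInterpNorm_lt_top {m : ℕ} {θ : ℝ} (hθ : 0 < θ) {u : ℝ → ℝ}
    (h0 : eSobolevNormNat m a b u < ⊤)
    (h1 : ∫⁻ t in Ioc (0 : ℝ) 1,
      (ENNReal.ofReal (t ^ (-θ)) * peetreK m a b u t) ^ 2 / ENNReal.ofReal t < ⊤) :
    eInterpNorm m θ a b u < ⊤ := by
  rw [eInterpNorm_lt_top_iff, ← Ioc_union_Ioi_eq_Ioi zero_le_one,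
    lintegral_union measurableSet_Ioi (Ioc_disjoint_Ioi le_rfl)]
  refine ENNReal.add_lt_top.2 ⟨h1, ?_⟩
  have h2 : ∫⁻ t in Ioi (1 : ℝ),
      (ENNReal.ofReal (t ^ (-θ)) * peetreK m a b u t) ^ 2 / ENNReal.ofReal t ≤
      ∫⁻ t in Ioi (1 : ℝ), eSobolevNormNat m a b u ^ 2 *
        (ENNReal.ofReal (t ^ (-θ)) ^ 2 / ENNReal.ofReal t) := by
    refine lintegral_mono fun t => ?_
    rw [mul_pow, mul_comm, ← mul_div_assoc]
    gcongr
    exact peetreK_le_eSobolevNormNat m u t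
  refine h2.trans_lt ?_
  rw [lintegral_const_mul' _ _ (ENNReal.pow_ne_top h0.ne)]
  exact ENNReal.mul_lt_top (ENNReal.pow_lt_top h0) (lintegral_rpow_Ioi_one_lt_top hθ)

/-- The Sobolev spaces decrease with the order of smoothness. -/
lemma MemSobolev.of_le {σ τ : ℝ} (hτ : 0 ≤ τ) (hτσ : τ ≤ σ) {u : ℝ → ℝ}
    (h : MemSobolev σ a b u) : MemSobolev τ a b u := by
  have hσ : 0 ≤ σ := hτ.trans hτσ
  have hfl : ⌊τ⌋₊ ≤ ⌊σ⌋₊ := Nat.floor_mono hτσ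
  by_cases hτi : (⌊τ⌋₊ : ℝ) = τ
  · rw [MemSobolev, eSobolevNorm, if_pos hτi]
    exact h.eSobolevNormNat_lt_top hσ hfl
  rw [MemSobolev, eSobolevNorm, if_neg hτi]
  obtain ⟨h1, h2⟩ := floor_lt_of_ne hτ hτi
  refine eInterpNorm_lt_top h1 (h.eSobolevNormNat_lt_top hσ hfl) ?_
  rcases hfl.lt_or_eq with hlt | heq
  · have h3 := h.eSobolevNormNat_lt_top hσ (m := ⌊τ⌋₊ + 1) hlt
    refine lt_of_le_of_lt (lintegral_mono fun t => ?_) (?_ : ∫⁻ t in Ioc (0 : ℝ) 1,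
      eSobolevNormNat (⌊τ⌋₊ + 1) a b u ^ 2 *
      ((ENNReal.ofReal (t ^ (-(τ - ⌊τ⌋₊))) * ENNReal.ofReal t) ^ 2 / ENNReal.ofReal t) < ⊤)
    · rw [← mul_div_assoc, ← mul_pow, mul_comm (eSobolevNormNat _ _ _ _), mul_assoc]
      gcongr
      exact peetreK_le_mul_eSobolevNormNat _ u t
    · rw [lintegral_const_mul' _ _ (ENNReal.pow_ne_top h3.ne)]
      exact ENNReal.mul_lt_top (ENNReal.pow_lt_top h3) (lintegral_rpow_Ioc_lt_top h2)
  · have hσi : (⌊σ⌋₊ : ℝ) ≠ σ := fun hcon => by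
      rw [← heq] at hcon
      linarith
    rw [MemSobolev, eSobolevNorm, if_neg hσi, eInterpNorm_lt_top_iff, ← heq] at h
    refine lt_of_le_of_lt ?_ h
    refine le_trans ?_ (lintegral_mono_set (Ioc_subset_Ioi_self : Ioc (0 : ℝ) 1 ⊆ Ioi 0))
    refine setLIntegral_mono' measurableSet_Ioc fun t ht => ?_
    have : t ^ (-(τ - ⌊τ⌋₊)) ≤ t ^ (-(σ - ⌊τ⌋₊)) :=
      Real.rpow_le_rpow_of_exponent_ge ht.1 ht.2 (by linarith)
    gcongr

section Restriction

variable {ι : Type*} [Fintype ι] {c d : ι → ℝ}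

lemma sum_eL2_sq_le (hdisj : Pairwise (Function.onFun Disjoint fun i => Ioo (c i) (d i)))
    (hsub : ∀ i, Ioo (c i) (d i) ⊆ Ioo a b) (f : ℝ → ℝ) :
    ∑ i, eL2 (c i) (d i) f ^ 2 ≤ eL2 a b f ^ 2 := by
  simp only [eL2_sq_eq_lintegral]
  rw [← tsum_fintype (L := .unconditional ι), ← lintegral_iUnion (fun i => measurableSet_Ioo) hdisj]
  exact lintegral_mono_set (iUnion_subset hsub)

lemma sum_eSobolevNormNat_sq_le
    (hdisj : Pairwise (Function.onFun Disjoint fun i => Ioo (c i) (d i)))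
    (hsub : ∀ i, Ioo (c i) (d i) ⊆ Ioo a b) (m : ℕ) (u : ℝ → ℝ) :
    ∑ i, eSobolevNormNat m (c i) (d i) u ^ 2 ≤ eSobolevNormNat m a b u ^ 2 := by
  by_cases h : eSobolevNormNat m a b u < ⊤
  swap
  · rw [not_lt_top_iff.1 h]; simp
  obtain ⟨D, hD⟩ := exists_weakDeriv_of_lt_top h
  rw [eSobolevNormNat_sq hD]
  have h1 : ∀ i, eSobolevNormNat m (c i) (d i) u ^ 2 =
      ∑ j ∈ Finset.range (m + 1), eL2 (c i) (d i) (D j) ^ 2 := fun i =>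
    eSobolevNormNat_sq fun j hj => (hD j hj).mono (hsub i)
  simp only [h1]
  rw [Finset.sum_comm]
  exact Finset.sum_le_sum fun j _ => sum_eL2_sq_le hdisj hsub (D j)

lemma add_sq_le_ennreal (x y : ℝ≥0∞) : (x + y) ^ 2 ≤ 2 * (x ^ 2 + y ^ 2) := by
  have := ENNReal.rpow_add_le_mul_rpow_add_rpow x y (p := 2) (by norm_num)
  norm_num at this
  exact this

/-- Restricting one splitting `u = (u - w) + w` to the subintervals bounds all local K-functionals at
once. -/
lemma sum_peetreK_sq_le (hdisj : Pairwise (Function.onFun Disjoint fun i => Ioo (c i) (d i)))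
    (hsub : ∀ i, Ioo (c i) (d i) ⊆ Ioo a b) (m : ℕ) (u : ℝ → ℝ) (t : ℝ) :
    ∑ i, peetreK m (c i) (d i) u t ^ 2 ≤ 2 * peetreK m a b u t ^ 2 := by
  have key : ((∑ i, peetreK m (c i) (d i) u t ^ 2) / 2) ^ (1 / 2 : ℝ) ≤ peetreK m a b u t := by
    refine le_iInf fun w => ?_
    rw [← sq_le_sq_iff_ennreal, rpow_half_sq]
    refine ENNReal.div_le_of_le_mul ?_
    have hA := sum_eSobolevNormNat_sq_le hdisj hsub m (u - w)
    have hB := sum_eSobolevNormNat_sq_le hdisj hsub (m + 1) w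
    set A := eSobolevNormNat m a b (u - w)
    set B := eSobolevNormNat (m + 1) a b w
    calc ∑ i, peetreK m (c i) (d i) u t ^ 2
        ≤ ∑ i, 2 * (eSobolevNormNat m (c i) (d i) (u - w) ^ 2 +
            ENNReal.ofReal t ^ 2 * eSobolevNormNat (m + 1) (c i) (d i) w ^ 2) := by
          refine Finset.sum_le_sum fun i _ => ?_
          rw [← mul_pow]
          refine le_trans ?_ (add_sq_le_ennreal _ _)
          gcongr
          exact iInf_le _ w
      _ ≤ 2 * (A ^ 2 + ENNReal.ofReal t ^ 2 * B ^ 2) := by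
          rw [← Finset.mul_sum, Finset.sum_add_distrib, ← Finset.mul_sum]
          gcongr
      _ ≤ (A + ENNReal.ofReal t * B) ^ 2 * 2 := by
          rw [← mul_pow, mul_comm]
          gcongr
          rw [add_sq, add_right_comm]
          exact le_self_add
  rw [← sq_le_sq_iff_ennreal, rpow_half_sq] at key
  rw [mul_comm]
  exact (ENNReal.div_le_iff two_ne_zero ENNReal.ofNat_ne_top).1 key

/-- For lower integrals of functions that need not be measurable only this inequality holds. -/
lemma sum_lintegral_le {α κ : Type*} [MeasurableSpace α] (μ : Measure α) (s : Finset κ)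
    (f : κ → α → ℝ≥0∞) : ∑ i ∈ s, ∫⁻ x, f i x ∂μ ≤ ∫⁻ x, ∑ i ∈ s, f i x ∂μ := by
  classical
  induction s using Finset.induction_on with
  | empty => simp
  | insert i s hi ih =>
    simp only [Finset.sum_insert hi]
    exact (add_le_add le_rfl ih).trans (le_lintegral_add _ _)

/-- The squared Sobolev norms over disjoint subintervals add up to at most twice the squared norm
over the whole interval. -/
lemma sum_eSobolevNorm_sq_le (hdisj : Pairwise (Function.onFun Disjoint fun i => Ioo (c i) (d i)))
    (hsub : ∀ i, Ioo (c i) (d i) ⊆ Ioo a b) (σ : ℝ) (u : ℝ → ℝ) :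
    ∑ i, eSobolevNorm σ (c i) (d i) u ^ 2 ≤ 2 * eSobolevNorm σ a b u ^ 2 := by
  by_cases h : (⌊σ⌋₊ : ℝ) = σ
  · simp only [eSobolevNorm, if_pos h]
    exact (sum_eSobolevNormNat_sq_le hdisj hsub _ u).trans
      (le_mul_of_one_le_left (zero_le) one_le_two)
  simp only [eSobolevNorm, if_neg h, eInterpNorm, rpow_half_sq]
  refine (sum_lintegral_le _ _ _).trans ?_
  rw [← lintegral_const_mul' _ _ ENNReal.ofNat_ne_top]
  refine lintegral_mono fun t => ?_
  simp only [mul_pow, div_eq_mul_inv]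
  rw [← Finset.sum_mul, ← Finset.mul_sum, ← mul_assoc, mul_left_comm]
  gcongr
  exact sum_peetreK_sq_le hdisj hsub _ u t

lemma MemSobolev.mono_interval {c d : ℝ} (hsub : Ioo c d ⊆ Ioo a b) {σ : ℝ} {u : ℝ → ℝ}
    (h : MemSobolev σ a b u) : MemSobolev σ c d u := by
  have h1 := sum_eSobolevNorm_sq_le (ι := Unit) (c := fun _ => c) (d := fun _ => d)
    (fun i j hij => absurd rfl hij) (fun _ => hsub) σ u
  simp only [Finset.univ_unique, Finset.sum_const, Finset.card_singleton, one_smul] at h1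
  have h2 := h1.trans_lt (ENNReal.mul_lt_top ENNReal.ofNat_lt_top (ENNReal.pow_lt_top h))
  exact (ENNReal.pow_lt_top_iff.1 h2).resolve_right two_ne_zero

end Restriction

end CPG

/-! ### Quotients of Gamma functions -/

namespace CPG

open Real in
/-- Log-convexity of `Γ` alone bounds `Γ(x + 1 - θ)` from above by the left-hand side; the reverse
bound, up to a factor two, applies log-convexity between `x + 1 - θ` and `x + 2 - θ`, where `x + 1`
is a convex combination. -/
lemma rpow_mul_Gamma_le {x θ : ℝ} (hx : 1 ≤ x) (hθ0 : 0 < θ) (hθ1 : θ < 1) :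
    Gamma (x + 1) ^ (1 - θ) * Gamma x ^ θ ≤ 2 * Gamma (x + 1 - θ) := by
  have hx0 : 0 < x := by linarith
  have hz : 0 < x + 1 - θ := by linarith
  have h1 := Gamma_mul_add_mul_le_rpow_Gamma_mul_rpow_Gamma (s := x + 1 - θ) (t := x + 1 - θ + 1)
    hz (by linarith) (sub_pos.2 hθ1) hθ0 (by ring)
  have hG := Gamma_pos_of_pos hz
  have hGx := Gamma_pos_of_pos hx0
  rw [show (1 - θ) * (x + 1 - θ) + θ * (x + 1 - θ + 1) = x + 1 by ring, Gamma_add_one hz.ne',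
    mul_rpow hz.le hG.le, mul_left_comm, ← rpow_add hG, sub_add_cancel, rpow_one] at h1
  have h2 : (x + 1 - θ) ^ θ ≤ 2 * x ^ θ := by
    calc (x + 1 - θ) ^ θ ≤ (2 * x) ^ θ := rpow_le_rpow hz.le (by linarith) hθ0.le
      _ = 2 ^ θ * x ^ θ := mul_rpow (by norm_num) hx0.le
      _ ≤ 2 ^ (1 : ℝ) * x ^ θ := by
          gcongr
          · norm_num
      _ = 2 * x ^ θ := by rw [rpow_one]
  have hxθ : 0 < x ^ θ := rpow_pos_of_pos hx0 θ
  have h3 : Gamma (x + 1) ^ (1 - θ) * Gamma x ^ θ * x ^ θ = Gamma (x + 1) := by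
    rw [mul_assoc, mul_comm (Gamma x ^ θ), ← mul_rpow hx0.le hGx.le, ← Gamma_add_one hx0.ne',
      ← rpow_add (Gamma_pos_of_pos (by linarith)), sub_add_cancel, rpow_one]
  refine le_of_mul_le_mul_right ?_ hxθ
  rw [h3]
  calc Gamma (x + 1) ≤ (x + 1 - θ) ^ θ * Gamma (x + 1 - θ) := h1
    _ ≤ 2 * x ^ θ * Gamma (x + 1 - θ) := by gcongr
    _ = _ := by ring

/-- The Gamma quotient `Γ(r - s + 1) / Γ(r + s - 1)` of the `hp` estimates. -/
noncomputable def hpFactor (r s : ℝ) : ℝ := Real.Gamma (r - s + 1) / Real.Gamma (r + s - 1)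

lemma hpFactor_pos {r s : ℝ} (hs : 1 ≤ s) (hsr : s ≤ r) : 0 < hpFactor r s :=
  div_pos (Real.Gamma_pos_of_pos (by linarith)) (Real.Gamma_pos_of_pos (by linarith))

/-- The Gamma quotients are, up to a factor two, stable under interpolation between consecutive
integers. -/
lemma hpFactor_interpolate {r m θ : ℝ} (hm : 2 ≤ m) (hmr : m ≤ r) (hθ0 : 0 < θ) (hθ1 : θ < 1) :
    hpFactor r (m - 1) ^ (1 - θ) * hpFactor r m ^ θ ≤ 2 * hpFactor r (m - 1 + θ) := by
  have h1 := rpow_mul_Gamma_le (x := r - m + 1) (by linarith) hθ0 hθ1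
  have h2 := Real.Gamma_mul_add_mul_le_rpow_Gamma_mul_rpow_Gamma (s := r + m - 2)
    (t := r + m - 1) (by linarith) (by linarith) (sub_pos.2 hθ1) hθ0 (by ring)
  have hp1 : 0 < Real.Gamma (r - m + 1 + 1) := Real.Gamma_pos_of_pos (by linarith)
  have hp2 : 0 < Real.Gamma (r - m + 1) := Real.Gamma_pos_of_pos (by linarith)
  have hp3 : 0 < Real.Gamma (r + m - 2) := Real.Gamma_pos_of_pos (by linarith)
  have hp4 : 0 < Real.Gamma (r + m - 1) := Real.Gamma_pos_of_pos (by linarith)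
  have hp5 : 0 < Real.Gamma (r + m - 2 + θ) := Real.Gamma_pos_of_pos (by linarith)
  rw [show (1 - θ) * (r + m - 2) + θ * (r + m - 1) = r + m - 2 + θ by ring] at h2
  simp only [hpFactor]
  rw [show r - (m - 1) + 1 = r - m + 1 + 1 by ring, show r + (m - 1) - 1 = r + m - 2 by ring,
    show r - (m - 1 + θ) + 1 = r - m + 1 + 1 - θ by ring,
    show r + (m - 1 + θ) - 1 = r + m - 2 + θ by ring, Real.div_rpow hp1.le hp3.le,
    Real.div_rpow hp2.le hp4.le, div_mul_div_comm, ← mul_div_assoc]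
  have hp6 : 0 < Real.Gamma (r - m + 1 + 1 - θ) := Real.Gamma_pos_of_pos (by linarith)
  gcongr

/-- Log-convexity bounds `Γ(x + α) / Γ(x)` below by a power. -/
lemma rpow_mul_Gamma_le_Gamma_add {x α : ℝ} (hx : 1 < x) (hα : 0 ≤ α) :
    (x - 1) ^ α * Real.Gamma x ≤ Real.Gamma (x + α) := by
  rcases hα.eq_or_lt with rfl | hα
  · simp
  have hx1 : 0 < x - 1 := by linarith
  have hG1 := Real.Gamma_pos_of_pos hx1
  have hG := Real.Gamma_pos_of_pos (show 0 < x by linarith)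
  have hGα := Real.Gamma_pos_of_pos (show 0 < x + α by linarith)
  have h := Real.convexOn_log_Gamma.slope_mono_adjacent (x := x - 1) (y := x) (z := x + α)
    (mem_Ioi.2 hx1) (mem_Ioi.2 (by linarith)) (by linarith) (by linarith)
  simp only [Function.comp_apply, sub_sub_cancel, div_one, add_sub_cancel_left] at h
  rw [le_div_iff₀ hα, ← Real.log_div hG.ne' hG1.ne'] at h
  have h2 : Real.Gamma x / Real.Gamma (x - 1) = x - 1 := by
    have := Real.Gamma_add_one hx1.ne'
    rw [sub_add_cancel] at this
    rw [this, mul_div_cancel_right₀ _ hG1.ne']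
  rw [h2, le_sub_iff_add_le, mul_comm, ← Real.log_rpow hx1,
    ← Real.log_mul (by positivity) hG.ne'] at h
  exact (Real.log_le_log_iff (by positivity) hGα).1 h

/-- For fixed `s` the Gamma quotient decays like `r^(2 - 2s)`. -/
lemma exists_hpFactor_le (s : ℝ) (hs : 1 ≤ s) : ∃ C : ℝ, 0 < C ∧ ∀ r : ℕ, s ≤ r →
    hpFactor r s ≤ C * (r : ℝ) ^ (-(2 * s - 2)) := by
  -- for `r < 2 * s` the bound is a finite sum; for `r ≥ 2 * s` one has `r ≤ 2 * (r - s)`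
  let g : ℕ → ℝ := fun r => |hpFactor r s * (r : ℝ) ^ (2 * s - 2)|
  refine ⟨∑ r ∈ Finset.range (⌈2 * s⌉₊ + 1), g r + 2 ^ (2 * s - 2), ?_, fun r hr => ?_⟩
  · have : 0 ≤ ∑ r ∈ Finset.range (⌈2 * s⌉₊ + 1), g r :=
      Finset.sum_nonneg fun _ _ => abs_nonneg _
    positivity
  have hr0 : (0 : ℝ) < r := by linarith
  have hsum : 0 ≤ ∑ r ∈ Finset.range (⌈2 * s⌉₊ + 1), g r :=
    Finset.sum_nonneg fun _ _ => abs_nonneg _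
  have h2 : (0 : ℝ) ≤ 2 ^ (2 * s - 2) := by positivity
  rw [Real.rpow_neg hr0.le, ← div_eq_mul_inv, le_div_iff₀ (by positivity)]
  rcases lt_or_ge (r : ℝ) (2 * s) with hlt | hge
  · have hmem : r ∈ Finset.range (⌈2 * s⌉₊ + 1) := by
      rw [Finset.mem_range, Nat.lt_succ_iff]
      exact_mod_cast hlt.le.trans (Nat.le_ceil _)
    have h3 := Finset.single_le_sum (f := g) (fun _ _ => abs_nonneg _) hmem
    have h4 := le_abs_self (hpFactor r s * (r : ℝ) ^ (2 * s - 2))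
    linarith
  · have h3 := rpow_mul_Gamma_le_Gamma_add (x := r - s + 1) (α := 2 * s - 2) (by linarith)
      (by linarith)
    rw [show (r : ℝ) - s + 1 + (2 * s - 2) = r + s - 1 by ring, add_sub_cancel_right] at h3
    have hG : 0 < Real.Gamma (r - s + 1) := Real.Gamma_pos_of_pos (by linarith)
    have hG' : 0 < Real.Gamma (r + s - 1) := Real.Gamma_pos_of_pos (by linarith)
    have h4 : (r : ℝ) ^ (2 * s - 2) ≤ 2 ^ (2 * s - 2) * (r - s) ^ (2 * s - 2) := by
      rw [← Real.mul_rpow (by norm_num) (by linarith)]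
      exact Real.rpow_le_rpow hr0.le (by linarith) (by linarith)
    have h5 : hpFactor r s * (r : ℝ) ^ (2 * s - 2) ≤ 2 ^ (2 * s - 2) := by
      rw [hpFactor, div_mul_eq_mul_div, div_le_iff₀ hG']
      calc Real.Gamma (r - s + 1) * (r : ℝ) ^ (2 * s - 2)
          ≤ Real.Gamma (r - s + 1) * (2 ^ (2 * s - 2) * (r - s) ^ (2 * s - 2)) := by gcongr
        _ = 2 ^ (2 * s - 2) * ((r - s) ^ (2 * s - 2) * Real.Gamma (r - s + 1)) := by ring
        _ ≤ _ := by gcongr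
    linarith

/-- At integers the Gamma quotient is the reciprocal of an eigenvalue of the Legendre-type operator
`PolyInterval.legendreOp`. -/
lemma legendreEigenvalue_mul_hpFactor {m r : ℕ} (hm : 2 ≤ m) (hmr : m ≤ r + 1) :
    (PolyInterval.legendreEigenvalue (m - 2) (r - 2 + 1) : ℝ) * hpFactor r (m - 1) = 1 := by
  rcases Nat.lt_or_ge r 2 with h2 | h2
  · obtain rfl : r = 1 := by omega
    obtain rfl : m = 2 := by omega
    simp [PolyInterval.legendreEigenvalue, hpFactor]
    norm_num
  obtain ⟨p, rfl⟩ : ∃ p, r = p + 2 := ⟨r - 2, by omega⟩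
  obtain ⟨σ, rfl⟩ : ∃ σ, m = σ + 2 := ⟨m - 2, by omega⟩
  simp only [Nat.add_sub_cancel]
  have hσ : σ ≤ p + 1 := by omega
  have e1 : Real.Gamma (((p + 2 : ℕ) : ℝ) - (((σ + 2 : ℕ) : ℝ) - 1) + 1) =
      (p + 1 - σ).factorial := by
    rw [← Real.Gamma_nat_eq_factorial]
    congr 1
    push_cast [hσ]
    ring
  have e2 : Real.Gamma (((p + 2 : ℕ) : ℝ) + (((σ + 2 : ℕ) : ℝ) - 1) - 1) =
      (p + 1 + σ).factorial := by
    rw [← Real.Gamma_nat_eq_factorial]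
    congr 1
    push_cast
    ring
  have e3 := Nat.factorial_mul_descFactorial hσ
  have e4 := Nat.factorial_mul_descFactorial (Nat.le_add_left σ (p + 1))
  rw [Nat.add_sub_cancel] at e4
  have e5 : (p + 1 + σ).factorial =
      (p + 1 - σ).factorial * PolyInterval.legendreEigenvalue σ (p + 1) := by
    rw [PolyInterval.legendreEigenvalue, ← e4, ← e3]; ring
  rw [hpFactor, e1, e2, ← mul_div_assoc, div_eq_one_iff_eq (by positivity), e5]
  push_cast
  ring

/-! ### Approximation in Sobolev spaces of real order -/

variable {a b : ℝ}

/-- The `L²(a, b)` distance of `g` from the polynomials of degree at most `p`. -/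
noncomputable def bestApprox (a b : ℝ) (p : ℕ) (g : ℝ → ℝ) : ℝ≥0∞ :=
  ⨅ (q : Polynomial ℝ) (_ : q.natDegree ≤ p), eL2 a b (fun x => g x - q.eval x)

lemma bestApprox_le {p : ℕ} {g : ℝ → ℝ} {q : Polynomial ℝ} (hq : q.natDegree ≤ p) :
    bestApprox a b p g ≤ eL2 a b (fun x => g x - q.eval x) := iInf₂_le q hq

lemma _root_.IsPolyProj.eL2_sub_le_bestApprox (hab : a ≤ b) {p : ℕ} {g : ℝ → ℝ}
    {q : Polynomial ℝ} (hq : IsPolyProj a b p g q) (hg : MemL2 a b g) :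
    eL2 a b (fun x => g x - q.eval x) ≤ bestApprox a b p g :=
  le_iInf₂ fun _ hq' => hq.eL2_sub_le hab hg hq'

lemma bestApprox_congr {p : ℕ} {g h : ℝ → ℝ} (hgh : g =ᵐ[volume.restrict (Ioo a b)] h) :
    bestApprox a b p g = bestApprox a b p h := by
  refine iInf_congr fun q => iInf_congr fun _ => eLpNorm_congr_ae ?_
  filter_upwards [hgh] with x hx
  rw [hx]

lemma bestApprox_add_le (hab : a < b) {p : ℕ} {g h : ℝ → ℝ} (hg : MemL2 a b g)
    (hh : MemL2 a b h) :
    bestApprox a b p (g + h) ≤ bestApprox a b p g + bestApprox a b p h := by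
  obtain ⟨q, hq⟩ := PolyInterval.exists_isPolyProj hab p (hg.intervalIntegrable hab.le)
  obtain ⟨q', hq'⟩ := PolyInterval.exists_isPolyProj hab p (hh.intervalIntegrable hab.le)
  have hdeg : (q + q').natDegree ≤ p :=
    (Polynomial.natDegree_add_le _ _).trans (max_le hq.natDegree_le hq'.natDegree_le)
  refine (bestApprox_le hdeg).trans (le_trans ?_ (add_le_add
    (hq.eL2_sub_le_bestApprox hab.le hg) (hq'.eL2_sub_le_bestApprox hab.le hh)))
  have : (fun x => (g + h) x - (q + q').eval x) =
      (fun x => g x - q.eval x) + fun x => h x - q'.eval x := by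
    ext x; simp; ring
  rw [this]
  exact eLpNorm_add_le (hg.sub (memL2_eval q)).aestronglyMeasurable
    (hh.sub (memL2_eval q')).aestronglyMeasurable (by norm_num)

/-- The constant `(k / 2)^(s - 1) (Γ(r - s + 1) / Γ(r + s - 1))^(1/2)` in the estimate, for a
function in `H^(s+1)` on an interval of length `k`, of the distance of its second derivative from
the polynomials of degree at most `r - 2`. -/
noncomputable def hpConst (k r s : ℝ) : ℝ := (k / 2) ^ (s - 1) * √(hpFactor r s)

lemma hpConst_pos {k r s : ℝ} (hk : 0 < k) (hs : 1 ≤ s) (hsr : s ≤ r) : 0 < hpConst k r s :=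
  mul_pos (Real.rpow_pos_of_pos (by linarith) _) (Real.sqrt_pos.2 (hpFactor_pos hs hsr))

/-- The `hp` approximation estimate for the second derivative of a function in `H^m`. -/
lemma bestApprox_le_eSobolevNormNat (hab : a < b) {m r : ℕ} (hm : 2 ≤ m) (hmr : m ≤ r + 1)
    {u : ℝ → ℝ} {D : ℕ → ℝ → ℝ} (hD : ∀ j ≤ m, IsWeakDeriv j a b u (D j)) :
    bestApprox a b (r - 2) (D 2) ≤
      ENNReal.ofReal (hpConst (b - a) r (m - 1)) * eSobolevNormNat m a b u := by
  have hm' : (2 : ℝ) ≤ m := by exact_mod_cast hm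
  have hmr' : (m : ℝ) ≤ r + 1 := by exact_mod_cast hmr
  have hC : 0 < hpConst (b - a) r (m - 1) :=
    hpConst_pos (sub_pos.2 hab) (by linarith) (by linarith)
  by_cases h : eSobolevNormNat m a b u < ⊤
  swap
  · rw [not_lt_top_iff.1 h, ENNReal.mul_top (ENNReal.ofReal_pos.2 hC).ne']; exact le_top
  have hchain : IsWeakChain a b (m - 2) fun j => D (2 + j) :=
    ⟨fun j hj => (hD (2 + j) (by omega)).step (hD (2 + j + 1) (by omega)),
      fun j hj => memL2_of_eSobolevNormNat_lt_top hD h (by omega)⟩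
  have h2 : MemL2 a b (D 2) := memL2_of_eSobolevNormNat_lt_top hD h hm
  obtain ⟨q, hq⟩ := PolyInterval.exists_isPolyProj hab (r - 2) (h2.intervalIntegrable hab.le)
  have h3 := hchain.eL2_sub_proj_le hab hq
  simp only [add_zero, show 2 + (m - 2) = m by omega] at h3
  set lam : ℝ := ((PolyInterval.legendreEigenvalue (m - 2) (r - 2 + 1) : ℕ) : ℝ)
  have hlam : lam * hpFactor r (m - 1) = 1 := legendreEigenvalue_mul_hpFactor hm hmr
  have hF : 0 < hpFactor r (m - 1) := hpFactor_pos (by linarith) (by linarith)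
  have hsq : √(hpFactor r (m - 1)) * √lam = 1 := by
    rw [← Real.sqrt_mul hF.le, mul_comm, hlam, Real.sqrt_one]
  have hk : (0 : ℝ) ≤ (b - a) / 2 := by linarith
  have e1 : hpConst (b - a) r (m - 1) = √(hpFactor r (m - 1)) * ((b - a) / 2) ^ (m - 2) := by
    rw [hpConst, mul_comm, ← Real.rpow_natCast _ (m - 2)]
    congr 2
    push_cast [hm]
    ring
  calc bestApprox a b (r - 2) (D 2)
      ≤ eL2 a b (fun x => D 2 x - q.eval x) := bestApprox_le hq.natDegree_le
    _ = ENNReal.ofReal √(hpFactor r (m - 1)) *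
        (ENNReal.ofReal √lam * eL2 a b (fun x => D 2 x - q.eval x)) := by
        rw [← mul_assoc, ← ENNReal.ofReal_mul (Real.sqrt_nonneg _), hsq, ENNReal.ofReal_one,
          one_mul]
    _ ≤ ENNReal.ofReal √(hpFactor r (m - 1)) *
        (ENNReal.ofReal (((b - a) / 2) ^ (m - 2)) * eL2 a b (D m)) := by gcongr
    _ = ENNReal.ofReal (hpConst (b - a) r (m - 1)) * eL2 a b (D m) := by
        rw [← mul_assoc, ← ENNReal.ofReal_mul (Real.sqrt_nonneg _), e1]
    _ ≤ _ := by gcongr; exact eL2_le_eSobolevNormNat hD le_rfl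

/-- Approximation between the integer orders `m` and `m + 1`: both parts of a splitting `u = v + w`
are approximated, and the ratio of the two constants is the argument of the K-functional. -/
lemma bestApprox_le_peetreK (hab : a < b) {m r : ℕ} (hm : 2 ≤ m) (hmr : m ≤ r)
    {u F : ℝ → ℝ} (hF : IsWeakDeriv 2 a b u F) :
    bestApprox a b (r - 2) F ≤ ENNReal.ofReal (hpConst (b - a) r (m - 1)) *
      peetreK m a b u (hpConst (b - a) r m / hpConst (b - a) r (m - 1)) := by
  have hm' : (2 : ℝ) ≤ m := by exact_mod_cast hm
  have hmr' : (m : ℝ) ≤ r := by exact_mod_cast hmr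
  have hC : 0 < hpConst (b - a) r (m - 1) :=
    hpConst_pos (sub_pos.2 hab) (by linarith) (by linarith)
  have hC' : 0 < hpConst (b - a) r m :=
    hpConst_pos (sub_pos.2 hab) (by linarith) hmr'
  have hdiv : ENNReal.ofReal (hpConst (b - a) r (m - 1)) *
      ENNReal.ofReal (hpConst (b - a) r m / hpConst (b - a) r (m - 1)) =
      ENNReal.ofReal (hpConst (b - a) r m) := by
    rw [← ENNReal.ofReal_mul hC.le, mul_div_cancel₀ _ hC.ne']
  have hne := (ENNReal.ofReal_pos.2 hC).ne'
  have hne' := (ENNReal.ofReal_pos.2 hC').ne'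
  rw [peetreK, ENNReal.mul_iInf_of_ne hne ENNReal.ofReal_ne_top]
  refine le_iInf fun w => ?_
  rw [mul_add, ← mul_assoc, hdiv]
  by_cases hv : eSobolevNormNat m a b (u - w) < ⊤
  swap
  · rw [not_lt_top_iff.1 hv, ENNReal.mul_top hne, top_add]; exact le_top
  by_cases hw : eSobolevNormNat (m + 1) a b w < ⊤
  swap
  · rw [not_lt_top_iff.1 hw, ENNReal.mul_top hne', add_top]; exact le_top
  obtain ⟨D, hD⟩ := exists_weakDeriv_of_lt_top hv
  obtain ⟨E, hE⟩ := exists_weakDeriv_of_lt_top hw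
  have hsum := (hD 2 hm).add (hE 2 (by omega))
  rw [sub_add_cancel] at hsum
  rw [bestApprox_congr (hF.ae_eq hsum)]
  refine (bestApprox_add_le hab (memL2_of_eSobolevNormNat_lt_top hD hv hm)
    (memL2_of_eSobolevNormNat_lt_top hE hw (by omega))).trans (add_le_add ?_ ?_)
  · exact bestApprox_le_eSobolevNormNat hab hm (by omega) hD
  · have := bestApprox_le_eSobolevNormNat hab (r := r) (by omega : 2 ≤ m + 1) (by omega) hE
    simpa using this

lemma hpConst_interpolate {k r m θ : ℝ} (hk : 0 < k) (hm : 2 ≤ m) (hmr : m ≤ r) (hθ0 : 0 < θ)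
    (hθ1 : θ < 1) :
    hpConst k r (m - 1) * (√8 * (hpConst k r m / hpConst k r (m - 1)) ^ θ) ≤
      4 * hpConst k r (m - 1 + θ) := by
  have hC : 0 < hpConst k r (m - 1) := hpConst_pos hk (by linarith) (by linarith)
  have hC' : 0 < hpConst k r m := hpConst_pos hk (by linarith) hmr
  have hk2 : 0 < k / 2 := by linarith
  have hf1 : 0 < hpFactor r (m - 1) := hpFactor_pos (by linarith) (by linarith)
  have hf2 : 0 < hpFactor r m := hpFactor_pos (by linarith) hmr
  have e1 : hpConst k r (m - 1) * (√8 * (hpConst k r m / hpConst k r (m - 1)) ^ θ) =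
      √8 * (hpConst k r (m - 1) ^ (1 - θ) * hpConst k r m ^ θ) := by
    rw [Real.div_rpow hC'.le hC.le, Real.rpow_sub hC, Real.rpow_one]
    ring
  have e2 : hpConst k r (m - 1) ^ (1 - θ) * hpConst k r m ^ θ =
      (k / 2) ^ (m - 1 + θ - 1) * √(hpFactor r (m - 1) ^ (1 - θ) * hpFactor r m ^ θ) := by
    simp only [hpConst]
    rw [Real.mul_rpow (by positivity) (by positivity),
      Real.mul_rpow (by positivity) (by positivity),
      ← Real.rpow_mul hk2.le, ← Real.rpow_mul hk2.le, Real.sqrt_mul (by positivity)]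
    have e3 : ∀ x : ℝ, 0 < x → ∀ α : ℝ, √x ^ α = √(x ^ α) := fun x hx α => by
      rw [Real.sqrt_eq_rpow, Real.sqrt_eq_rpow, ← Real.rpow_mul hx.le, ← Real.rpow_mul hx.le,
        mul_comm]
    rw [e3 _ hf1, e3 _ hf2, mul_mul_mul_comm, ← Real.rpow_add hk2]
    congr 2
    ring
  have h1 := Real.sqrt_le_sqrt (hpFactor_interpolate hm hmr hθ0 hθ1)
  rw [Real.sqrt_mul (by norm_num : (0 : ℝ) ≤ 2)] at h1
  rw [e1, e2, hpConst]
  have h8 : √8 * √2 = 4 := by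
    rw [← Real.sqrt_mul (by norm_num), show (8 : ℝ) * 2 = 4 ^ 2 by norm_num,
      Real.sqrt_sq (by norm_num)]
  calc √8 * ((k / 2) ^ (m - 1 + θ - 1) * √(hpFactor r (m - 1) ^ (1 - θ) * hpFactor r m ^ θ))
      ≤ √8 * ((k / 2) ^ (m - 1 + θ - 1) * (√2 * √(hpFactor r (m - 1 + θ)))) := by gcongr
    _ = √8 * √2 * ((k / 2) ^ (m - 1 + θ - 1) * √(hpFactor r (m - 1 + θ))) := by ring
    _ = _ := by rw [h8]

/-- The `hp` approximation estimate for the second derivative of a function in `H^(s+1)`, by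
interpolation between the integer orders. -/
lemma bestApprox_le_eSobolevNorm (hab : a < b) {r : ℕ} {s : ℝ} (hs : 1 ≤ s) (hsr : s ≤ r)
    {u F : ℝ → ℝ} (hF : IsWeakDeriv 2 a b u F) :
    bestApprox a b (r - 2) F ≤
      ENNReal.ofReal (4 * hpConst (b - a) r s) * eSobolevNorm (s + 1) a b u := by
  have hk : 0 < b - a := sub_pos.2 hab
  have hC : 0 < hpConst (b - a) r s := hpConst_pos hk hs hsr
  set m := ⌊s + 1⌋₊ with hmdef
  have hm : 2 ≤ m := Nat.le_floor (by push_cast; linarith)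
  by_cases h : (m : ℝ) = s + 1
  · rw [eSobolevNorm, if_pos h]
    have hmr : m ≤ r + 1 := by
      have : (m : ℝ) ≤ r + 1 := by linarith
      exact_mod_cast this
    by_cases hu : eSobolevNormNat m a b u < ⊤
    swap
    · rw [not_lt_top_iff.1 hu, ENNReal.mul_top (ENNReal.ofReal_pos.2 (by linarith)).ne']
      exact le_top
    obtain ⟨D, hD⟩ := exists_weakDeriv_of_lt_top hu
    rw [bestApprox_congr (hF.ae_eq (hD 2 hm))]
    refine (bestApprox_le_eSobolevNormNat hab hm hmr hD).trans ?_
    rw [show (m : ℝ) - 1 = s by linarith]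
    gcongr
    linarith
  · rw [eSobolevNorm, if_neg h]
    obtain ⟨h1, h2⟩ := floor_lt_of_ne (by linarith : 0 ≤ s + 1) h
    rw [← hmdef] at h1 h2 ⊢
    have hm' : (2 : ℝ) ≤ m := by exact_mod_cast hm
    have hmr : m ≤ r := by
      have : (m : ℝ) < r + 1 := by linarith
      exact Nat.lt_succ_iff.1 (by exact_mod_cast this)
    have hmr' : (m : ℝ) ≤ r := by exact_mod_cast hmr
    have hA : 0 < hpConst (b - a) r (m - 1) := hpConst_pos hk (by linarith) (by linarith)
    have hB : 0 < hpConst (b - a) r m := hpConst_pos hk (by linarith) hmr'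
    have h3 := hpConst_interpolate hk hm' hmr' h1 h2
    rw [show (m : ℝ) - 1 + (s + 1 - m) = s by ring] at h3
    refine (bestApprox_le_peetreK hab hm hmr hF).trans ?_
    refine (mul_le_mul_right (peetreK_le m u h1 h2 (div_pos hB hA)) _).trans ?_
    rw [← mul_assoc, ← ENNReal.ofReal_mul hA.le]
    gcongr

end CPG

/-! ### The error on one subinterval -/

namespace CPG

open Polynomial

variable {a b : ℝ}

lemma integral_deriv_of_le {g g' : ℝ → ℝ} (hg : ContinuousOn g (Icc a b))
    (hg' : ContinuousOn g' (Icc a b)) (hd : ∀ x ∈ Ioo a b, HasDerivAt g (g' x) x) {x : ℝ}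
    (hx : x ∈ Icc a b) : ∫ t in a..x, g' t = g x - g a := by
  have hsub : Icc a x ⊆ Icc a b := Icc_subset_Icc_right hx.2
  refine intervalIntegral.integral_eq_sub_of_hasDerivAt_of_le hx.1 (hg.mono hsub)
    (fun y hy => hd y ⟨hy.1, hy.2.trans_le hx.2⟩) ?_
  exact ContinuousOn.intervalIntegrable_of_Icc hx.1 (hg'.mono hsub)

lemma isWeakDeriv_one_of_hasDerivAt (hab : a ≤ b) {g g' : ℝ → ℝ} (hg : ContinuousOn g (Icc a b))
    (hg' : ContinuousOn g' (Icc a b)) (hd : ∀ x ∈ Ioo a b, HasDerivAt g (g' x) x) :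
    IsWeakDeriv 1 a b g g' := by
  refine isWeakDeriv_one_of_eq_primitive hab (c := g a)
    (hg'.intervalIntegrable_of_Icc hab) fun x hx => ?_
  rw [integral_deriv_of_le hg hg' hd (Ioo_subset_Icc_self hx)]
  ring

/-- Poincaré's inequality for functions vanishing at the left end point. -/
lemma integral_sq_le_of_left_eq_zero (hab : a ≤ b) {g g' : ℝ → ℝ} (hg : ContinuousOn g (Icc a b))
    (hg' : ContinuousOn g' (Icc a b)) (hd : ∀ x ∈ Ioo a b, HasDerivAt g (g' x) x)
    (ha : g a = 0) : ∫ x in a..b, g x ^ 2 ≤ (b - a) ^ 2 * ∫ x in a..b, g' x ^ 2 := by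
  have h1 := eL2_primitive_le (memL2_of_continuousOn hg')
  have h2 : (fun x => ∫ t in a..x, g' t) =ᵐ[volume.restrict (Ioo a b)] g := by
    filter_upwards [ae_restrict_mem measurableSet_Ioo] with x hx
    rw [integral_deriv_of_le hg hg' hd (Ioo_subset_Icc_self hx), ha, sub_zero]
  rw [eL2, eLpNorm_congr_ae h2, ← sq_le_sq_iff_ennreal, mul_pow] at h1
  change eL2 a b g ^ 2 ≤ _ at h1
  have hk : 0 ≤ b - a := sub_nonneg.2 hab
  have hI : 0 ≤ ∫ x in a..b, g' x ^ 2 := intervalIntegral.integral_nonneg hab fun x _ => sq_nonneg _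
  rw [eL2_sq hab (memL2_of_continuousOn hg), eL2_sq hab (memL2_of_continuousOn hg'),
    ← ENNReal.ofReal_pow hk, ← ENNReal.ofReal_mul (by positivity),
    ENNReal.ofReal_le_ofReal_iff (by positivity)] at h1
  exact h1

/-- If `g'' ⟂ P_p` and `g`, `g'` vanish at both end points, then `g'` is smaller than `g''` by a
factor of order `h / p`: integrate by parts and approximate `g` by a polynomial. -/
lemma integral_deriv_sq_le (hab : a < b) {p : ℕ} {g g' g'' : ℝ → ℝ} (hg : ContinuousOn g (Icc a b))
    (hg' : ContinuousOn g' (Icc a b)) (hg'' : ContinuousOn g'' (Icc a b))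
    (hd : ∀ x ∈ Ioo a b, HasDerivAt g (g' x) x) (hd' : ∀ x ∈ Ioo a b, HasDerivAt g' (g'' x) x)
    (ha : g' a = 0) (hb : g' b = 0)
    (horth : ∀ φ : ℝ[X], φ.natDegree ≤ p → ∫ x in a..b, g'' x * φ.eval x = 0) :
    ((p + 2) * (p + 1) : ℝ) * ∫ x in a..b, g' x ^ 2 ≤
      ((b - a) / 2) ^ 2 * ∫ x in a..b, g'' x ^ 2 := by
  have m0 := memL2_of_continuousOn hg
  have m1 := memL2_of_continuousOn hg'
  have m2 := memL2_of_continuousOn hg''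
  have hchain : IsWeakChain a b 1 fun j => if j = 0 then g else g' := by
    refine ⟨fun j hj => ?_, fun j hj => ?_⟩
    · obtain rfl : j = 0 := by omega
      simpa using isWeakDeriv_one_of_hasDerivAt hab.le hg hg' hd
    · rcases j with _ | j
      · simpa using m0
      · simpa using m1
  obtain ⟨π, hπ⟩ := PolyInterval.exists_isPolyProj hab p (m0.intervalIntegrable hab.le)
  have h1 := hchain.eL2_sub_proj_le hab (p := p) (q := π) (by simpa using hπ)
  have m3 : MemL2 a b (fun x => g x - π.eval x) := m0.sub (memL2_eval π)
  have hlam : ((PolyInterval.legendreEigenvalue 1 (p + 1) : ℕ) : ℝ) = (p + 2) * (p + 1) := by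
    simp only [PolyInterval.legendreEigenvalue, Nat.descFactorial_one]
    push_cast
    ring
  have hk : 0 < (b - a) / 2 := by linarith
  have hX : 0 ≤ ∫ x in a..b, g' x ^ 2 :=
    intervalIntegral.integral_nonneg hab.le fun x _ => sq_nonneg _
  have hB : 0 ≤ ∫ x in a..b, g'' x ^ 2 :=
    intervalIntegral.integral_nonneg hab.le fun x _ => sq_nonneg _
  have h2 : ((p + 2) * (p + 1) : ℝ) * ∫ x in a..b, (g x - π.eval x) ^ 2 ≤
      ((b - a) / 2) ^ 2 * ∫ x in a..b, g' x ^ 2 := by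
    rw [← sq_le_sq_iff_ennreal, mul_pow, mul_pow] at h1
    simp only [if_true, one_ne_zero, if_false, pow_one] at h1
    rw [eL2_sq hab.le m3, eL2_sq hab.le m1, ← ENNReal.ofReal_pow (by positivity),
      ← ENNReal.ofReal_pow (by positivity), ← ENNReal.ofReal_mul (by positivity),
      ← ENNReal.ofReal_mul (by positivity), Real.sq_sqrt (by positivity), hlam,
      ENNReal.ofReal_le_ofReal_iff (by positivity)] at h1
    exact h1
  have h3 : ∫ x in a..b, g' x ^ 2 = -∫ x in a..b, g'' x * (g x - π.eval x) := by
    have e1 := integral_deriv_of_le (hg.mul hg') ((hg'.mul hg').add (hg.mul hg''))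
      (fun x hx => (hd x hx).mul (hd' x hx)) (right_mem_Icc.2 hab.le)
    simp only [Pi.mul_apply, Pi.add_apply, ha, hb, mul_zero, sub_zero] at e1
    rw [intervalIntegral.integral_add (m1.intervalIntegrable_mul hab.le m1)
      (m0.intervalIntegrable_mul hab.le m2)] at e1
    simp only [mul_sub]
    rw [intervalIntegral.integral_sub (m2.intervalIntegrable_mul hab.le m0)
      (m2.intervalIntegrable_mul hab.le (memL2_eval π)), horth π hπ.natDegree_le]
    simp only [sq, mul_comm (g'' _)]
    linarith
  have h4 := sq_integral_mul_le hab.le m2 m3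
  rw [← neg_sq, ← h3] at h4
  set X := ∫ x in a..b, g' x ^ 2
  set B := ∫ x in a..b, g'' x ^ 2
  rcases hX.eq_or_lt with h0 | h0
  · rw [← h0, mul_zero]; positivity
  refine le_of_mul_le_mul_right ?_ h0
  calc ((p + 2) * (p + 1) : ℝ) * X * X = ((p + 2) * (p + 1) : ℝ) * X ^ 2 := by ring
    _ ≤ ((p + 2) * (p + 1) : ℝ) * (B * ∫ x in a..b, (g x - π.eval x) ^ 2) := by gcongr
    _ = B * (((p + 2) * (p + 1) : ℝ) * ∫ x in a..b, (g x - π.eval x) ^ 2) := by ring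
    _ ≤ B * (((b - a) / 2) ^ 2 * X) := by gcongr
    _ = _ := by ring

/-- The comparison polynomial: it interpolates `u` and `u'` at the left end point and has the
projection of `u''` as second derivative. Since `u'' - Q''` is orthogonal to the linear functions,
`Q` interpolates `u` and `u'` at the right end point as well. -/
lemma exists_comparison_polynomial (hab : a < b) {p : ℕ} (hp : 1 ≤ p) {u v F : ℝ → ℝ}
    (hu : ContinuousOn u (Icc a b)) (hv : ContinuousOn v (Icc a b)) (hF : ContinuousOn F (Icc a b))
    (hud : ∀ x ∈ Ioo a b, HasDerivAt u (v x) x) (hvd : ∀ x ∈ Ioo a b, HasDerivAt v (F x) x)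
    {q : ℝ[X]} (hq : IsPolyProj a b p F q) :
    ∃ Q : ℝ[X], derivative (derivative Q) = q ∧ u a = Q.eval a ∧ v a = (derivative Q).eval a ∧
      u b = Q.eval b ∧ v b = (derivative Q).eval b := by
  obtain ⟨q₁, rfl⟩ := exists_derivative_eq q
  obtain ⟨q₂, hq₂⟩ := exists_derivative_eq (q₁ + C (v a - q₁.eval a))
  have hQ1 : derivative (q₂ + C (u a - q₂.eval a)) = q₁ + C (v a - q₁.eval a) := by simp [hq₂]
  have hQ2 : derivative (derivative (q₂ + C (u a - q₂.eval a))) = derivative q₁ := by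
    rw [hQ1]; simp
  set Q := q₂ + C (u a - q₂.eval a) with hQ
  have ha0 : u a = Q.eval a := by simp [hQ]
  have ha1 : v a = (derivative Q).eval a := by rw [hQ1]; simp
  rw [← hQ2] at hq
  have hcQ : ∀ P : ℝ[X], ContinuousOn (fun x => P.eval x) (Icc a b) := fun P =>
    P.continuous.continuousOn
  have hb1 : v b - (derivative Q).eval b = 0 := by
    have h1 := integral_deriv_of_le (hv.sub (hcQ (derivative Q)))
      (hF.sub (hcQ (derivative (derivative Q)))) (fun x hx => (hvd x hx).sub
      ((derivative Q).hasDerivAt x)) (right_mem_Icc.2 hab.le)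
    have h2 := hq.orthogonal 1 (by simp)
    simp only [eval_one, mul_one] at h2
    simp only [Pi.sub_apply] at h1
    rw [h2, ha1] at h1
    linarith
  refine ⟨Q, hQ2, ha0, ha1, ?_, by linarith⟩
  -- Taylor expansion of `u - Q` with integral remainder, as the derivative of
  -- `(u - Q)' * (x - b) - (u - Q)`
  have h3 := integral_deriv_of_le
    (g := fun x => (v x - (derivative Q).eval x) * (x - b) - (u x - Q.eval x))
    (g' := fun x => (F x - (derivative (derivative Q)).eval x) * (X - C b : ℝ[X]).eval x)
    (((hv.sub (hcQ _)).mul (by fun_prop)).sub (hu.sub (hcQ _)))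
    ((hF.sub (hcQ _)).mul (hcQ _)) (fun x hx => by
      have e := (((hvd x hx).sub ((derivative Q).hasDerivAt x)).mul
        ((hasDerivAt_id x).sub_const b)).sub ((hud x hx).sub (Q.hasDerivAt x))
      exact e.congr_deriv (by simp)) (right_mem_Icc.2 hab.le)
  rw [hq.orthogonal (X - C b) ((natDegree_X_sub_C_le b).trans hp)] at h3
  simp only [ha0, ha1, sub_self, mul_zero, zero_mul] at h3
  linarith

/-- The squared `H¹` distance from `u` to the comparison polynomial is bounded by the squared
projection error of `u''`, with a gain of order `h² / r²`. -/
lemma comparison_error (hab : a < b) {T : ℝ} (hT : b - a ≤ T) {r : ℕ} (hr : 3 ≤ r)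
    {u v F : ℝ → ℝ} (hu : ContinuousOn u (Icc a b)) (hv : ContinuousOn v (Icc a b))
    (hF : ContinuousOn F (Icc a b))
    (hud : ∀ x ∈ Ioo a b, HasDerivAt u (v x) x) (hvd : ∀ x ∈ Ioo a b, HasDerivAt v (F x) x)
    {Q : ℝ[X]} (hq : IsPolyProj a b (r - 2) F (derivative (derivative Q)))
    (ha0 : u a = Q.eval a) (ha1 : v a = (derivative Q).eval a)
    (hb1 : v b = (derivative Q).eval b) :
    (∫ x in a..b, (u x - Q.eval x) ^ 2) + ∫ x in a..b, (v x - (derivative Q).eval x) ^ 2 ≤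
      (1 + T ^ 2) * (((b - a) / 2) ^ 2 / (r * (r - 1)) *
        ∫ x in a..b, (F x - (derivative (derivative Q)).eval x) ^ 2) := by
  have hcP : ∀ P : ℝ[X], ContinuousOn (fun x => P.eval x) (Icc a b) := fun P =>
    P.continuous.continuousOn
  have hk0 : 0 < b - a := sub_pos.2 hab
  have hr3 : (3 : ℝ) ≤ r := by exact_mod_cast hr
  have hρ' := integral_deriv_sq_le hab (p := r - 2) (hu.sub (hcP Q)) (hv.sub (hcP (derivative Q)))
    (hF.sub (hcP (derivative (derivative Q)))) (fun x hx => (hud x hx).sub (Q.hasDerivAt x))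
    (fun x hx => (hvd x hx).sub ((derivative Q).hasDerivAt x)) (by simp [ha1]) (by simp [hb1])
    hq.orthogonal
  have hρ := integral_sq_le_of_left_eq_zero hab.le (hu.sub (hcP Q)) (hv.sub (hcP (derivative Q)))
    (fun x hx => (hud x hx).sub (Q.hasDerivAt x)) (by simp [ha0])
  simp only [Pi.sub_apply] at hρ' hρ
  rw [Nat.cast_sub (by omega : 2 ≤ r)] at hρ'
  set B := ∫ x in a..b, (F x - (derivative (derivative Q)).eval x) ^ 2
  set I1 := ∫ x in a..b, (v x - (derivative Q).eval x) ^ 2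
  set I0 := ∫ x in a..b, (u x - Q.eval x) ^ 2
  have hI1nn : 0 ≤ I1 := intervalIntegral.integral_nonneg hab.le fun x _ => sq_nonneg _
  have hI1le : I1 ≤ ((b - a) / 2) ^ 2 / (r * (r - 1)) * B := by
    rw [div_mul_eq_mul_div, le_div_iff₀ (by nlinarith)]
    push_cast at hρ'
    linarith
  have h1 : (b - a) ^ 2 ≤ T ^ 2 := by gcongr
  calc I0 + I1 ≤ (1 + (b - a) ^ 2) * I1 := by linarith
    _ ≤ (1 + T ^ 2) * I1 := by gcongr
    _ ≤ _ := by gcongr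

/-- Growth of `θ² + θ'²` for a polynomial `θ`. -/
lemma polynomial_energy_le (θ : ℝ[X]) {x : ℝ} (hx : x ∈ Icc a b) :
    θ.eval x ^ 2 + (derivative θ).eval x ^ 2 ≤ θ.eval a ^ 2 + (derivative θ).eval a ^ 2 +
      2 * (∫ t in a..b, (θ.eval t ^ 2 + (derivative θ).eval t ^ 2)) +
      ∫ t in a..b, (derivative (derivative θ)).eval t ^ 2 := by
  have hab : a ≤ b := hx.1.trans hx.2
  have h1 : ∫ t in a..x, (2 * θ.eval t * (derivative θ).eval t +
      2 * (derivative θ).eval t * (derivative (derivative θ)).eval t) =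
      (θ.eval x ^ 2 + (derivative θ).eval x ^ 2) - (θ.eval a ^ 2 + (derivative θ).eval a ^ 2) := by
    refine intervalIntegral.integral_eq_sub_of_hasDerivAt
      (f := fun t => θ.eval t ^ 2 + (derivative θ).eval t ^ 2) (fun t _ => ?_)
      (Continuous.intervalIntegrable (by fun_prop) _ _)
    exact (((θ.hasDerivAt t).pow 2).add (((derivative θ).hasDerivAt t).pow 2)).congr_deriv
      (by norm_num)
  let W : ℝ → ℝ := fun t => 2 * (θ.eval t ^ 2 + (derivative θ).eval t ^ 2) +
    (derivative (derivative θ)).eval t ^ 2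
  have hW : Continuous W := by fun_prop
  have h2 : ∫ t in a..x, (2 * θ.eval t * (derivative θ).eval t +
      2 * (derivative θ).eval t * (derivative (derivative θ)).eval t) ≤ ∫ t in a..x, W t := by
    refine intervalIntegral.integral_mono_on hx.1 (Continuous.intervalIntegrable (by fun_prop) _ _)
      (hW.intervalIntegrable _ _) fun t _ => ?_
    simp only [W]
    nlinarith [sq_nonneg (θ.eval t - (derivative θ).eval t), sq_nonneg (θ.eval t),
      sq_nonneg ((derivative θ).eval t - (derivative (derivative θ)).eval t)]
  have h3 : ∫ t in a..x, W t ≤ ∫ t in a..b, W t :=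
    intervalIntegral.integral_mono_interval le_rfl hx.1 hx.2
      (Filter.Eventually.of_forall fun t => by simp only [W, Pi.zero_apply]; positivity)
      (hW.intervalIntegrable _ _)
  have h4 : ∫ t in a..b, W t = 2 * (∫ t in a..b, (θ.eval t ^ 2 + (derivative θ).eval t ^ 2)) +
      ∫ t in a..b, (derivative (derivative θ)).eval t ^ 2 := by
    simp only [W]
    rw [intervalIntegral.integral_add (Continuous.intervalIntegrable (by fun_prop) _ _)
      (Continuous.intervalIntegrable (by fun_prop) _ _), intervalIntegral.integral_const_mul]
  linarith

/-- The projection is a contraction: `‖q - q̃‖ ≤ ‖F - G‖` for the projections of `F` and `G`. -/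
lemma _root_.IsPolyProj.integral_sub_sq_le (hab : a ≤ b) {p : ℕ} {F G : ℝ → ℝ} {q q' : ℝ[X]}
    (hq : IsPolyProj a b p F q) (hq' : IsPolyProj a b p G q') (hF : MemL2 a b F)
    (hG : MemL2 a b G) :
    ∫ x in a..b, (q - q').eval x ^ 2 ≤ ∫ x in a..b, (F x - G x) ^ 2 := by
  have hdeg : (q - q').natDegree ≤ p :=
    (natDegree_sub_le _ _).trans (max_le hq.natDegree_le hq'.natDegree_le)
  have m1 : MemL2 a b (fun x => F x - q.eval x) := hF.sub (memL2_eval q)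
  have m2 : MemL2 a b (fun x => G x - q'.eval x) := hG.sub (memL2_eval q')
  have m3 : MemL2 a b (fun x => (q - q').eval x) := memL2_eval _
  have m4 : MemL2 a b (fun x => F x - G x) := hF.sub hG
  have e1 := hq.orthogonal _ hdeg
  have e2 := hq'.orthogonal _ hdeg
  have i1 := m1.intervalIntegrable_mul hab m3
  have i2 := m2.intervalIntegrable_mul hab m3
  have i3 := m3.intervalIntegrable_mul hab m3
  have e3 : ∫ x in a..b, (F x - G x) * (q - q').eval x =
      ∫ x in a..b, (q - q').eval x * (q - q').eval x := by
    have : ∀ x, (F x - G x) * (q - q').eval x = (F x - q.eval x) * (q - q').eval x -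
        (G x - q'.eval x) * (q - q').eval x + (q - q').eval x * (q - q').eval x := fun x => by
      simp only [eval_sub]; ring
    simp only [this]
    rw [intervalIntegral.integral_add (i1.sub i2) i3, intervalIntegral.integral_sub i1 i2, e1, e2]
    ring
  have h := sq_integral_mul_le hab m4 m3
  simp only [← sq] at e3
  rw [e3] at h
  have hY : 0 ≤ ∫ x in a..b, (q - q').eval x ^ 2 :=
    intervalIntegral.integral_nonneg hab fun x _ => sq_nonneg _
  have hZ : 0 ≤ ∫ x in a..b, (F x - G x) ^ 2 :=
    intervalIntegral.integral_nonneg hab fun x _ => sq_nonneg _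
  set Y := ∫ x in a..b, (q - q').eval x ^ 2
  rcases hY.eq_or_lt with h0 | h0
  · rw [← h0]; exact hZ
  · refine le_of_mul_le_mul_right ?_ h0
    rw [← sq]
    exact h

lemma integral_add_sq_le (hab : a ≤ b) {f g : ℝ → ℝ} (hf : MemL2 a b f) (hg : MemL2 a b g) :
    ∫ x in a..b, (f x + g x) ^ 2 ≤ 2 * (∫ x in a..b, f x ^ 2) + 2 * ∫ x in a..b, g x ^ 2 := by
  have hfg : MemL2 a b (fun x => f x + g x) := hf.add hg
  have i0 := hfg.intervalIntegrable_mul hab hfg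
  have i1 := hf.intervalIntegrable_mul hab hf
  have i2 := hg.intervalIntegrable_mul hab hg
  simp only [← sq] at i0 i1 i2
  rw [← intervalIntegral.integral_const_mul, ← intervalIntegral.integral_const_mul,
    ← intervalIntegral.integral_add (i1.const_mul 2) (i2.const_mul 2)]
  refine intervalIntegral.integral_mono_on hab i0 ((i1.const_mul 2).add (i2.const_mul 2))
    fun x _ => ?_
  nlinarith [sq_nonneg (f x - g x)]

/-- On a short subinterval the discrete error `Y` can be absorbed into the left-hand side. -/
lemma absorb_error {k l A A' R X Y : ℝ} (hl : 0 ≤ l) (hR : 0 ≤ R)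
    (hY : 0 ≤ Y) (hkl : (2 + 4 * l) * k ≤ 1 / 2)
    (hYle : Y ≤ k * (A + (2 + 4 * l) * Y + 4 * l * R))
    (hA' : A' ≤ A + (2 + 4 * l) * Y + 4 * l * R) (hX : X ≤ 2 * R + 2 * Y) :
    A' ≤ (1 + 2 * (2 + 4 * l) * k) * A + 8 * l * R ∧
      X ≤ 2 * R + 4 * k * (A + 4 * l * R) := by
  have h1 := mul_le_mul_of_nonneg_right hkl hY
  have h2 : Y ≤ 2 * (k * (A + 4 * l * R)) := by linarith
  have h3 := mul_le_mul_of_nonneg_left h2 (by positivity : 0 ≤ 2 + 4 * l)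
  have h4 := mul_le_mul_of_nonneg_right hkl (by positivity : 0 ≤ 4 * l * R)
  constructor <;> linarith

/-- Error propagation over one subinterval. `A` and `A'` are the squared errors of value and
derivative at the end points, `X` the squared `H¹` error, `B` the squared projection error of `u''`
and `R` a bound for the squared `H¹` norm of `u - Q`, where `Q` is the comparison polynomial. -/
lemma local_error (hab : a < b) {T L : ℝ} (hT : b - a ≤ T) {r : ℕ} (hr : 3 ≤ r)
    {u v F G : ℝ → ℝ} (hu : ContinuousOn u (Icc a b)) (hv : ContinuousOn v (Icc a b))
    (hF : ContinuousOn F (Icc a b)) (hG : ContinuousOn G (Icc a b))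
    (hud : ∀ x ∈ Ioo a b, HasDerivAt u (v x) x) (hvd : ∀ x ∈ Ioo a b, HasDerivAt v (F x) x)
    {p q : ℝ[X]} (hp : IsPolyProj a b (r - 2) G (derivative (derivative p)))
    (hq : IsPolyProj a b (r - 2) F q)
    (hlip : ∀ x ∈ Icc a b, |F x - G x| ≤ L * (|u x - p.eval x| + |v x - (derivative p).eval x|))
    (hk : (2 + 4 * L ^ 2) * (b - a) ≤ 1 / 2) {A A' X B R : ℝ}
    (hA : A = (u a - p.eval a) ^ 2 + (v a - (derivative p).eval a) ^ 2)
    (hA' : A' = (u b - p.eval b) ^ 2 + (v b - (derivative p).eval b) ^ 2)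
    (hX : X = ∫ x in a..b, ((u x - p.eval x) ^ 2 + (v x - (derivative p).eval x) ^ 2))
    (hB : B = ∫ x in a..b, (F x - q.eval x) ^ 2)
    (hR : R = (1 + T ^ 2) * (((b - a) / 2) ^ 2 / (r * (r - 1)) * B)) :
    A' ≤ (1 + 2 * (2 + 4 * L ^ 2) * (b - a)) * A + 8 * L ^ 2 * R ∧
    X ≤ 2 * R + 4 * (b - a) * (A + 4 * L ^ 2 * R) ∧
    ∫ x in a..b, (F x - (derivative (derivative p)).eval x) ^ 2 ≤ 2 * B + 4 * L ^ 2 * X := by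
  obtain ⟨Q, rfl, ha0, ha1, hb0, hb1⟩ :=
    exists_comparison_polynomial hab (by omega : 1 ≤ r - 2) hu hv hF hud hvd hq
  have hcP : ∀ P : ℝ[X], ContinuousOn (fun x => P.eval x) (Icc a b) := fun P =>
    P.continuous.continuousOn
  have hk0 : 0 < b - a := sub_pos.2 hab
  have mF := memL2_of_continuousOn hF
  have mG := memL2_of_continuousOn hG
  have mρ : MemL2 a b (fun x => u x - Q.eval x) := memL2_of_continuousOn (hu.sub (hcP Q))
  have mρ' : MemL2 a b (fun x => v x - (derivative Q).eval x) :=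
    memL2_of_continuousOn (hv.sub (hcP _))
  have me : MemL2 a b (fun x => u x - p.eval x) := memL2_of_continuousOn (hu.sub (hcP p))
  have me' : MemL2 a b (fun x => v x - (derivative p).eval x) :=
    memL2_of_continuousOn (hv.sub (hcP _))
  have ii : ∀ {f : ℝ → ℝ}, MemL2 a b f → IntervalIntegrable (fun x => f x ^ 2) volume a b :=
    fun hf => by simpa only [sq] using hf.intervalIntegrable_mul hab.le hf
  have hRle := comparison_error hab hT hr hu hv hF hud hvd hq ha0 ha1 hb1
  rw [← hB, ← hR] at hRle
  -- the discrete part `θ = Q - U`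
  set θ := Q - p with hθ
  have hθ'' : derivative (derivative θ) =
      derivative (derivative Q) - derivative (derivative p) := by
    simp [hθ]
  set Y := ∫ x in a..b, (θ.eval x ^ 2 + (derivative θ).eval x ^ 2) with hY
  set Z := ∫ x in a..b, (derivative (derivative θ)).eval x ^ 2 with hZ
  have hYsplit : Y = (∫ x in a..b, θ.eval x ^ 2) + ∫ x in a..b, (derivative θ).eval x ^ 2 :=
    intervalIntegral.integral_add (ii (memL2_eval θ)) (ii (memL2_eval (derivative θ)))
  have hXsplit : X = (∫ x in a..b, (u x - p.eval x) ^ 2) +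
      ∫ x in a..b, (v x - (derivative p).eval x) ^ 2 := by
    rw [hX]; exact intervalIntegral.integral_add (ii me) (ii me')
  have hXle : X ≤ 2 * R + 2 * Y := by
    have h1 := integral_add_sq_le hab.le mρ (memL2_eval θ)
    have h2 := integral_add_sq_le hab.le mρ' (memL2_eval (derivative θ))
    simp only [hθ, derivative_sub, eval_sub, sub_add_sub_cancel] at h1 h2
    simp only [hθ, derivative_sub, eval_sub] at hYsplit
    linarith
  have hFG : ∫ x in a..b, (F x - G x) ^ 2 ≤ 2 * L ^ 2 * X := by
    rw [hX, ← intervalIntegral.integral_const_mul]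
    refine intervalIntegral.integral_mono_on hab.le (ii (mF.sub mG))
      (((ii me).add (ii me')).const_mul _) fun x hx => ?_
    have h1 := hlip x hx
    calc (F x - G x) ^ 2 = |F x - G x| ^ 2 := (sq_abs _).symm
      _ ≤ (L * (|u x - p.eval x| + |v x - (derivative p).eval x|)) ^ 2 := by gcongr
      _ = L ^ 2 * (|u x - p.eval x| + |v x - (derivative p).eval x|) ^ 2 := by ring
      _ ≤ L ^ 2 * (2 * (|u x - p.eval x| ^ 2 + |v x - (derivative p).eval x| ^ 2)) := by
          gcongr; exact add_sq_le
      _ = _ := by rw [sq_abs, sq_abs]; ring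
  have hZle : Z ≤ 2 * L ^ 2 * X := by
    rw [hZ, hθ'']
    exact (hq.integral_sub_sq_le hab.le hp mF mG).trans hFG
  have hL2 : 0 ≤ L ^ 2 := sq_nonneg L
  have hRnn : 0 ≤ R := by
    refine le_trans (add_nonneg ?_ ?_) hRle <;>
      exact intervalIntegral.integral_nonneg hab.le fun x _ => sq_nonneg _
  have hYnn : 0 ≤ Y := intervalIntegral.integral_nonneg hab.le fun x _ => by positivity
  have hAeq : θ.eval a ^ 2 + (derivative θ).eval a ^ 2 = A := by
    rw [hA, ha0, ha1]; simp [hθ]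
  have hA'eq : θ.eval b ^ 2 + (derivative θ).eval b ^ 2 = A' := by
    rw [hA', hb0, hb1]; simp [hθ]
  have hAnn : 0 ≤ A := by rw [hA]; positivity
  have hpt : ∀ x ∈ Icc a b, θ.eval x ^ 2 + (derivative θ).eval x ^ 2 ≤
      A + (2 + 4 * L ^ 2) * Y + 4 * L ^ 2 * R := fun x hx => by
    have h1 := polynomial_energy_le θ hx
    rw [hAeq, ← hY, ← hZ] at h1
    have h2 := mul_le_mul_of_nonneg_left hXle (by positivity : 0 ≤ 2 * L ^ 2)
    linarith
  have hYle : Y ≤ (b - a) * (A + (2 + 4 * L ^ 2) * Y + 4 * L ^ 2 * R) := by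
    have h1 : Y ≤ ∫ _ in a..b, (A + (2 + 4 * L ^ 2) * Y + 4 * L ^ 2 * R) :=
      intervalIntegral.integral_mono_on hab.le ((ii (memL2_eval θ)).add (ii (memL2_eval _)))
        intervalIntegrable_const hpt
    rwa [intervalIntegral.integral_const, smul_eq_mul] at h1
  have hend := hpt b (right_mem_Icc.2 hab.le)
  rw [hA'eq] at hend
  obtain ⟨hres1, hres2⟩ := absorb_error hL2 hRnn hYnn hk hYle hend hXle
  refine ⟨hres1, hres2, ?_⟩
  · have h1 := integral_add_sq_le hab.le
      (f := fun x => F x - (derivative (derivative Q)).eval x)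
      (g := fun x => (derivative (derivative θ)).eval x) (mF.sub (memL2_eval _)) (memL2_eval _)
    rw [← hB, ← hZ] at h1
    simp only [hθ'', eval_sub, sub_add_sub_cancel] at h1
    linarith

end CPG

/-! ### Partitions -/

namespace CPG

open Polynomial

variable {T : ℝ} {N : ℕ}

namespace Partition

lemma left_lt_right (P : Partition T N) (n : Fin N) : P.left n < P.right n :=
  P.strictMono n.castSucc_lt_succ

lemma step_pos (P : Partition T N) (n : Fin N) : 0 < P.step n := sub_pos.2 (P.left_lt_right n)

lemma node_mem (P : Partition T N) (i : Fin (N + 1)) : P.node i ∈ Icc 0 T :=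
  ⟨P.node_zero.ge.trans (P.strictMono.monotone (Fin.zero_le i)),
    (P.strictMono.monotone (Fin.le_last i)).trans P.node_last.le⟩

lemma Icc_subset (P : Partition T N) (n : Fin N) : Icc (P.left n) (P.right n) ⊆ Icc 0 T :=
  Icc_subset_Icc (P.node_mem _).1 (P.node_mem _).2

lemma Ioo_subset (P : Partition T N) (n : Fin N) : Ioo (P.left n) (P.right n) ⊆ Ioo 0 T :=
  Ioo_subset_Ioo (P.node_mem _).1 (P.node_mem _).2

lemma step_le (P : Partition T N) (n : Fin N) : P.step n ≤ T := by
  have h1 := (P.node_mem n.castSucc).1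
  have h2 := (P.node_mem n.succ).2
  simp only [step, left, right]
  linarith

lemma disjoint_Ioo (P : Partition T N) :
    Pairwise (Function.onFun Disjoint fun n => Ioo (P.left n) (P.right n)) := by
  intro m n hmn
  wlog h : m < n generalizing m n
  · exact (this hmn.symm (lt_of_le_of_ne (not_lt.1 h) hmn.symm)).symm
  refine Set.disjoint_left.2 fun x hx hx' => ?_
  have : P.right m ≤ P.left n := P.strictMono.monotone (by
    rw [Fin.le_def]; simpa using h)
  exact absurd (hx.2.trans_le this) (not_lt.2 hx'.1.le)

lemma exists_mem_Ioo (P : Partition T N) {x : ℝ} (hx : x ∈ Ioo 0 T) (hx' : x ∉ range P.node) :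
    ∃ n, x ∈ Ioo (P.left n) (P.right n) := by
  let S := Finset.univ.filter fun i => P.node i ≤ x
  have hS : S.Nonempty := ⟨0, by simp [S, P.node_zero, hx.1.le]⟩
  have hmax := S.max'_mem hS
  set i := S.max' hS with hi
  have hle : P.node i ≤ x := (Finset.mem_filter.1 hmax).2
  have hne : i ≠ Fin.last N := fun h => by
    rw [h, P.node_last] at hle
    exact absurd hx.2 (not_lt.2 hle)
  obtain ⟨n, hn⟩ := Fin.exists_castSucc_eq.2 hne
  refine ⟨n, lt_of_le_of_ne (by rw [left, hn]; exact hle) fun h => hx' ⟨n.castSucc, h⟩, ?_⟩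
  by_contra hcon
  have : n.succ ∈ S := Finset.mem_filter.2 ⟨Finset.mem_univ _, not_lt.1 hcon⟩
  have := S.le_max' _ this
  rw [← hi, ← hn] at this
  exact absurd n.castSucc_lt_succ (not_lt.2 this)

lemma sum_step (P : Partition T N) : ∑ n, P.step n = T := by
  have key : ∀ (M : ℕ) (g : Fin (M + 1) → ℝ),
      ∑ n : Fin M, (g n.succ - g n.castSucc) = g (Fin.last M) - g 0 := by
    intro M
    induction M with
    | zero => intro g; simp
    | succ M ih =>
      intro g
      rw [Fin.sum_univ_castSucc]
      have := ih fun i => g i.castSucc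
      simp only [Fin.castSucc_zero] at this
      simp only [← Fin.castSucc_succ] at this ⊢
      rw [this, Fin.succ_last]
      ring
  have := key N P.node
  rw [P.node_last, P.node_zero, sub_zero] at this
  exact this

lemma step_le_meshSize (P : Partition T N) (n : Fin N) : P.step n ≤ P.meshSize :=
  le_ciSup (Set.finite_range _).bddAbove n

/-- The squared `L²` norm is additive over the subintervals. -/
lemma sum_eL2_sq (P : Partition T N) (f : ℝ → ℝ) :
    ∑ n, eL2 (P.left n) (P.right n) f ^ 2 = eL2 0 T f ^ 2 := by
  refine le_antisymm (sum_eL2_sq_le P.disjoint_Ioo P.Ioo_subset f) ?_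
  simp only [eL2_sq_eq_lintegral]
  rw [← tsum_fintype (L := .unconditional _),
    ← lintegral_iUnion (fun i => measurableSet_Ioo) P.disjoint_Ioo]
  refine lintegral_mono_set' ?_
  have hfin : (range P.node).Countable := (Set.finite_range _).countable
  filter_upwards [hfin.ae_notMem volume] with x hx hxm
  exact mem_iUnion.2 (P.exists_mem_Ioo hxm hx)

/-- The discrete Gronwall inequality along the nodes of a partition. -/
lemma gronwall (P : Partition T N) {α β : ℝ} (hα : 0 ≤ α) (hβ : 0 ≤ β) {A : Fin (N + 1) → ℝ}
    {R : Fin N → ℝ} (hA0 : A 0 = 0) (hR : ∀ n, 0 ≤ R n) (hA : ∀ i, 0 ≤ A i)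
    (h : ∀ n : Fin N, A n.succ ≤ (1 + α * P.step n) * A n.castSucc + β * R n) (i : Fin (N + 1)) :
    A i ≤ Real.exp (α * T) * (β * ∑ n, R n) := by
  have key : ∀ i : Fin (N + 1), A i ≤ Real.exp (α * P.node i) *
      (β * ∑ n ∈ Finset.univ.filter (fun n : Fin N => n.castSucc < i), R n) := by
    intro i
    induction i using Fin.induction with
    | zero => simp [hA0]
    | succ n ih =>
      have hfil : Finset.univ.filter (fun m : Fin N => m.castSucc < n.succ) =
          insert n (Finset.univ.filter fun m : Fin N => m.castSucc < n.castSucc) := by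
        ext m
        simp only [Finset.mem_filter, Finset.mem_univ, true_and, Finset.mem_insert,
          Fin.castSucc_lt_succ_iff, Fin.castSucc_lt_castSucc_iff]
        rw [le_iff_eq_or_lt]
      rw [hfil, Finset.sum_insert (by simp)]
      set S := ∑ m ∈ Finset.univ.filter (fun m : Fin N => m.castSucc < n.castSucc), R m
      have hS : 0 ≤ S := Finset.sum_nonneg fun m _ => hR m
      have hk : 0 ≤ P.step n := (P.step_pos n).le
      have e1 : Real.exp (α * P.step n) * Real.exp (α * P.node n.castSucc) =
          Real.exp (α * P.node n.succ) := by
        rw [← Real.exp_add]; congr 1; simp only [step, left, right]; ring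
      have e2 : 1 + α * P.step n ≤ Real.exp (α * P.step n) := by
        rw [add_comm]; exact Real.add_one_le_exp _
      have e3 : 1 ≤ Real.exp (α * P.node n.succ) :=
        Real.one_le_exp (mul_nonneg hα (P.node_mem _).1)
      have hRn := hR n
      calc A n.succ ≤ (1 + α * P.step n) * A n.castSucc + β * R n := h n
        _ ≤ Real.exp (α * P.step n) * (Real.exp (α * P.node n.castSucc) * (β * S)) +
            Real.exp (α * P.node n.succ) * (β * R n) := by
            refine add_le_add (mul_le_mul e2 ih (hA _) (Real.exp_pos _).le) ?_
            exact le_mul_of_one_le_left (by positivity) e3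
        _ = Real.exp (α * P.node n.succ) * (β * (R n + S)) := by
            rw [← mul_assoc, e1]; ring
  have h1 : P.node i ≤ T := (P.node_mem i).2
  refine (key i).trans ?_
  have h2 : ∑ n ∈ Finset.univ.filter (fun n : Fin N => n.castSucc < i), R n ≤ ∑ n, R n :=
    Finset.sum_le_sum_of_subset_of_nonneg (Finset.filter_subset _ _) fun n _ _ => hR n
  have h3 : 0 ≤ ∑ n, R n := Finset.sum_nonneg fun n _ => hR n
  calc _ ≤ Real.exp (α * P.node i) * (β * ∑ n, R n) := by gcongr
    _ ≤ _ := by gcongr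

end Partition

/-! ### The discrete solution on the subintervals -/

lemma IsAdmissibleRHS.continuousOn_comp {L : ℝ} {f : ℝ → ℝ → ℝ → ℝ}
    (hf : IsAdmissibleRHS T L f) {x y : ℝ → ℝ} (hx : ContinuousOn x (Icc 0 T))
    (hy : ContinuousOn y (Icc 0 T)) : ContinuousOn (fun t => f t (x t) (y t)) (Icc 0 T) := by
  intro t₀ ht₀
  have h1 : ContinuousWithinAt (fun t => f t (x t₀) (y t₀)) (Icc 0 T) t₀ :=
    hf.continuousOn _ _ t₀ ht₀
  have h2 : Filter.Tendsto (fun t => f t (x t) (y t) - f t (x t₀) (y t₀))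
      (nhdsWithin t₀ (Icc 0 T)) (nhds 0) := by
    have h3 : Filter.Tendsto (fun t => L * (|x t - x t₀| + |y t - y t₀|))
        (nhdsWithin t₀ (Icc 0 T)) (nhds 0) := by
      have hx' : ContinuousWithinAt x (Icc 0 T) t₀ := hx t₀ ht₀
      have hy' : ContinuousWithinAt y (Icc 0 T) t₀ := hy t₀ ht₀
      have h4 : ContinuousWithinAt (fun t => L * (|x t - x t₀| + |y t - y t₀|)) (Icc 0 T) t₀ :=
        ((hx'.sub continuousWithinAt_const).abs.add
          (hy'.sub continuousWithinAt_const).abs).const_mul L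
      have h5 := h4.tendsto
      simpa using h5
    refine squeeze_zero_norm' ?_ h3
    filter_upwards [self_mem_nhdsWithin] with t ht
    exact hf.lipschitz t ht _ _ _ _
  have h6 := h2.add h1.tendsto
  simp only [sub_add_cancel, zero_add] at h6
  exact h6

lemma hasDerivAt_derivWithin {U : ℝ → ℝ} (hU : ContDiffOn ℝ 1 U (Icc 0 T)) {x : ℝ}
    (hx : x ∈ Ioo 0 T) : HasDerivAt U (derivWithin U (Icc 0 T) x) x :=
  ((hU.differentiableOn one_ne_zero) x (Ioo_subset_Icc_self hx)).hasDerivWithinAt.hasDerivAt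
    (Icc_mem_nhds hx.1 hx.2)

lemma continuousOn_derivWithin_Icc (hT : 0 < T) {U : ℝ → ℝ} (hU : ContDiffOn ℝ 1 U (Icc 0 T)) :
    ContinuousOn (derivWithin U (Icc 0 T)) (Icc 0 T) :=
  hU.continuousOn_derivWithin (uniqueDiffOn_Icc hT) le_rfl

/-- A continuous piecewise polynomial function agrees with its polynomial pieces, together with the
first derivatives, up to the end points. -/
lemma eqOn_piece (hT : 0 < T) {c d : ℝ} (hcd : c < d) (hsub : Icc c d ⊆ Icc 0 T)
    (hsub' : Ioo c d ⊆ Ioo 0 T) {U : ℝ → ℝ} (hU : ContDiffOn ℝ 1 U (Icc 0 T)) {p : ℝ[X]}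
    (hp : ∀ t ∈ Ioo c d, U t = p.eval t) :
    EqOn U (fun t => p.eval t) (Icc c d) ∧
      EqOn (derivWithin U (Icc 0 T)) (fun t => (derivative p).eval t) (Icc c d) := by
  have hcl : Icc c d ⊆ closure (Ioo c d) := (closure_Ioo hcd.ne).symm.subset
  have h1 : EqOn (derivWithin U (Icc 0 T)) (fun t => (derivative p).eval t) (Ioo c d) := by
    intro x hx
    refine (hasDerivAt_derivWithin hU (hsub' hx)).unique ((p.hasDerivAt x).congr_of_eventuallyEq ?_)
    filter_upwards [isOpen_Ioo.mem_nhds hx] with y hy using hp y hy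
  exact ⟨EqOn.of_subset_closure hp (hU.continuousOn.mono hsub) p.continuous.continuousOn
      Ioo_subset_Icc_self hcl,
    EqOn.of_subset_closure h1 ((continuousOn_derivWithin_Icc hT hU).mono hsub)
      (derivative p).continuous.continuousOn Ioo_subset_Icc_self hcl⟩

/-- The Galerkin equations say that `U''` is, on every subinterval, the projection of
`f(t, U, U')`. -/
lemma IsCPGSolution.isPolyProj (hT : 0 < T) {L : ℝ} {f : ℝ → ℝ → ℝ → ℝ}
    (hf : IsAdmissibleRHS T L f) {P : Partition T N} {r : Fin N → ℕ} (hr : ∀ n, 3 ≤ r n)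
    {u₀ u₁ : ℝ} {U : ℝ → ℝ} (hU : IsCPGSolution P r f u₀ u₁ U) (n : Fin N) {p : ℝ[X]}
    (hpd : p.natDegree ≤ r n) (hp : ∀ t ∈ Ioo (P.left n) (P.right n), U t = p.eval t) :
    IsPolyProj (P.left n) (P.right n) (r n - 2)
      (fun t => f t (U t) (derivWithin U (Icc 0 T) t)) (derivative (derivative p)) := by
  classical
  have hlr := P.left_lt_right n
  have hUc := hU.isTrial.contDiffOn
  refine ⟨?_, fun q hq => ?_⟩
  · have h1 := natDegree_derivative_le p
    have h2 := natDegree_derivative_le (derivative p)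
    omega
  -- test with a polynomial supported on the single subinterval `n`
  let φ : ℝ → ℝ := (Ioo (P.left n) (P.right n)).indicator fun t => q.eval t
  have hφn : ∀ t ∈ Ioo (P.left n) (P.right n), φ t = q.eval t := fun t ht =>
    indicator_of_mem ht _
  have hφm : ∀ m ≠ n, ∀ t ∈ Ioo (P.left m) (P.right m), φ t = 0 := fun m hm t ht =>
    indicator_of_notMem (Set.disjoint_left.1 (P.disjoint_Ioo hm) ht) _
  have htest : IsTest P r φ := fun m => by
    rcases eq_or_ne m n with rfl | hm
    · exact ⟨q, by have := hr m; omega, hφn⟩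
    · refine ⟨0, by have := hr m; simp; omega, fun t ht => ?_⟩
      rw [hφm m hm t ht, eval_zero]
  have h := hU.galerkin φ htest
  have hzero : ∀ g : ℝ → ℝ, ∀ m ≠ n, ∫ t in Ioo (P.left m) (P.right m), g t * φ t = 0 :=
    fun g m hm => setIntegral_eq_zero_of_forall_eq_zero fun t ht => by
      rw [hφm m hm t ht, mul_zero]
  rw [Finset.sum_eq_single n (fun m _ hm => hzero _ m hm) (by simp),
    Finset.sum_eq_single n (fun m _ hm => hzero _ m hm) (by simp)] at h
  have hdd : ∀ t ∈ Ioo (P.left n) (P.right n),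
      iteratedDeriv 2 U t = (derivative (derivative p)).eval t := fun t ht => by
    have hev : U =ᶠ[nhds t] fun t => p.eval t := by
      filter_upwards [isOpen_Ioo.mem_nhds ht] with y hy using hp y hy
    rw [hev.iteratedDeriv_eq, iteratedDeriv_succ, iteratedDeriv_one]
    have : deriv (fun t => p.eval t) = fun t => (derivative p).eval t := funext fun y => p.deriv
    rw [this, Polynomial.deriv]
  have hd : ∀ t ∈ Ioo (P.left n) (P.right n), deriv U t = derivWithin U (Icc 0 T) t := fun t ht =>
    (hasDerivAt_derivWithin hUc (P.Ioo_subset n ht)).deriv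
  have e1 : ∫ t in Ioo (P.left n) (P.right n), iteratedDeriv 2 U t * φ t =
      ∫ t in P.left n..P.right n, (derivative (derivative p)).eval t * q.eval t := by
    rw [← setIntegral_Ioo_eq hlr.le]
    refine setIntegral_congr_fun measurableSet_Ioo fun t ht => ?_
    simp only [hdd t ht, hφn t ht]
  have e2 : ∫ t in Ioo (P.left n) (P.right n), f t (U t) (deriv U t) * φ t =
      ∫ t in P.left n..P.right n, f t (U t) (derivWithin U (Icc 0 T) t) * q.eval t := by
    rw [← setIntegral_Ioo_eq hlr.le]
    refine setIntegral_congr_fun measurableSet_Ioo fun t ht => ?_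
    simp only [hd t ht, hφn t ht]
  rw [e1, e2] at h
  have hG : ContinuousOn (fun t => f t (U t) (derivWithin U (Icc 0 T) t))
      (Icc (P.left n) (P.right n)) :=
    (hf.continuousOn_comp hUc.continuousOn (continuousOn_derivWithin_Icc hT hUc)).mono
      (P.Icc_subset n)
  simp only [sub_mul]
  rw [intervalIntegral.integral_sub ((memL2_of_continuousOn hG).intervalIntegrable_mul hlr.le
    (memL2_eval q)) ((memL2_eval _).intervalIntegrable_mul hlr.le (memL2_eval q)), h, sub_self]

end CPG

/-! ### Stability of the scheme -/

namespace CPG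

open Polynomial

variable {T : ℝ} {N : ℕ}

lemma isWeakDeriv_one_off_countable {T : ℝ} (hT : 0 ≤ T) {g g' : ℝ → ℝ}
    {S : Set ℝ} (hS : S.Countable) (hg : ContinuousOn g (Icc 0 T))
    (hd : ∀ x ∈ Ioo 0 T \ S, HasDerivAt g (g' x) x) (hg' : IntervalIntegrable g' volume 0 T) :
    IsWeakDeriv 1 0 T g g' := by
  refine isWeakDeriv_one_of_eq_primitive hT (c := g 0) hg' fun x hx => ?_
  rw [integral_eq_of_hasDerivAt_off_countable_of_le g g' hx.1.le hS
    (hg.mono (Icc_subset_Icc_right hx.2.le))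
    (fun y hy => hd y ⟨⟨hy.1.1, hy.1.2.trans hx.2⟩, hy.2⟩)
    (hg'.mono_set (by
      rw [uIcc_of_le hT, uIcc_of_le hx.1.le]; exact Icc_subset_Icc_right hx.2.le))]
  ring

/-- A continuous function with piecewise continuous derivative has a square integrable weak
derivative, which agrees on each subinterval with the given pieces `g' n`. -/
lemma Partition.exists_weakDeriv (P : Partition T N) (hT : 0 < T) {g : ℝ → ℝ}
    {g' : Fin N → ℝ → ℝ} (hg : ContinuousOn g (Icc 0 T))
    (hg' : ∀ n, ContinuousOn (g' n) (Icc (P.left n) (P.right n)))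
    (hd : ∀ n, ∀ x ∈ Ioo (P.left n) (P.right n), HasDerivAt g (g' n x) x) :
    ∃ W : ℝ → ℝ, IsWeakDeriv 1 0 T g W ∧ MemL2 0 T W ∧
      ∀ n, ∀ x ∈ Ioo (P.left n) (P.right n), W x = g' n x := by
  let W : ℝ → ℝ := fun x => ∑ n, (Ioo (P.left n) (P.right n)).indicator (g' n) x
  have hW : ∀ n, ∀ x ∈ Ioo (P.left n) (P.right n), W x = g' n x := fun n x hx => by
    simp only [W]
    rw [Finset.sum_eq_single n, indicator_of_mem hx]
    · intro m _ hm
      exact indicator_of_notMem (Set.disjoint_right.1 (P.disjoint_Ioo hm) hx) _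
    · simp
  have hmem : MemL2 0 T W := by
    refine memLp_finsetSum _ fun n _ => ?_
    rw [memLp_indicator_iff_restrict measurableSet_Ioo,
      Measure.restrict_restrict measurableSet_Ioo,
      inter_eq_self_of_subset_left (P.Ioo_subset n)]
    exact memL2_of_continuousOn (hg' n)
  refine ⟨W, ?_, hmem, hW⟩
  refine isWeakDeriv_one_off_countable hT.le (Set.finite_range P.node).countable hg
    (fun x hx => ?_) (hmem.intervalIntegrable hT.le)
  obtain ⟨n, hn⟩ := P.exists_mem_Ioo hx.1 hx.2
  rw [hW n x hn]
  exact hd n x hn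

lemma Partition.eL2_sq_eq_ofReal_sum (P : Partition T N) {g : ℝ → ℝ} {g' : Fin N → ℝ → ℝ}
    (hg' : ∀ n, ContinuousOn (g' n) (Icc (P.left n) (P.right n)))
    (h : ∀ n, ∀ x ∈ Ioo (P.left n) (P.right n), g x = g' n x) :
    eL2 0 T g ^ 2 = ENNReal.ofReal (∑ n, ∫ x in P.left n..P.right n, g' n x ^ 2) := by
  rw [← P.sum_eL2_sq, ENNReal.ofReal_sum_of_nonneg fun n _ =>
    intervalIntegral.integral_nonneg (P.left_lt_right n).le fun x _ => sq_nonneg _]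
  refine Finset.sum_congr rfl fun n _ => ?_
  rw [← eL2_sq (P.left_lt_right n).le (memL2_of_continuousOn (hg' n))]
  congr 1
  refine eLpNorm_congr_ae ?_
  filter_upwards [ae_restrict_mem measurableSet_Ioo] with x hx using h n x hx

/-- The stability estimate: the errors are controlled by the `L²` projection errors `B n` of `u''`
on the subintervals, in the `H¹` norm with an additional factor of order `k_n² / r_n²`. -/
theorem stability (T L : ℝ) (hT : 0 < T) :
    ∃ k₀ : ℝ, 0 < k₀ ∧ ∃ C : ℝ, 0 < C ∧
      ∀ (f : ℝ → ℝ → ℝ → ℝ) (u₀ u₁ : ℝ) (u : ℝ → ℝ),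
        IsAdmissibleRHS T L f → IsExactSolution T f u₀ u₁ u →
      ∃ F : ℝ → ℝ, IsWeakDeriv 2 0 T u F ∧
      ∀ (N : ℕ) (P : Partition T N) (r : Fin N → ℕ) (U : ℝ → ℝ),
        (∀ n, P.step n ≤ k₀) → (∀ n, 3 ≤ r n) → IsCPGSolution P r f u₀ u₁ U →
      ∃ B : Fin N → ℝ, (∀ n, 0 ≤ B n) ∧
        (∀ n, ENNReal.ofReal (B n) ≤ bestApprox (P.left n) (P.right n) (r n - 2) F ^ 2) ∧
        MemSobolev 2 0 T (u - U) ∧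
        sobolevNorm 1 0 T (u - U) ^ 2 ≤
          C * ∑ n, (P.step n / 2) ^ 2 / ((r n : ℝ) * ((r n : ℝ) - 1)) * B n ∧
        sobolevNorm 2 0 T (u - U) ^ 2 ≤ C * ∑ n, B n := by
  let c : ℝ := 2 + 4 * L ^ 2
  have hc : 0 < c := by positivity
  let E : ℝ := Real.exp (2 * c * T) * (8 * L ^ 2)
  have hE : 0 ≤ E := by positivity
  let C₀ : ℝ := (2 + 4 * T * E + 16 * L ^ 2 * T) * (1 + T ^ 2)
  have hC₀ : 0 < C₀ := by positivity
  -- `k₀` makes `c * k_n ≤ 1 / 2`, as `local_error` requires; `E` bounds the nodal errors by the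
  -- Gronwall inequality with rate `2 * c`
  refine ⟨1 / (2 * c), by positivity, (1 + 4 * L ^ 2) * C₀ * (1 + T ^ 2) + 2, by positivity, ?_⟩
  rintro f u₀ u₁ u hf ⟨v, hu, hv, hu0, hv0⟩
  have huc : ContinuousOn u (Icc 0 T) := fun t ht => (hu t ht).continuousWithinAt
  have hvc : ContinuousOn v (Icc 0 T) := fun t ht => (hv t ht).continuousWithinAt
  have hud : ∀ t ∈ Ioo 0 T, HasDerivAt u (v t) t := fun t ht =>
    (hu t (Ioo_subset_Icc_self ht)).hasDerivAt (Icc_mem_nhds ht.1 ht.2)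
  set F : ℝ → ℝ := fun t => f t (u t) (v t)
  have hvd : ∀ t ∈ Ioo 0 T, HasDerivAt v (F t) t := fun t ht =>
    (hv t (Ioo_subset_Icc_self ht)).hasDerivAt (Icc_mem_nhds ht.1 ht.2)
  have hFc : ContinuousOn F (Icc 0 T) := hf.continuousOn_comp huc hvc
  refine ⟨F, (isWeakDeriv_one_of_hasDerivAt hT.le huc hvc hud).comp
    (isWeakDeriv_one_of_hasDerivAt hT.le hvc hFc hvd), ?_⟩
  intro N P r U hstep hr hU
  have hUc := hU.isTrial.contDiffOn
  set V := derivWithin U (Icc 0 T)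
  have hVc : ContinuousOn V (Icc 0 T) := continuousOn_derivWithin_Icc hT hUc
  choose p hpdeg hp using hU.isTrial.piecewise
  have hUp : ∀ n, EqOn U (fun t => (p n).eval t) (Icc (P.left n) (P.right n)) := fun n =>
    (eqOn_piece hT (P.left_lt_right n) (P.Icc_subset n) (P.Ioo_subset n) hUc (hp n)).1
  have hVp : ∀ n, EqOn V (fun t => (derivative (p n)).eval t) (Icc (P.left n) (P.right n)) :=
    fun n =>
    (eqOn_piece hT (P.left_lt_right n) (P.Icc_subset n) (P.Ioo_subset n) hUc (hp n)).2
  have hproj := fun n => hU.isPolyProj hT hf hr n (hpdeg n) (hp n)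
  have hGc : ContinuousOn (fun t => f t (U t) (V t)) (Icc 0 T) :=
    hf.continuousOn_comp hUc.continuousOn hVc
  have hcP : ∀ (n : Fin N) (Q : ℝ[X]), ContinuousOn (fun x => Q.eval x)
      (Icc (P.left n) (P.right n)) := fun n Q => Q.continuous.continuousOn
  have hFn := fun n => hFc.mono (P.Icc_subset n)
  have hun := fun n => huc.mono (P.Icc_subset n)
  have hvn := fun n => hvc.mono (P.Icc_subset n)
  choose q hq using fun n => PolyInterval.exists_isPolyProj (P.left_lt_right n) (r n - 2)
    ((memL2_of_continuousOn (hFn n)).intervalIntegrable (P.left_lt_right n).le)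
  set B : Fin N → ℝ := fun n => ∫ x in P.left n..P.right n, (F x - (q n).eval x) ^ 2
  have hB0 : ∀ n, 0 ≤ B n := fun n =>
    intervalIntegral.integral_nonneg (P.left_lt_right n).le fun x _ => sq_nonneg _
  have hmF := fun n => memL2_of_continuousOn (hFn n)
  -- errors at the nodes and on the subintervals
  let A : Fin (N + 1) → ℝ := fun i => (u (P.node i) - U (P.node i)) ^ 2 +
    (v (P.node i) - V (P.node i)) ^ 2
  let X : Fin N → ℝ := fun n => ∫ x in P.left n..P.right n,
    ((u x - (p n).eval x) ^ 2 + (v x - (derivative (p n)).eval x) ^ 2)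
  let Y : Fin N → ℝ := fun n => ∫ x in P.left n..P.right n,
    (F x - (derivative (derivative (p n))).eval x) ^ 2
  let w : Fin N → ℝ := fun n => (P.step n / 2) ^ 2 / ((r n : ℝ) * ((r n : ℝ) - 1)) * B n
  let R : Fin N → ℝ := fun n => (1 + T ^ 2) * w n
  have hr3 : ∀ n, (3 : ℝ) ≤ r n := fun n => by exact_mod_cast hr n
  have hw0 : ∀ n, 0 ≤ w n := fun n => by
    have h1 := hr3 n
    have h2 : (0 : ℝ) ≤ (r n : ℝ) * ((r n : ℝ) - 1) := mul_nonneg (by linarith) (by linarith)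
    exact mul_nonneg (div_nonneg (sq_nonneg _) h2) (hB0 n)
  have hR0 : ∀ n, 0 ≤ R n := fun n => mul_nonneg (by positivity) (hw0 n)
  have hA0 : ∀ i, 0 ≤ A i := fun i => by positivity
  have hloc := fun n => local_error (P.left_lt_right n) (P.step_le n) (hr n) (hun n) (hvn n)
    (hFn n) (hGc.mono (P.Icc_subset n)) (fun x hx => hud x (P.Ioo_subset n hx))
    (fun x hx => hvd x (P.Ioo_subset n hx)) (hproj n) (hq n) (L := L)
    (fun x hx => by
      have e0 : U x = (p n).eval x := hUp n hx
      have e1 : V x = (derivative (p n)).eval x := hVp n hx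
      rw [← e0, ← e1]
      exact hf.lipschitz x (P.Icc_subset n hx) (u x) (v x) (U x) (V x))
    (by
      have h1 : P.right n - P.left n ≤ 1 / (2 * c) := hstep n
      calc c * (P.right n - P.left n) ≤ c * (1 / (2 * c)) := by gcongr
        _ = 1 / 2 := by field_simp)
    (A := A n.castSucc) (A' := A n.succ) (X := X n) (B := B n) (R := R n)
    (by
      have hm := left_mem_Icc.2 (P.left_lt_right n).le
      change (u (P.left n) - U (P.left n)) ^ 2 + (v (P.left n) - V (P.left n)) ^ 2 = _
      rw [hUp n hm, hVp n hm])
    (by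
      have hm := right_mem_Icc.2 (P.left_lt_right n).le
      change (u (P.right n) - U (P.right n)) ^ 2 + (v (P.right n) - V (P.right n)) ^ 2 = _
      rw [hUp n hm, hVp n hm]) rfl rfl rfl
  have hAstart : A 0 = 0 := by
    have h1 : U 0 = u₀ := hU.initial
    have h2 : V 0 = u₁ := hU.initial_deriv
    simp only [A, P.node_zero, hu0, hv0, h1, h2, sub_self]
    norm_num
  have hAle : ∀ i, A i ≤ E * ∑ n, R n := fun i => by
    have h1 := P.gronwall (α := 2 * c) (β := 8 * L ^ 2) (by positivity) (by positivity) hAstart hR0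
      hA0 (fun n => (hloc n).1) i
    rwa [← mul_assoc] at h1
  set M := ∑ n, R n
  have hM0 : 0 ≤ M := Finset.sum_nonneg fun n _ => hR0 n
  have hXsum : ∑ n, X n ≤ C₀ * ∑ n, w n := by
    have h1 : ∀ n, X n ≤ 2 * R n + 4 * E * M * P.step n + 16 * L ^ 2 * T * R n := fun n => by
      have h2 : X n ≤ 2 * R n + 4 * P.step n * (A n.castSucc + 4 * L ^ 2 * R n) := (hloc n).2.1
      have h3 := mul_le_mul_of_nonneg_left (hAle n.castSucc)
        (by have := (P.step_pos n).le; positivity : 0 ≤ 4 * P.step n)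
      have h4 := mul_le_mul_of_nonneg_right (P.step_le n)
        (by have := hR0 n; positivity : 0 ≤ 16 * L ^ 2 * R n)
      linarith
    calc ∑ n, X n ≤ ∑ n, (2 * R n + 4 * E * M * P.step n + 16 * L ^ 2 * T * R n) :=
          Finset.sum_le_sum fun n _ => h1 n
      _ = (2 + 4 * T * E + 16 * L ^ 2 * T) * M := by
          have s1 : ∑ n, 2 * R n = 2 * M := (Finset.mul_sum _ _ _).symm
          have s2 : ∑ n, 16 * L ^ 2 * T * R n = 16 * L ^ 2 * T * M := (Finset.mul_sum _ _ _).symm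
          rw [Finset.sum_add_distrib, Finset.sum_add_distrib, s1, s2, ← Finset.mul_sum, P.sum_step]
          ring
      _ = C₀ * ∑ n, w n := by
          have s1 : M = (1 + T ^ 2) * ∑ n, w n := (Finset.mul_sum _ _ _).symm
          rw [s1]; ring
  have hwB : ∑ n, w n ≤ (1 + T ^ 2) * ∑ n, B n := by
    rw [Finset.mul_sum]
    refine Finset.sum_le_sum fun n _ => mul_le_mul_of_nonneg_right ?_ (hB0 n)
    have h1 := hr3 n
    have h2 : (1 : ℝ) ≤ (r n : ℝ) * ((r n : ℝ) - 1) := by nlinarith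
    have h3 : (P.step n / 2) ^ 2 ≤ T ^ 2 :=
      pow_le_pow_left₀ (by have := P.step_pos n; linarith)
        (by have := P.step_le n; have := P.step_pos n; linarith) 2
    calc (P.step n / 2) ^ 2 / ((r n : ℝ) * ((r n : ℝ) - 1)) ≤ (P.step n / 2) ^ 2 :=
          div_le_self (sq_nonneg _) h2
      _ ≤ 1 + T ^ 2 := by linarith
  have hX0 : ∀ n, 0 ≤ X n := fun n =>
    intervalIntegral.integral_nonneg (P.left_lt_right n).le fun x _ => by positivity
  have hY0 : ∀ n, 0 ≤ Y n := fun n =>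
    intervalIntegral.integral_nonneg (P.left_lt_right n).le fun x _ => sq_nonneg _
  have hYsum : ∑ n, Y n ≤ 2 * ∑ n, B n + 4 * L ^ 2 * ∑ n, X n := by
    rw [Finset.mul_sum, Finset.mul_sum, ← Finset.sum_add_distrib]
    exact Finset.sum_le_sum fun n _ => (hloc n).2.2
  -- weak derivatives of the error
  have hw1 : IsWeakDeriv 1 0 T (u - U) (v - V) :=
    isWeakDeriv_one_of_hasDerivAt hT.le (huc.sub hUc.continuousOn) (hvc.sub hVc)
      fun x hx => (hud x hx).sub (hasDerivAt_derivWithin hUc hx)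
  obtain ⟨W, hW1, -, hWp⟩ := P.exists_weakDeriv hT (g := v - V)
    (g' := fun n x => F x - (derivative (derivative (p n))).eval x) (hvc.sub hVc)
    (fun n => (hFn n).sub (hcP n _)) (fun n x hx => by
      refine (hvd x (P.Ioo_subset n hx)).sub
        (((derivative (p n)).hasDerivAt x).congr_of_eventuallyEq ?_)
      filter_upwards [isOpen_Ioo.mem_nhds hx] with y hy using hVp n (Ioo_subset_Icc_self hy))
  let D : ℕ → ℝ → ℝ := fun j => if j = 0 then u - U else if j = 1 then v - V else W
  have hD2 : ∀ j ≤ 2, IsWeakDeriv j 0 T (u - U) (D j) := by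
    intro j hj
    interval_cases j
    · exact isWeakDeriv_zero_self hw1.1
    · exact hw1
    · exact hw1.comp hW1
  have hn0 : eL2 0 T (D 0) ^ 2 =
      ENNReal.ofReal (∑ n, ∫ x in P.left n..P.right n, (u x - (p n).eval x) ^ 2) :=
    P.eL2_sq_eq_ofReal_sum (fun n => (hun n).sub (hcP n _)) fun n x hx => by
      simp [D, hUp n (Ioo_subset_Icc_self hx)]
  have hn1 : eL2 0 T (D 1) ^ 2 =
      ENNReal.ofReal (∑ n, ∫ x in P.left n..P.right n, (v x - (derivative (p n)).eval x) ^ 2) :=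
    P.eL2_sq_eq_ofReal_sum (fun n => (hvn n).sub (hcP n _)) fun n x hx => by
      simp [D, hVp n (Ioo_subset_Icc_self hx)]
  have hn2 : eL2 0 T (D 2) ^ 2 = ENNReal.ofReal (∑ n, Y n) :=
    P.eL2_sq_eq_ofReal_sum (fun n => (hFn n).sub (hcP n _)) hWp
  have hn01 : eL2 0 T (D 0) ^ 2 + eL2 0 T (D 1) ^ 2 = ENNReal.ofReal (∑ n, X n) := by
    rw [hn0, hn1, ← ENNReal.ofReal_add, ← Finset.sum_add_distrib]
    · congr 1
      refine Finset.sum_congr rfl fun n _ => (intervalIntegral.integral_add ?_ ?_).symm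
      · exact (((hun n).sub (hcP n _)).pow 2).intervalIntegrable_of_Icc (P.left_lt_right n).le
      · exact (((hvn n).sub (hcP n _)).pow 2).intervalIntegrable_of_Icc (P.left_lt_right n).le
    all_goals
      exact Finset.sum_nonneg fun n _ =>
        intervalIntegral.integral_nonneg (P.left_lt_right n).le fun x _ => sq_nonneg _
  have hN1 : eSobolevNorm 1 0 T (u - U) ^ 2 = ENNReal.ofReal (∑ n, X n) := by
    rw [eSobolevNorm_one, eSobolevNormNat_sq fun j hj => hD2 j (by omega), Finset.sum_range_succ,
      Finset.sum_range_one, hn01]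
  have hN2 : eSobolevNorm 2 0 T (u - U) ^ 2 = ENNReal.ofReal (∑ n, X n + ∑ n, Y n) := by
    rw [eSobolevNorm_two, eSobolevNormNat_sq hD2, Finset.sum_range_succ, Finset.sum_range_succ,
      Finset.sum_range_one, hn01, hn2, ENNReal.ofReal_add]
    · exact Finset.sum_nonneg fun n _ => hX0 n
    · exact Finset.sum_nonneg fun n _ => hY0 n
  have hXt : 0 ≤ ∑ n, X n := Finset.sum_nonneg fun n _ => hX0 n
  have hYt : 0 ≤ ∑ n, Y n := Finset.sum_nonneg fun n _ => hY0 n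
  have hBt : 0 ≤ ∑ n, B n := Finset.sum_nonneg fun n _ => hB0 n
  have hwt : 0 ≤ ∑ n, w n := Finset.sum_nonneg fun n _ => hw0 n
  refine ⟨B, hB0, fun n => ?_, ?_, ?_, ?_⟩
  · have h1 := (hq n).eL2_sub_le_bestApprox (P.left_lt_right n).le (hmF n)
    have h2 : MemL2 (P.left n) (P.right n) (fun x => F x - (q n).eval x) :=
      (hmF n).sub (memL2_eval _)
    rw [← sq_le_sq_iff_ennreal, eL2_sq (P.left_lt_right n).le h2] at h1
    exact h1
  · have h1 : eSobolevNorm 2 0 T (u - U) ^ 2 < ⊤ := by rw [hN2]; exact ENNReal.ofReal_lt_top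
    exact (ENNReal.pow_lt_top_iff.1 h1).resolve_right two_ne_zero
  · rw [sobolevNorm, ← ENNReal.toReal_pow, hN1, ENNReal.toReal_ofReal hXt]
    refine hXsum.trans (mul_le_mul_of_nonneg_right ?_ hwt)
    have h1 : C₀ * 1 ≤ C₀ * ((1 + 4 * L ^ 2) * (1 + T ^ 2)) := by
      gcongr
      nlinarith [sq_nonneg L, sq_nonneg T, mul_nonneg (sq_nonneg L) (sq_nonneg T)]
    linarith
  · rw [sobolevNorm, ← ENNReal.toReal_pow, hN2, ENNReal.toReal_ofReal (add_nonneg hXt hYt)]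
    have h1 : ∑ n, X n ≤ C₀ * ((1 + T ^ 2) * ∑ n, B n) :=
      hXsum.trans (mul_le_mul_of_nonneg_left hwB hC₀.le)
    have h2 := mul_le_mul_of_nonneg_left h1 (by positivity : 0 ≤ 1 + 4 * L ^ 2)
    linarith

end CPG

/-! ### Error estimates -/

namespace CPG

variable {T : ℝ} {N : ℕ}

lemma le_of_bestApprox_sq {a b : ℝ} (hab : a < b) {r : ℕ} {s : ℝ} (hs : 1 ≤ s) (hsr : s ≤ r)
    {u F : ℝ → ℝ} (hF : IsWeakDeriv 2 a b u F) (hu : MemSobolev (s + 1) a b u) {B : ℝ}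
    (hB : ENNReal.ofReal B ≤ bestApprox a b (r - 2) F ^ 2) :
    B ≤ 16 * (((b - a) / 2) ^ (2 * s - 2) * hpFactor r s * sobolevNorm (s + 1) a b u ^ 2) := by
  have hk : 0 < (b - a) / 2 := by linarith
  have hC := hpConst_pos (sub_pos.2 hab) hs hsr
  have hfac := hpFactor_pos hs hsr
  have h1 := bestApprox_le_eSobolevNorm hab hs hsr hF
  have h2 := hB.trans (sq_le_sq_iff_ennreal.2 h1)
  rw [← ENNReal.ofReal_toReal hu.ne, ← ENNReal.ofReal_mul (by linarith),
    ← ENNReal.ofReal_pow (by positivity), ENNReal.ofReal_le_ofReal_iff (by positivity)] at h2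
  refine h2.trans (le_of_eq ?_)
  have h3 : hpConst (b - a) r s ^ 2 = ((b - a) / 2) ^ (2 * s - 2) * hpFactor r s := by
    rw [hpConst, mul_pow, Real.sq_sqrt hfac.le, ← Real.rpow_mul_natCast hk.le]
    congr 2
    push_cast
    ring
  rw [sobolevNorm, mul_pow, mul_pow, h3]
  ring

/-- The `hp` error estimates on a general partition. -/
theorem error_estimate (T L : ℝ) (hT : 0 < T) :
    ∃ k₀ : ℝ, 0 < k₀ ∧ ∃ C : ℝ, 0 < C ∧
      ∀ (f : ℝ → ℝ → ℝ → ℝ) (u₀ u₁ : ℝ) (u : ℝ → ℝ),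
        IsAdmissibleRHS T L f → IsExactSolution T f u₀ u₁ u →
      ∀ (N : ℕ) (P : Partition T N) (r : Fin N → ℕ) (U : ℝ → ℝ),
        (∀ n, P.step n ≤ k₀) → (∀ n, 3 ≤ r n) → IsCPGSolution P r f u₀ u₁ U →
      ∀ s : Fin N → ℝ, (∀ n, 1 ≤ s n) → (∀ n, s n ≤ r n) →
        (∀ n, MemSobolev (s n + 1) (P.left n) (P.right n) u) →
        MemSobolev 2 0 T (u - U) ∧
        sobolevNorm 1 0 T (u - U) ^ 2 ≤
          C * ∑ n, (P.step n / 2) ^ (2 * s n) * hpFactor (r n) (s n) *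
            (1 / ((r n : ℝ) * ((r n : ℝ) - 1))) *
            sobolevNorm (s n + 1) (P.left n) (P.right n) u ^ 2 ∧
        sobolevNorm 2 0 T (u - U) ^ 2 ≤
          C * ∑ n, (P.step n / 2) ^ (2 * s n - 2) * hpFactor (r n) (s n) *
            sobolevNorm (s n + 1) (P.left n) (P.right n) u ^ 2 := by
  obtain ⟨k₀, hk₀, C, hC, hstab⟩ := stability T L hT
  refine ⟨k₀, hk₀, 16 * C, by positivity, ?_⟩
  intro f u₀ u₁ u hf hu N P r U hstep hr hU s hs hsr hmem
  obtain ⟨F, hF, hstab⟩ := hstab f u₀ u₁ u hf hu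
  obtain ⟨B, hB0, hB, hmem2, h1, h2⟩ := hstab N P r U hstep hr hU
  have hBle := fun n => le_of_bestApprox_sq (P.left_lt_right n) (hs n) (hsr n)
    (hF.mono (P.Ioo_subset n)) (hmem n) (hB n)
  have hk := fun n => half_pos (P.step_pos n)
  refine ⟨hmem2, h1.trans ?_, h2.trans ?_⟩
  · rw [mul_comm 16 C, mul_assoc]
    refine mul_le_mul_of_nonneg_left ?_ hC.le
    rw [Finset.mul_sum]
    refine Finset.sum_le_sum fun n _ => ?_
    have hr3 : (3 : ℝ) ≤ r n := by exact_mod_cast hr n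
    have hrr : (0 : ℝ) < (r n : ℝ) * ((r n : ℝ) - 1) := mul_pos (by linarith) (by linarith)
    have e1 : (P.step n / 2) ^ (2 * s n) =
        (P.step n / 2) ^ 2 * (P.step n / 2) ^ (2 * s n - 2) := by
      rw [← Real.rpow_natCast, ← Real.rpow_add (hk n)]
      congr 1
      push_cast
      ring
    have e2 := mul_le_mul_of_nonneg_left (hBle n)
      (by positivity : 0 ≤ (P.step n / 2) ^ 2 / ((r n : ℝ) * ((r n : ℝ) - 1)))
    refine e2.trans (le_of_eq ?_)
    rw [e1, Partition.step]
    ring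
  · rw [mul_comm 16 C, mul_assoc]
    refine mul_le_mul_of_nonneg_left ?_ hC.le
    rw [Finset.mul_sum]
    exact Finset.sum_le_sum fun n _ => hBle n

lemma Partition.sum_sobolevNorm_sq_le (P : Partition T N) {σ : ℝ} {u : ℝ → ℝ}
    (hu : MemSobolev σ 0 T u) :
    ∑ n, sobolevNorm σ (P.left n) (P.right n) u ^ 2 ≤ 2 * sobolevNorm σ 0 T u ^ 2 := by
  have h := sum_eSobolevNorm_sq_le P.disjoint_Ioo P.Ioo_subset σ u
  have hn := fun n => (hu.mono_interval (P.Ioo_subset n)).ne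
  have h1 := ENNReal.toReal_mono (ENNReal.mul_ne_top ENNReal.ofNat_ne_top
    (ENNReal.pow_ne_top hu.ne)) h
  rw [ENNReal.toReal_sum fun n _ => ENNReal.pow_ne_top (hn n)] at h1
  simpa [sobolevNorm] using h1

/-- The norm of order `min r s + 1`, with `r` an integer, is controlled by the norm of order
`s + 1`. -/
lemma sobolevNorm_min_sq_le {r : ℕ} {s : ℝ} (hs : 1 ≤ s) {u : ℝ → ℝ}
    (hu : MemSobolev (s + 1) 0 T u) :
    sobolevNorm (min (r : ℝ) s + 1) 0 T u ^ 2 ≤ 8 * sobolevNorm (s + 1) 0 T u ^ 2 := by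
  rcases le_or_gt s r with h | h
  · rw [min_eq_right h]
    have := sq_nonneg (sobolevNorm (s + 1) 0 T u)
    linarith
  · rw [min_eq_left h.le]
    have hfl : r + 1 ≤ ⌊s + 1⌋₊ := Nat.le_floor (by push_cast; linarith)
    have h1 := eSobolevNormNat_le_eSobolevNorm (a := 0) (b := T) (by linarith) hfl u
    rw [← eSobolevNorm_natCast, Nat.cast_add, Nat.cast_one] at h1
    have h2 := ENNReal.toReal_mono (ENNReal.mul_ne_top ENNReal.ofReal_ne_top hu.ne) h1
    rw [ENNReal.toReal_mul, ENNReal.toReal_ofReal (Real.sqrt_nonneg _)] at h2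
    have h3 := pow_le_pow_left₀ ENNReal.toReal_nonneg h2 2
    rwa [mul_pow, Real.sq_sqrt (by norm_num)] at h3

/-- For fixed `s`, the Gamma quotient of order `min r s` decays like `r^(2 - 2s)`; the finitely many
`r < s` only affect the constant. -/
lemma exists_hpFactor_min_le (s : ℝ) (hs : 1 ≤ s) : ∃ K : ℝ, 0 < K ∧ ∀ r : ℕ, 3 ≤ r →
    hpFactor r (min (r : ℝ) s) ≤ K * (r : ℝ) ^ (-(2 * s - 2)) := by
  obtain ⟨K, hK, h⟩ := exists_hpFactor_le s hs
  refine ⟨K + s ^ (2 * s - 2), by positivity, fun r hr => ?_⟩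
  have hr3 : (3 : ℝ) ≤ r := by exact_mod_cast hr
  have hpow : (0 : ℝ) < (r : ℝ) ^ (-(2 * s - 2)) := Real.rpow_pos_of_pos (by linarith) _
  have hs0 : 0 < s ^ (2 * s - 2) := by positivity
  rw [add_mul]
  rcases le_or_gt s r with hsr | hsr
  · rw [min_eq_right hsr]
    have := h r hsr
    have := mul_pos hs0 hpow
    linarith
  · rw [min_eq_left hsr.le]
    have h1 : hpFactor r r ≤ 1 := by
      have e1 : Real.Gamma ((r : ℝ) + r - 1) = (2 * r - 2).factorial := by
        rw [← Real.Gamma_nat_eq_factorial]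
        congr 1
        push_cast [show 2 ≤ 2 * r by omega]
        ring
      rw [hpFactor, e1, sub_self, zero_add, Real.Gamma_one]
      exact div_le_one_of_le₀ (by exact_mod_cast Nat.factorial_pos _) (by positivity)
    have h2 : 1 ≤ s ^ (2 * s - 2) * (r : ℝ) ^ (-(2 * s - 2)) := by
      rw [Real.rpow_neg (by linarith), ← div_eq_mul_inv, one_le_div (by positivity)]
      exact Real.rpow_le_rpow (by linarith) hsr.le (by linarith)
    have := mul_pos hK hpow
    linarith

/-- For a uniform degree `r` the sum in the error estimate is bounded through the mesh size and the
global norm: the step sizes are at most the mesh size, the Gamma quotient decays like a power of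
`r`, and the local norms add up. -/
lemma sum_error_terms_le (P : Partition T N) {r : ℕ} (hr : 3 ≤ r) {s K : ℝ} (hs : 1 ≤ s)
    (hfac : hpFactor r (min (r : ℝ) s) ≤ K * (r : ℝ) ^ (-(2 * s - 2)))
    {u : ℝ → ℝ} (hu : MemSobolev (s + 1) 0 T u) {α : ℝ} (hα : 0 ≤ α) :
    ∑ n, (P.step n / 2) ^ α * hpFactor r (min (r : ℝ) s) *
        sobolevNorm (min (r : ℝ) s + 1) (P.left n) (P.right n) u ^ 2 ≤
      16 * K * (P.meshSize ^ α * (r : ℝ) ^ (-(2 * s - 2)) * sobolevNorm (s + 1) 0 T u ^ 2) := by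
  have hr3 : (3 : ℝ) ≤ r := by exact_mod_cast hr
  have hτ1 : 1 ≤ min (r : ℝ) s := le_min (by linarith) hs
  have hfac0 := hpFactor_pos hτ1 (min_le_left (r : ℝ) s)
  have hmem : MemSobolev (min (r : ℝ) s + 1) 0 T u :=
    hu.of_le (by linarith) (by linarith [min_le_right (r : ℝ) s])
  have hmesh : 0 ≤ P.meshSize := Real.iSup_nonneg fun n => (P.step_pos n).le
  calc ∑ n, (P.step n / 2) ^ α * hpFactor r (min (r : ℝ) s) *
        sobolevNorm (min (r : ℝ) s + 1) (P.left n) (P.right n) u ^ 2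
      ≤ ∑ n, P.meshSize ^ α * (K * (r : ℝ) ^ (-(2 * s - 2))) *
        sobolevNorm (min (r : ℝ) s + 1) (P.left n) (P.right n) u ^ 2 := by
        refine Finset.sum_le_sum fun n _ => ?_
        have h1 := P.step_pos n
        have h2 : (P.step n / 2) ^ α ≤ P.meshSize ^ α :=
          Real.rpow_le_rpow (by linarith) (by linarith [P.step_le_meshSize n]) hα
        gcongr
    _ = P.meshSize ^ α * (K * (r : ℝ) ^ (-(2 * s - 2))) *
        ∑ n, sobolevNorm (min (r : ℝ) s + 1) (P.left n) (P.right n) u ^ 2 := by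
        rw [Finset.mul_sum]
    _ ≤ P.meshSize ^ α * (K * (r : ℝ) ^ (-(2 * s - 2))) *
        (2 * (8 * sobolevNorm (s + 1) 0 T u ^ 2)) := by
        have h1 := P.sum_sobolevNorm_sq_le hmem
        have h2 := sobolevNorm_min_sq_le (r := r) hs hu
        have h3 : 0 ≤ K * (r : ℝ) ^ (-(2 * s - 2)) := hfac0.le.trans hfac
        have h4 : 0 ≤ P.meshSize ^ α := Real.rpow_nonneg hmesh α
        refine mul_le_mul_of_nonneg_left ?_ (mul_nonneg h4 h3)
        linarith
    _ = _ := by ring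

end CPG

theorem theorem3p1 (T L : ℝ) (hT : 0 < T) (hL : 0 < L) :
    ∃ k₀ : ℝ, 0 < k₀ ∧
      -- general partitions
      (∃ C : ℝ, 0 < C ∧
        ∀ (f : ℝ → ℝ → ℝ → ℝ) (u₀ u₁ : ℝ) (u : ℝ → ℝ),
          CPG.IsAdmissibleRHS T L f → CPG.IsExactSolution T f u₀ u₁ u →
          CPG.MemSobolev 2 0 T u →
        ∀ (N : ℕ) (P : CPG.Partition T N) (r : Fin N → ℕ) (U : ℝ → ℝ),
          (∀ n, P.step n ≤ k₀) → (∀ n, 3 ≤ r n) → CPG.IsCPGSolution P r f u₀ u₁ U →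
        ∀ s₀ : Fin N → ℝ, (∀ n, 1 ≤ s₀ n) →
          (∀ n, CPG.MemSobolev (s₀ n + 1) (P.left n) (P.right n) u) →
        ∀ s : Fin N → ℝ, (∀ n, 1 ≤ s n ∧ s n ≤ min (r n : ℝ) (s₀ n)) →
          CPG.MemSobolev 2 0 T (u - U) ∧
          CPG.sobolevNorm 1 0 T (u - U) ^ 2 ≤
            C * ∑ n, (P.step n / 2) ^ (2 * s n) *
              (Real.Gamma (r n - s n + 1) / Real.Gamma (r n + s n - 1)) *
              (1 / ((r n : ℝ) * ((r n : ℝ) - 1))) *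
              CPG.sobolevNorm (s n + 1) (P.left n) (P.right n) u ^ 2 ∧
          CPG.sobolevNorm 2 0 T (u - U) ^ 2 ≤
            C * ∑ n, (P.step n / 2) ^ (2 * s n - 2) *
              (Real.Gamma (r n - s n + 1) / Real.Gamma (r n + s n - 1)) *
              CPG.sobolevNorm (s n + 1) (P.left n) (P.right n) u ^ 2) ∧
      -- quasi-uniform partitions and a uniform degree
      (∀ Cq s : ℝ, 1 ≤ Cq → 1 ≤ s → ∃ C : ℝ, 0 < C ∧
        ∀ (f : ℝ → ℝ → ℝ → ℝ) (u₀ u₁ : ℝ) (u : ℝ → ℝ),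
          CPG.IsAdmissibleRHS T L f → CPG.IsExactSolution T f u₀ u₁ u →
          CPG.MemSobolev (s + 1) 0 T u →
        ∀ (N : ℕ) (P : CPG.Partition T N) (r : ℕ) (U : ℝ → ℝ),
          P.IsQuasiUniform Cq → (∀ n, P.step n ≤ k₀) → 3 ≤ r →
          CPG.IsCPGSolution P (fun _ => r) f u₀ u₁ U →
          CPG.MemSobolev 2 0 T (u - U) ∧
          CPG.sobolevNorm 1 0 T (u - U) ≤
            C * (P.meshSize ^ min (r : ℝ) s / (r : ℝ) ^ s) * CPG.sobolevNorm (s + 1) 0 T u ∧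
          CPG.sobolevNorm 2 0 T (u - U) ≤
            C * (P.meshSize ^ (min (r : ℝ) s - 1) / (r : ℝ) ^ (s - 1)) *
              CPG.sobolevNorm (s + 1) 0 T u) := by
  obtain ⟨k₀, hk₀, C, hC, hest⟩ := CPG.error_estimate T L hT
  refine ⟨k₀, hk₀, ⟨C, hC, ?_⟩, fun Cq s _ hs => ?_⟩
  · intro f u₀ u₁ u hf hu _ N P r U hstep hr hU s₀ _ hmem s hs
    exact hest f u₀ u₁ u hf hu N P r U hstep hr hU s (fun n => (hs n).1)
      (fun n => (hs n).2.trans (min_le_left _ _)) fun n =>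
      (hmem n).of_le (by linarith [(hs n).1]) (by linarith [(hs n).2.trans (min_le_right _ _)])
  obtain ⟨K, hK, hfac⟩ := CPG.exists_hpFactor_min_le s hs
  refine ⟨√(32 * C * K), by positivity, ?_⟩
  intro f u₀ u₁ u hf hu hmem N P r U _ hstep hr hU
  have hr3 : (3 : ℝ) ≤ r := by exact_mod_cast hr
  have hr0 : (0 : ℝ) < r := by linarith
  set τ := min (r : ℝ) s with hτ
  have hτ1 : 1 ≤ τ := le_min (by linarith) hs
  have hmesh : 0 ≤ P.meshSize := Real.iSup_nonneg fun n => (P.step_pos n).le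
  have hnorm : 0 ≤ CPG.sobolevNorm (s + 1) 0 T u := ENNReal.toReal_nonneg
  obtain ⟨h0, h1, h2⟩ := hest f u₀ u₁ u hf hu N P (fun _ => r) U hstep (fun _ => hr) hU
    (fun _ => τ) (fun _ => hτ1) (fun _ => min_le_left _ _) fun n =>
      (hmem.of_le (by linarith) (by linarith [min_le_right (r : ℝ) s])).mono_interval
        (P.Ioo_subset n)
  have hsq : √(32 * C * K) ^ 2 = 32 * C * K := Real.sq_sqrt (by positivity)
  refine ⟨h0, ?_, ?_⟩
  · refine le_of_sq_le_sq ?_ (by positivity)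
    have h3 := CPG.sum_error_terms_le P hr hs (hfac r hr) hmem (α := 2 * τ) (by linarith)
    have hrr : 1 / ((r : ℝ) * ((r : ℝ) - 1)) ≤ 2 * (r : ℝ) ^ (-2 : ℝ) := by
      rw [Real.rpow_neg hr0.le, Real.rpow_two, ← div_eq_mul_inv,
        div_le_div_iff₀ (by nlinarith) (by positivity)]
      nlinarith
    have e1 : P.meshSize ^ (2 * τ) = (P.meshSize ^ τ) ^ 2 := by
      rw [← Real.rpow_mul_natCast hmesh, mul_comm]; norm_num
    have e2 : (r : ℝ) ^ (-2 : ℝ) * (r : ℝ) ^ (-(2 * s - 2)) = (((r : ℝ) ^ s) ^ 2)⁻¹ := by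
      rw [← Real.rpow_add hr0, ← Real.rpow_mul_natCast hr0.le, ← Real.rpow_neg hr0.le]
      congr 1
      push_cast
      ring
    have hsum : 0 ≤ ∑ n, (P.step n / 2) ^ (2 * τ) * CPG.hpFactor r τ *
        CPG.sobolevNorm (τ + 1) (P.left n) (P.right n) u ^ 2 :=
      Finset.sum_nonneg fun n _ => by
        have := P.step_pos n
        have := CPG.hpFactor_pos hτ1 (min_le_left (r : ℝ) s)
        positivity
    calc CPG.sobolevNorm 1 0 T (u - U) ^ 2
        ≤ C * ∑ n, (P.step n / 2) ^ (2 * τ) * CPG.hpFactor r τ *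
            (1 / ((r : ℝ) * ((r : ℝ) - 1))) *
            CPG.sobolevNorm (τ + 1) (P.left n) (P.right n) u ^ 2 := h1
      _ = C * (1 / ((r : ℝ) * ((r : ℝ) - 1))) * ∑ n, (P.step n / 2) ^ (2 * τ) *
            CPG.hpFactor r τ * CPG.sobolevNorm (τ + 1) (P.left n) (P.right n) u ^ 2 := by
          rw [mul_assoc C, Finset.mul_sum _ _ (1 / ((r : ℝ) * ((r : ℝ) - 1)))]
          congr 1
          exact Finset.sum_congr rfl fun n _ => by ring
      _ ≤ C * (2 * (r : ℝ) ^ (-2 : ℝ)) * (16 * K * (P.meshSize ^ (2 * τ) *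
            (r : ℝ) ^ (-(2 * s - 2)) * CPG.sobolevNorm (s + 1) 0 T u ^ 2)) :=
          mul_le_mul (mul_le_mul_of_nonneg_left hrr hC.le) h3 hsum (by positivity)
      _ = 32 * C * K * (P.meshSize ^ (2 * τ) * ((r : ℝ) ^ (-2 : ℝ) *
            (r : ℝ) ^ (-(2 * s - 2))) * CPG.sobolevNorm (s + 1) 0 T u ^ 2) := by ring
      _ = _ := by rw [e1, e2, mul_pow, mul_pow, div_pow, hsq]; ring
  · refine le_of_sq_le_sq ?_ (by positivity)
    have h3 := CPG.sum_error_terms_le P hr hs (hfac r hr) hmem (α := 2 * τ - 2) (by linarith)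
    have e1 : P.meshSize ^ (2 * τ - 2) = (P.meshSize ^ (τ - 1)) ^ 2 := by
      rw [← Real.rpow_mul_natCast hmesh]
      congr 1
      push_cast
      ring
    have e2 : (r : ℝ) ^ (-(2 * s - 2)) = (((r : ℝ) ^ (s - 1)) ^ 2)⁻¹ := by
      rw [← Real.rpow_mul_natCast hr0.le, ← Real.rpow_neg hr0.le]
      congr 1
      push_cast
      ring
    calc CPG.sobolevNorm 2 0 T (u - U) ^ 2
        ≤ C * (16 * K * (P.meshSize ^ (2 * τ - 2) *
            (r : ℝ) ^ (-(2 * s - 2)) * CPG.sobolevNorm (s + 1) 0 T u ^ 2)) :=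
          h2.trans (mul_le_mul_of_nonneg_left h3 hC.le)
      _ ≤ 32 * C * K * (P.meshSize ^ (2 * τ - 2) *
            (r : ℝ) ^ (-(2 * s - 2)) * CPG.sobolevNorm (s + 1) 0 T u ^ 2) := by
          have : 0 ≤ C * K * (P.meshSize ^ (2 * τ - 2) *
            (r : ℝ) ^ (-(2 * s - 2)) * CPG.sobolevNorm (s + 1) 0 T u ^ 2) := by positivity
          linarith
      _ = _ := by rw [e1, e2, mul_pow, mul_pow, div_pow, hsq]; ring
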